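/- Let $\mathcal H$ be a complex Hilbert space. For a linear operator $T$ with domain $\mathcal D(T)\subset\mathcal H$ and null space $\mathcal N(T)$ we use the following terms. $T$ is *accretive* if $\operatorname{Re}\langle Tx,x\rangle\ge 0$ for all $x\in\mathcal D(T)$. $T$ is *m-accretive* if it is accretive, densely defined, and $\mathcal R(\lambda+T)=\mathcal H$ for some $\lambda>0$. For $0\le\omega<\pi/2$, $T$ is *$\omega$-accretive* if $\langle Tx,x\rangle\in\{z\in\mathbb C:|\arg z|\le\omega\}\cup\{0\}$ for all $x\in\mathcal D(T)$ with $\|x\|=1$, and *m-$\omega$-accretive* if it is moreover m-accretive. $T^2$ has domain $\{x\in\mathcal D(T):Tx\in\mathcal D(T)\}$. Let $B$ and $C$ be linear operators in $\mathcal H$ such that $B^2$ is m-accretive, $C$ is accretive, $\mathcal D(B^2)\subset\mathcal D(C)$, and there are constants $\alpha\ge0$, $0\le\beta<1$, $\delta\ge0$ with $$\operatorname{Re}\langle B^2x,Cx\rangle\ \ge\ -\alpha\|x\|^2-\beta\|B^2x\|^2-\delta\|B^2x\|\,\|x\|\qquad\text{for all }x\in\mathcal D(B^2).$$ Let $\Lambda=B^2+C$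 with domain $\mathcal D(B^2)$ (an m-accretive operator), and let $\Lambda^{1/2}$ be its square root, that is, the closure of the operator given by the Balakrishnan formula $$\Lambda^{1/2}x=\frac1\pi\int_0^\infty s^{-1/2}\,\Lambda(s+\Lambda)^{-1}x\,ds,\qquad x\in\mathcal D(\Lambda).$$ Let $Z_1=B+\Lambda^{1/2}$ with domain $\mathcal D(B)\cap\mathcal D(\Lambda^{1/2})$. **Proposition.** Suppose that $\mathcal D(\Lambda^{1/2})\subset\mathcal D(B)$ and that $B$ is accretive. Then $Z_1$ is m-$(\pi/4)$-accretive. In particular, $-Z_1$ generates a holomorphic $C_0$-semigroup of angle $\pi/4$: there are bounded operators $S(z)$, for $z=0$ and for $z\ne 0$ with $|\arg z|<\pi/4$, such that $S(0)=I$, $S(z+w)=S(z)S(w)$, $z\mapsto S(z)$ is holomorphic on the open sector, $S(z)x\to x$ for every $x\in\mathcal H$ as $z\to0$ in the sector, and $-Z_1$ is the infinitesimal generator of $(S(t))_{t\ge0}$. If, moreover, $B$ is $\theta$-accretive for some $\theta$ with $0\le\theta<\pi/2$, then $\mathcal N(Z_1)=\mathcal N(B)\cap\mathcal N(\Lambda^{1/2})$.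 -/

import Mathlib

open Filter Topology MeasureTheory

noncomputable section

namespace PencilFactor

variable {H : Type*} [NormedAddCommGroup H] [InnerProductSpace ℂ H]

/-- The numerical range `W(T) = {⟨Tx, x⟩ : x ∈ D(T), ‖x‖ = 1}` of a (possibly unbounded) linear
operator. Mathlib's `inner ℂ x y` is linear in `y`, so `⟨Tx, x⟩` is `inner ℂ x (T x)`. -/
def numericalRange (T : H →ₗ.[ℂ] H) : Set ℂ :=
  {z | ∃ x : T.domain, ‖(x : H)‖ = 1 ∧ z = inner ℂ (x : H) (T x)}

/-- `T` is accretive: `Re ⟨Tx, x⟩ ≥ 0` on the domain. -/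
def IsAccretive (T : H →ₗ.[ℂ] H) : Prop :=
  ∀ x : T.domain, 0 ≤ (inner ℂ (x : H) (T x)).re

/-- `T` is m-accretive: accretive, densely defined, and `R(s + T) = H` for some `s > 0`. -/
def IsMAccretive (T : H →ₗ.[ℂ] H) : Prop :=
  IsAccretive T ∧ Dense (T.domain : Set H) ∧
    ∃ s : ℝ, 0 < s ∧ ∀ y : H, ∃ x : T.domain, (s : ℂ) • (x : H) + T x = y

/-- `T` is `ω`-accretive: its numerical range lies in the closed sector `{|arg z| ≤ ω}`
(which contains `0`, since `Complex.arg 0 = 0`). -/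
def IsSectorial (ω : ℝ) (T : H →ₗ.[ℂ] H) : Prop :=
  numericalRange T ⊆ {z : ℂ | |z.arg| ≤ ω}

/-- `T` is m-`ω`-accretive. -/
def IsMSectorial (ω : ℝ) (T : H →ₗ.[ℂ] H) : Prop :=
  IsSectorial ω T ∧ IsMAccretive T

/-- The null space `N(T)`, as a subset of `H`. -/
def nullSpace (T : H →ₗ.[ℂ] H) : Set H :=
  {x | ∃ hx : x ∈ T.domain, T ⟨x, hx⟩ = 0}

/-- The square `T²`, with domain `{x ∈ D(T) : Tx ∈ D(T)}`. -/
def sq (T : H →ₗ.[ℂ] H) : H →ₗ.[ℂ] H :=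
  T.comp (T.domRestrict ((T.domain.comap T.toFun).map T.domain.subtype)) (by
    rintro ⟨x, hx⟩
    obtain ⟨⟨y, hy, rfl⟩, h2⟩ := hx
    exact hy)

theorem mem_sq_domain (T : H →ₗ.[ℂ] H) (x : H) :
    x ∈ (sq T).domain ↔ ∃ hx : x ∈ T.domain, T ⟨x, hx⟩ ∈ T.domain := by
  constructor
  · rintro ⟨⟨y, hy, rfl⟩, h2⟩
    exact ⟨y.2, hy⟩
  · rintro ⟨hx, h⟩
    exact ⟨⟨⟨x, hx⟩, h, rfl⟩, hx⟩

theorem sq_apply (T : H →ₗ.[ℂ] H) (x : H) (hx : x ∈ T.domain) (h : T ⟨x, hx⟩ ∈ T.domain) :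
    sq T ⟨x, (mem_sq_domain T x).2 ⟨hx, h⟩⟩ = T ⟨T ⟨x, hx⟩, h⟩ := rfl

open scoped Classical in
/-- `T (s + T)⁻¹ x`; the value is `0` if `x` is not in the range of `s + T`. When `T` is
m-accretive and `s > 0`, the operator `s + T` is a bijection from `D(T)` onto `H`. -/
def mulResolvent (T : H →ₗ.[ℂ] H) (s : ℝ) (x : H) : H :=
  if h : ∃ y : T.domain, (s : ℂ) • (y : H) + T y = x then T h.choose else 0

/-- The Balakrishnan integral `(1/π) ∫₀^∞ s^{-1/2} T (s + T)⁻¹ x ds`. -/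
def balakrishnan (T : H →ₗ.[ℂ] H) (x : H) : H :=
  ((1 / Real.pi : ℝ) : ℂ) •
    ∫ s in Set.Ioi (0 : ℝ), ((s ^ (-(1 / 2 : ℝ)) : ℝ) : ℂ) • mulResolvent T s x

/-- The square root `T^{1/2}` of an m-accretive operator: the closure of the operator which is
given on `D(T)` by the Balakrishnan integral. It is obtained from the closure of the graph; for
m-accretive `T` the integral converges absolutely for `x ∈ D(T)` and is linear in `x`, so that the
span below is just the graph of the integral over `D(T)`. -/
def sqrtOp (T : H →ₗ.[ℂ] H) : H →ₗ.[ℂ] H :=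
  (Submodule.span ℂ
    {p : H × H | p.1 ∈ T.domain ∧ p.2 = balakrishnan T p.1}).topologicalClosure.toLinearPMap

/-- Compatibility of `B²` and `C`: `D(B²) ⊆ D(C)` and, for some `α, δ ≥ 0` and `0 ≤ β < 1`,
`Re ⟨B²x, Cx⟩ ≥ -α ‖x‖² - β ‖B²x‖² - δ ‖B²x‖ ‖x‖` on `D(B²)`. -/
def LowerBoundCondition (B C : H →ₗ.[ℂ] H) : Prop :=
  (sq B).domain ≤ C.domain ∧
    ∃ α β δ : ℝ, 0 ≤ α ∧ 0 ≤ β ∧ β < 1 ∧ 0 ≤ δ ∧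
      ∀ (x : H) (hx : x ∈ (sq B).domain) (hxC : x ∈ C.domain),
        -α * ‖x‖ ^ 2 - β * ‖sq B ⟨x, hx⟩‖ ^ 2 - δ * ‖sq B ⟨x, hx⟩‖ * ‖x‖ ≤
          (inner ℂ (C ⟨x, hxC⟩) (sq B ⟨x, hx⟩)).re

/-- The operator `Λ = B² + C` with domain `D(B²) ∩ D(C)`, which is `D(B²)` when `D(B²) ⊆ D(C)`. -/
def lam (B C : H →ₗ.[ℂ] H) : H →ₗ.[ℂ] H := sq B + C

/-- The linear factor `Z₁ = B + Λ^{1/2}` with domain `D(B) ∩ D(Λ^{1/2})`. -/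
def factorOne (B C : H →ₗ.[ℂ] H) : H →ₗ.[ℂ] H := B + sqrtOp (lam B C)

/-- The open sector `{z ≠ 0 : |arg z| < φ}`. -/
def openSector (φ : ℝ) : Set ℂ := {z | z ≠ 0 ∧ |z.arg| < φ}

/-- A holomorphic `C₀`-semigroup of angle `φ`: a family of bounded operators `S z`, for `z = 0` or
`z` in the open sector, that is holomorphic on the sector, has the semigroup property, and tends
strongly to `S 0 = I` as `z → 0` in the sector. Values of `S` elsewhere are irrelevant. -/
structure IsHolomorphicSemigroup (φ : ℝ) (S : ℂ → H →L[ℂ] H) : Prop where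
  map_zero : S 0 = ContinuousLinearMap.id ℂ H
  map_add : ∀ z ∈ openSector φ, ∀ w ∈ openSector φ, S (z + w) = (S z).comp (S w)
  holo : DifferentiableOn ℂ S (openSector φ)
  tendsto_zero : ∀ x : H, Tendsto (fun z => S z x) (𝓝[openSector φ] 0) (𝓝 x)

/-- `A` is the infinitesimal generator of `(S t)`, `t ≥ 0`: `x ∈ D(A)` and `A x = y` if and only if
`(S t x - x) / t → y` as `t ↓ 0`. -/
def IsGenerator (A : H →ₗ.[ℂ] H) (S : ℂ → H →L[ℂ] H) : Prop :=
  ∀ x y : H, (∃ hx : x ∈ A.domain, A ⟨x, hx⟩ = y) ↔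
    Tendsto (fun t : ℝ => ((t⁻¹ : ℝ) : ℂ) • (S (t : ℂ) x - x)) (𝓝[>] (0 : ℝ)) (𝓝 y)

/-- `A` generates a holomorphic `C₀`-semigroup of angle `φ`. -/
def GeneratesHolomorphicSemigroup (φ : ℝ) (A : H →ₗ.[ℂ] H) : Prop :=
  ∃ S : ℂ → H →L[ℂ] H, IsHolomorphicSemigroup φ S ∧ IsGenerator A S

end PencilFactor

end

/-!
Write `Z₁ = B + Λ^{1/2}`. The proof has three parts.

*The angle between the square roots.* The compatibility condition says that
`Re ⟨B²x, Λx⟩ ≥ -κ ‖x‖²` on `D(B²) = D(Λ)` (`exists_lower_bound`). Accretivity of the resolvents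
carries this over to the bounded operators `B²(s + B²)⁻¹` and `Λ(t + Λ)⁻¹`, with `κ / (st)` in place
of `κ`. Since the Balakrishnan formula has a positive weight, double integration over `s, t > 1`
gives a lower bound for `Re ⟨(B²)^{1/2} x, Λ^{1/2} x⟩` by terms of lower order
(`re_inner_balakrishnan_balakrishnan`). As `B` is accretive, it is the square root of `B²`
(`IsMAccretive.balakrishnan_sq_mem_graph`), and by the closed graph theorem it is bounded relative
to `Λ^{1/2}`, so the estimate extends from `D(Λ)` to `D(Λ^{1/2})`. Hence `B` is an admissible
perturbation of the m-accretive operator `Λ^{1/2}`: along `Λ^{1/2} + tB` there is a uniform a priori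
bound, and the method of continuity shows that `Z₁` is m-accretive (`IsMAccretive.add`).

*Sectoriality.* The square root of an m-accretive operator has its numerical range in the sector of
half-angle `π / 4`. For a bounded `P` with `P` and `P²` accretive this is
`abs_im_le_re_of_sq_accretive`: the half-plane condition for `(1 - ik) P` holds for `k = 0` and
persists up to `k = 1`. The unbounded case follows from the coercive approximations
`k T (k + T)⁻¹ + 1/k`, whose square roots are constructed by the Balakrishnan integral
(`algSqrt_mul_self`) and converge on the domain. So `B` on `D(Λ^{1/2})`, `Λ^{1/2}`, and the sum `Z₁`
are sectorial of angle `π / 4`. A sectorial form that vanishes at `x` has `x` in the null space of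
the operator, which yields the formula for the null space of `Z₁`.

*The semigroup.* If `T` is m-accretive and sectorial of angle `π / 4`, its bounded approximations
`Tₙ` are sectorial as well, so that `e^{-z Tₙ}` is a contraction for `|Im z| ≤ Re z`. The
approximations commute, whence `‖e^{-z Tₙ} x - e^{-z Tₘ} x‖ ≤ |z| ‖Tₙ x - Tₘ x‖`; the limits form
the holomorphic semigroup (`generatesHolomorphicSemigroup`).
-/

noncomputable section

set_option linter.unusedSectionVars false

namespace PencilFactor

/-! ### The method of continuity and the resolvent of an m-accretive operator -/

section

section Continuity

variable {V H : Type*} [AddCommGroup V] [Module ℂ V] [NormedAddCommGroup H] [NormedSpace ℂ H]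
  [CompleteSpace H]

/-- A small perturbation of a surjective map is surjective, by the contraction principle. -/
theorem surjective_add_smul_of_lt (L D : V →ₗ[ℂ] H) {K : ℝ}
    (hK : ∀ x, ‖D x‖ ≤ K * ‖L x‖) (hL : Function.Surjective L) {c : ℂ} (hc : ‖c‖ * K < 1) :
    Function.Surjective (L + c • D) := by
  intro y
  let σ := Function.surjInv hL
  have hσ : ∀ a, L (σ a) = a := Function.surjInv_eq hL
  let F : H → H := fun a => y - c • D (σ a)
  have hF : ContractingWith (Real.toNNReal (‖c‖ * K)) F := by
    refine ⟨by simpa [Real.toNNReal_lt_one] using hc, LipschitzWith.of_dist_le_mul fun a b => ?_⟩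
    have h1 : F a - F b = -(c • D (σ a - σ b)) := by
      simp only [F, map_sub, smul_sub]; abel
    have h2 := hK (σ a - σ b)
    rw [map_sub L, hσ, hσ] at h2
    rw [dist_eq_norm, dist_eq_norm, h1, norm_neg, norm_smul]
    calc ‖c‖ * ‖D (σ a - σ b)‖ ≤ ‖c‖ * (K * ‖a - b‖) := by gcongr
      _ = (‖c‖ * K) * ‖a - b‖ := by ring
      _ ≤ _ := by gcongr; exact Real.le_coe_toNNReal _
  have hfix : F (hF.fixedPoint F) = hF.fixedPoint F := hF.fixedPoint_isFixedPt
  refine ⟨σ (hF.fixedPoint F), ?_⟩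
  have : y - c • D (σ (hF.fixedPoint F)) = hF.fixedPoint F := hfix
  simp only [LinearMap.add_apply, LinearMap.smul_apply, hσ]
  nth_rewrite 1 [← this]
  abel

/-- The method of continuity: a uniform a priori bound along the segment from `L` to `L + D`
transports surjectivity from one end to the other. -/
theorem surjective_add_of_bound (L D : V →ₗ[ℂ] H) {K : ℝ}
    (hK : ∀ t : ℝ, 0 ≤ t → t ≤ 1 → ∀ x, ‖D x‖ ≤ K * ‖L x + (t : ℂ) • D x‖)
    (hL : Function.Surjective L) : Function.Surjective (L + D) := by
  obtain ⟨N, hN⟩ := exists_nat_gt (max K 0)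
  have hN0 : (0 : ℝ) < N := (le_max_right _ _).trans_lt hN
  have hNK : K < N := (le_max_left _ _).trans_lt hN
  -- steps of length `1 / N` are short enough for the contraction principle
  have key : ∀ k : ℕ, k ≤ N → Function.Surjective (L + (((k / N : ℝ)) : ℂ) • D) := by
    intro k
    induction k with
    | zero => intro _; simpa using hL
    | succ k ih =>
      intro hk
      have hk' : (k : ℝ) + 1 ≤ N := by exact_mod_cast hk
      have h1 := surjective_add_smul_of_lt (L + (((k / N : ℝ)) : ℂ) • D) D (K := K)
        (fun x => by
          simpa using hK (k / N) (by positivity) ((div_le_one hN0).2 (by linarith)) x)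
        (ih (by omega)) (c := ((1 / N : ℝ) : ℂ)) (by
          rw [Complex.norm_real, Real.norm_of_nonneg (by positivity), one_div,
            inv_mul_lt_iff₀ hN0]
          simpa using hNK)
      rw [add_assoc, ← add_smul, ← Complex.ofReal_add, ← add_div] at h1
      exact_mod_cast h1
  have := key N le_rfl
  rwa [div_self hN0.ne', Complex.ofReal_one, one_smul] at this

end Continuity

variable {H : Type*} [NormedAddCommGroup H] [InnerProductSpace ℂ H]

/-- Accretivity of a linear relation in `H`, given as a subspace of `H × H`. -/
def RelAccretive (G : Submodule ℂ (H × H)) : Prop :=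
  ∀ x y : H, (x, y) ∈ G → 0 ≤ (inner ℂ x y).re

theorem isAccretive_iff_graph {T : H →ₗ.[ℂ] H} : IsAccretive T ↔ RelAccretive T.graph := by
  constructor
  · intro h x y hxy
    obtain ⟨z, rfl, rfl⟩ := (LinearPMap.mem_graph_iff T).1 hxy
    exact h z
  · intro h x
    exact h _ _ (T.mem_graph x)

theorem re_inner_smul_add_self (μ : ℂ) (x y : H) :
    (inner ℂ x (μ • x + y)).re = μ.re * ‖x‖ ^ 2 + (inner ℂ x y).re := by
  rw [inner_add_right, inner_smul_right, inner_self_eq_norm_sq_to_K]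
  simp [← Complex.ofReal_pow]

theorem mul_norm_le_of_re_inner {c : ℝ} {x f : H} (h : c * ‖x‖ ^ 2 ≤ (inner ℂ x f).re) :
    c * ‖x‖ ≤ ‖f‖ := by
  rcases eq_or_ne x 0 with rfl | hx
  · simp
  have h1 : (inner ℂ x f).re ≤ ‖x‖ * ‖f‖ :=
    re_inner_le_norm (𝕜 := ℂ) x f
  have h2 : 0 < ‖x‖ := norm_pos_iff.2 hx
  nlinarith

theorem RelAccretive.mul_norm_le {G : Submodule ℂ (H × H)} (hG : RelAccretive G) (μ : ℂ)
    {x y : H} (h : (x, y) ∈ G) : μ.re * ‖x‖ ≤ ‖μ • x + y‖ := by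
  apply mul_norm_le_of_re_inner
  rw [re_inner_smul_add_self]
  linarith [hG x y h]

/-- For an accretive relation `G`, if `μ₀ + G` is onto for one `μ₀` in the open right half plane,
then it is onto for all of them. -/
theorem RelAccretive.surjective [CompleteSpace H] {G : Submodule ℂ (H × H)}
    (hG : RelAccretive G) {μ₀ : ℂ} (h₀ : 0 < μ₀.re)
    (hs : ∀ f : H, ∃ x y, (x, y) ∈ G ∧ μ₀ • x + y = f) {μ : ℂ} (hμ : 0 < μ.re) (f : H) :
    ∃ x y, (x, y) ∈ G ∧ μ • x + y = f := by
  let P1 : G →ₗ[ℂ] H := (LinearMap.fst ℂ H H).comp G.subtype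
  let P2 : G →ₗ[ℂ] H := (LinearMap.snd ℂ H H).comp G.subtype
  have hm : 0 < min μ₀.re μ.re := lt_min h₀ hμ
  have h := surjective_add_of_bound (μ₀ • P1 + P2) ((μ - μ₀) • P1)
    (K := ‖μ - μ₀‖ / min μ₀.re μ.re) (by
      rintro t ht0 ht1 ⟨⟨x, y⟩, hxy⟩
      have h1 := hG.mul_norm_le (μ₀ + t * (μ - μ₀)) hxy
      have h2 : min μ₀.re μ.re ≤ (μ₀ + t * (μ - μ₀)).re := by
        simp only [Complex.add_re, Complex.mul_re, Complex.ofReal_re, Complex.sub_re,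
          Complex.ofReal_im, zero_mul, sub_zero]
        have h3 := min_le_left μ₀.re μ.re
        have h4 := min_le_right μ₀.re μ.re
        nlinarith
      have h3 : (μ₀ • P1 + P2) ⟨(x, y), hxy⟩ + (t : ℂ) • ((μ - μ₀) • P1) ⟨(x, y), hxy⟩
          = (μ₀ + t * (μ - μ₀)) • x + y := by
        simp only [LinearMap.add_apply, LinearMap.smul_apply, P1, P2, LinearMap.comp_apply,
          Submodule.subtype_apply, LinearMap.fst_apply, LinearMap.snd_apply, add_smul, mul_smul]
        abel
      rw [h3]
      have h4 : ((μ - μ₀) • P1) ⟨(x, y), hxy⟩ = (μ - μ₀) • x := rfl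
      rw [h4, norm_smul, div_mul_eq_mul_div, mul_div_assoc]
      gcongr
      rw [le_div_iff₀ hm, mul_comm]
      exact (mul_le_mul_of_nonneg_right h2 (norm_nonneg _)).trans h1)
    (by
      intro f
      obtain ⟨x, y, hxy, hf⟩ := hs f
      exact ⟨⟨(x, y), hxy⟩, hf⟩)
  obtain ⟨⟨⟨x, y⟩, hxy⟩, hf⟩ := h f
  refine ⟨x, y, hxy, ?_⟩
  rw [← hf]
  change μ • x + y = μ₀ • x + y + (μ - μ₀) • x
  rw [sub_smul]; abel

theorem IsMAccretive.relAccretive {T : H →ₗ.[ℂ] H} (hT : IsMAccretive T) :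
    RelAccretive T.graph := isAccretive_iff_graph.1 hT.1

variable [CompleteSpace H]

theorem IsMAccretive.exists_mem_graph {T : H →ₗ.[ℂ] H} (hT : IsMAccretive T) {μ : ℂ}
    (hμ : 0 < μ.re) (f : H) : ∃ x y, (x, y) ∈ T.graph ∧ μ • x + y = f := by
  obtain ⟨s, hs, h⟩ := hT.2.2
  refine hT.relAccretive.surjective (μ₀ := s) (by simpa using hs) (fun f => ?_) hμ f
  obtain ⟨x, hx⟩ := h f
  exact ⟨x, T x, T.mem_graph x, hx⟩

theorem isMAccretive_of_surjective {T : H →ₗ.[ℂ] H} (hT : IsAccretive T)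
    (hd : Dense (T.domain : Set H)) {μ : ℂ} (hμ : 0 < μ.re)
    (hs : ∀ f : H, ∃ x y, (x, y) ∈ T.graph ∧ μ • x + y = f) : IsMAccretive T := by
  refine ⟨hT, hd, 1, one_pos, fun f => ?_⟩
  obtain ⟨x, y, hxy, hf⟩ := (isAccretive_iff_graph.1 hT).surjective hμ hs (μ := ((1 : ℝ) : ℂ))
    (by simp) f
  obtain ⟨z, rfl, rfl⟩ := (LinearPMap.mem_graph_iff T).1 hxy
  exact ⟨z, hf⟩

theorem IsMAccretive.exists_resolvent {T : H →ₗ.[ℂ] H} (hT : IsMAccretive T) {μ : ℂ}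
    (hμ : 0 < μ.re) : ∃ R : H →L[ℂ] H, (∀ f, (R f, f - μ • R f) ∈ T.graph) ∧
      (∀ x y, (x, y) ∈ T.graph → R (μ • x + y) = x) ∧ ‖R‖ ≤ 1 / μ.re := by
  choose r t hrt hr using fun f => hT.exists_mem_graph hμ f
  have hinj : ∀ x y f, (x, y) ∈ T.graph → μ • x + y = f → r f = x := by
    intro x y f hxy hf
    have h1 := T.graph.sub_mem (hrt f) hxy
    have h2 := hT.relAccretive.mul_norm_le μ h1
    have h3 : μ • (r f - x) + (t f - y) = 0 := by
      rw [smul_sub, sub_add_sub_comm, hr, hf, sub_self]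
    change μ.re * ‖r f - x‖ ≤ ‖μ • (r f - x) + (t f - y)‖ at h2
    rw [h3, norm_zero] at h2
    have h4 : ‖r f - x‖ ≤ 0 := by nlinarith [norm_nonneg (r f - x)]
    exact sub_eq_zero.1 (norm_le_zero_iff.1 h4)
  have ht : ∀ f, t f = f - μ • r f := fun f => eq_sub_of_add_eq' (hr f)
  let R₀ : H →ₗ[ℂ] H :=
    { toFun := r
      map_add' := fun f g => hinj _ _ _ (T.graph.add_mem (hrt f) (hrt g)) (by
        change μ • (r f + r g) + (t f + t g) = f + g
        rw [ht, ht, smul_add]; abel)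
      map_smul' := fun c f => hinj _ _ _ (T.graph.smul_mem c (hrt f)) (by
        change μ • (c • r f) + c • t f = c • f
        rw [ht, smul_sub, smul_comm]; abel) }
  have hb : ∀ f, ‖R₀ f‖ ≤ 1 / μ.re * ‖f‖ := by
    intro f
    have h := hT.relAccretive.mul_norm_le μ (hrt f)
    rw [hr] at h
    rw [one_div, inv_mul_eq_div, le_div_iff₀ hμ, mul_comm]
    exact h
  refine ⟨R₀.mkContinuous _ hb, fun f => ?_, fun x y hxy => hinj x y _ hxy rfl, ?_⟩
  · have := hrt f
    rwa [ht] at this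
  · exact LinearMap.mkContinuous_norm_le _ (by positivity) hb

open scoped Classical in
/-- The resolvent `(μ + T)⁻¹`, as a bounded operator; zero if there is none. -/
def res (T : H →ₗ.[ℂ] H) (μ : ℂ) : H →L[ℂ] H :=
  if h : ∃ R : H →L[ℂ] H, (∀ f, (R f, f - μ • R f) ∈ T.graph) ∧
      (∀ x y, (x, y) ∈ T.graph → R (μ • x + y) = x) ∧ ‖R‖ ≤ 1 / μ.re then h.choose else 0

theorem IsMAccretive.res_spec {T : H →ₗ.[ℂ] H} (hT : IsMAccretive T) {μ : ℂ}
    (hμ : 0 < μ.re) : (∀ f, (res T μ f, f - μ • res T μ f) ∈ T.graph) ∧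
      (∀ x y, (x, y) ∈ T.graph → res T μ (μ • x + y) = x) ∧ ‖res T μ‖ ≤ 1 / μ.re := by
  have h := hT.exists_resolvent hμ
  rw [res, dif_pos h]
  exact h.choose_spec

theorem IsMAccretive.res_mem {T : H →ₗ.[ℂ] H} (hT : IsMAccretive T) {μ : ℂ}
    (hμ : 0 < μ.re) (f : H) : (res T μ f, f - μ • res T μ f) ∈ T.graph := (hT.res_spec hμ).1 f

theorem IsMAccretive.res_apply {T : H →ₗ.[ℂ] H} (hT : IsMAccretive T) {μ : ℂ}
    (hμ : 0 < μ.re) {x y : H} (h : (x, y) ∈ T.graph) : res T μ (μ • x + y) = x :=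
  (hT.res_spec hμ).2.1 x y h

theorem IsMAccretive.norm_res_apply_le {T : H →ₗ.[ℂ] H} (hT : IsMAccretive T) {μ : ℂ}
    (hμ : 0 < μ.re) (f : H) : ‖res T μ f‖ ≤ ‖f‖ / μ.re := by
  have := (res T μ).le_of_opNorm_le (hT.res_spec hμ).2.2 f
  rwa [one_div, inv_mul_eq_div] at this

theorem IsMAccretive.isClosed_graph {T : H →ₗ.[ℂ] H} (hT : IsMAccretive T) :
    IsClosed (T.graph : Set (H × H)) := by
  have h1 : (0 : ℝ) < (1 : ℂ).re := by simp
  have : (T.graph : Set (H × H)) = {p | res T 1 (p.1 + p.2) = p.1} := by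
    ext ⟨x, y⟩
    constructor
    · intro h
      simpa using hT.res_apply h1 h
    · intro (h : res T 1 (x + y) = x)
      have h2 := hT.res_mem h1 (x + y)
      rw [h] at h2
      simpa using h2
  rw [this]
  exact isClosed_eq (by fun_prop) (by fun_prop)

/-- The bounded operator `T (s + T)⁻¹ = 1 - s (s + T)⁻¹`. -/
def yos (T : H →ₗ.[ℂ] H) (s : ℝ) : H →L[ℂ] H := 1 - (s : ℂ) • res T s

theorem yos_apply (T : H →ₗ.[ℂ] H) (s : ℝ) (x : H) : yos T s x = x - (s : ℂ) • res T s x := rfl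

section Yosida

variable {T : H →ₗ.[ℂ] H} {s : ℝ}

theorem IsMAccretive.res_yos_mem (hT : IsMAccretive T) (hs : 0 < s) (x : H) :
    (res T s x, yos T s x) ∈ T.graph := hT.res_mem (by simpa using hs) x

theorem IsMAccretive.res_real_apply (hT : IsMAccretive T) (hs : 0 < s) {x y : H}
    (h : (x, y) ∈ T.graph) : res T s ((s : ℂ) • x + y) = x :=
  hT.res_apply (by simpa using hs) h

theorem IsMAccretive.norm_res_real_le (hT : IsMAccretive T) (hs : 0 < s) (x : H) :
    ‖res T s x‖ ≤ ‖x‖ / s := by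
  simpa using hT.norm_res_apply_le (μ := s) (by simpa using hs) x

theorem smul_res_add_yos (T : H →ₗ.[ℂ] H) (s : ℝ) (x : H) :
    (s : ℂ) • res T s x + yos T s x = x := by rw [yos_apply]; abel

theorem IsMAccretive.norm_sq_yos_le (hT : IsMAccretive T) (hs : 0 < s) (x : H) :
    ‖yos T s x‖ ^ 2 ≤ (inner ℂ x (yos T s x)).re := by
  have h := hT.relAccretive _ _ (hT.res_yos_mem hs x)
  have h1 : inner ℂ x (yos T s x)
      = inner ℂ ((s : ℂ) • res T s x + yos T s x) (yos T s x) := by rw [smul_res_add_yos]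
  rw [h1, inner_add_left, inner_smul_left, Complex.conj_ofReal, Complex.add_re,
    Complex.re_ofReal_mul, inner_self_eq_norm_sq_to_K]
  have : ((‖yos T s x‖ : ℂ) ^ 2).re = ‖yos T s x‖ ^ 2 := by
    rw [← Complex.ofReal_pow, Complex.ofReal_re]
  have h2 := mul_nonneg hs.le h
  simp only [Complex.coe_algebraMap]
  linarith

theorem IsMAccretive.norm_yos_le (hT : IsMAccretive T) (hs : 0 < s) (x : H) :
    ‖yos T s x‖ ≤ ‖x‖ := by
  have h := hT.norm_sq_yos_le hs x
  have h1 : (inner ℂ x (yos T s x)).re ≤ ‖x‖ * ‖yos T s x‖ := re_inner_le_norm (𝕜 := ℂ) _ _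
  by_contra! hc
  nlinarith [norm_nonneg x, norm_nonneg (yos T s x)]

theorem IsMAccretive.yos_eq_res (hT : IsMAccretive T) (hs : 0 < s) {x y : H}
    (h : (x, y) ∈ T.graph) : yos T s x = res T s y := by
  have h1 := hT.res_real_apply hs h
  rw [map_add, map_smul] at h1
  rw [yos_apply, sub_eq_iff_eq_add']
  exact h1.symm

theorem IsMAccretive.norm_yos_le_div (hT : IsMAccretive T) (hs : 0 < s) {x y : H}
    (h : (x, y) ∈ T.graph) : ‖yos T s x‖ ≤ ‖y‖ / s := by
  rw [hT.yos_eq_res hs h]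
  exact hT.norm_res_real_le hs y

/-- A bounded operator that leaves the graph of `T` invariant commutes with the resolvents. -/
theorem IsMAccretive.commute_res (hT : IsMAccretive T) {M : H →L[ℂ] H}
    (hM : ∀ x y, (x, y) ∈ T.graph → (M x, M y) ∈ T.graph) {μ : ℂ} (hμ : 0 < μ.re) (x : H) :
    M (res T μ x) = res T μ (M x) := by
  have h := hT.res_apply hμ (hM _ _ (hT.res_mem hμ x))
  rw [← h, map_sub, map_smul, add_sub_cancel]

theorem IsMAccretive.res_mem_graph (hT : IsMAccretive T) {μ : ℂ} (hμ : 0 < μ.re) {x y : H}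
    (h : (x, y) ∈ T.graph) : (res T μ x, res T μ y) ∈ T.graph := by
  have h1 := hT.res_apply hμ h
  have h2 := hT.res_mem hμ x
  rw [map_add, map_smul, ← eq_sub_iff_add_eq'] at h1
  rwa [← h1] at h2

theorem IsMAccretive.res_sub_res (hT : IsMAccretive T) {μ ν : ℂ} (hμ : 0 < μ.re)
    (hν : 0 < ν.re) (x : H) :
    res T μ x - res T ν x = (ν - μ) • res T μ (res T ν x) := by
  have h1 := hT.res_apply hμ (hT.res_mem hν x)
  have h2 : μ • res T ν x + (x - ν • res T ν x) = x - (ν - μ) • res T ν x := by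
    rw [sub_smul]; abel
  rw [h2, map_sub, map_smul] at h1
  rw [← sub_eq_iff_eq_add'.2 (sub_eq_iff_eq_add.1 h1)]

theorem IsMAccretive.continuousOn_res (hT : IsMAccretive T) (x : H) :
    ContinuousOn (fun s : ℝ => res T s x) (Set.Ioi 0) := by
  intro s hs
  have hs : 0 < s := hs
  rw [ContinuousWithinAt, tendsto_iff_norm_sub_tendsto_zero]
  refine squeeze_zero' (g := fun t : ℝ => |s - t| * (‖x‖ / s / (s / 2))) (by simp) ?_ ?_
  · filter_upwards [nhdsWithin_le_nhds (lt_mem_nhds (half_lt_self hs))] with t ht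
    have ht0 : 0 < t := (half_pos hs).trans ht
    rw [hT.res_sub_res (by simpa using ht0) (by simpa using hs), norm_smul, ← Complex.ofReal_sub,
      Complex.norm_real, Real.norm_eq_abs]
    gcongr
    refine (hT.norm_res_real_le ht0 _).trans ?_
    gcongr
    exact hT.norm_res_real_le hs x
  · have : Continuous (fun t : ℝ => |s - t| * (‖x‖ / s / (s / 2))) := by fun_prop
    have := this.tendsto s
    simp only [sub_self, abs_zero, zero_mul] at this
    exact this.mono_left nhdsWithin_le_nhds

theorem IsMAccretive.continuousOn_yos (hT : IsMAccretive T) (x : H) :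
    ContinuousOn (fun s : ℝ => yos T s x) (Set.Ioi 0) := by
  simp only [yos_apply]
  exact continuousOn_const.sub
    ((Complex.continuous_ofReal.continuousOn).smul (hT.continuousOn_res x))

/-- A bounded family of operators that converges on a dense set converges strongly. -/
theorem tendsto_of_dense {ι : Type*} {l : Filter ι} {A : ι → H →L[ℂ] H} {A₀ : H →L[ℂ] H} {c : ℝ}
    (hA : ∀ᶠ i in l, ∀ x, ‖A i x‖ ≤ c * ‖x‖) {D : Set H} (hD : Dense D)
    (h : ∀ x ∈ D, Tendsto (fun i => A i x) l (𝓝 (A₀ x))) (x : H) :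
    Tendsto (fun i => A i x) l (𝓝 (A₀ x)) := by
  rw [Metric.tendsto_nhds]
  intro ε hε
  have hK : 0 < 3 * (|c| + ‖A₀‖ + 1) := by positivity
  obtain ⟨y, hy, hxy⟩ := hD.exists_dist_lt x (div_pos hε hK)
  rw [lt_div_iff₀ hK] at hxy
  filter_upwards [(Metric.tendsto_nhds.1 (h y hy)) (ε / 3) (by positivity), hA] with i hi hA
  rw [dist_eq_norm] at *
  have e : A i x - A₀ x = A i (x - y) + (A i y - A₀ y) - A₀ (x - y) := by
    simp only [map_sub]; abel
  have h1 : ‖A i (x - y)‖ ≤ |c| * ‖x - y‖ := (hA _).trans (by gcongr; exact le_abs_self c)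
  have h2 := A₀.le_opNorm (x - y)
  rw [e]
  refine (norm_sub_le _ _).trans_lt ?_
  have h3 := norm_add_le (A i (x - y)) (A i y - A₀ y)
  nlinarith [norm_nonneg (x - y)]

theorem IsMAccretive.tendsto_smul_res (hT : IsMAccretive T) (x : H) :
    Tendsto (fun s : ℝ => (s : ℂ) • res T s x) atTop (𝓝 x) := by
  have h2 : Tendsto (fun s : ℝ => yos T s x) atTop (𝓝 0) := by
    refine tendsto_of_dense (A₀ := 0) (c := 1) ?_ hT.2.1 (fun x hx => ?_) x
    · filter_upwards [Ioi_mem_atTop 0] with s hs x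
      simpa using hT.norm_yos_le hs x
    · obtain ⟨y, hxy⟩ := LinearPMap.mem_domain_iff.1 hx
      refine squeeze_zero_norm' (a := fun s => ‖y‖ / s) ?_ (tendsto_const_nhds.div_atTop tendsto_id)
      filter_upwards [Ioi_mem_atTop 0] with s hs
      exact hT.norm_yos_le_div hs hxy
  have h3 := (tendsto_const_nhds (x := x)).sub h2
  simpa [yos_apply] using h3

theorem IsMAccretive.mulResolvent_eq (hT : IsMAccretive T) (hs : 0 < s) (x : H) :
    mulResolvent T s x = yos T s x := by
  have h : ∃ y : T.domain, (s : ℂ) • (y : H) + T y = x := by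
    obtain ⟨z, hz1, hz2⟩ := (LinearPMap.mem_graph_iff T).1 (hT.res_yos_mem hs x)
    refine ⟨z, ?_⟩
    rw [hz1, hz2]
    exact smul_res_add_yos T s x
  rw [mulResolvent, dif_pos h]
  have h1 := hT.res_real_apply hs (T.mem_graph h.choose)
  rw [h.choose_spec] at h1
  rw [yos_apply, h1, eq_sub_iff_add_eq']
  exact h.choose_spec

end Yosida

end

/-! ### Accretive and sectorial relations -/

section

variable {H : Type*} [NormedAddCommGroup H] [InnerProductSpace ℂ H]

theorem eq_zero_of_forall_quadratic {p q : ℝ} (h : ∀ t : ℝ, 0 ≤ t * p + t ^ 2 * q) : p = 0 := by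
  by_contra hp
  have hq : 0 < |q| + 1 := by positivity
  have h1 := h (-p / (|q| + 1))
  have h2 : -p / (|q| + 1) * p + (-p / (|q| + 1)) ^ 2 * q
      = p ^ 2 / (|q| + 1) ^ 2 * (q - (|q| + 1)) := by field_simp; ring
  rw [h2] at h1
  have h3 : 0 < p ^ 2 / (|q| + 1) ^ 2 := by positivity
  nlinarith [le_abs_self q]

/-- The relation `G` has its numerical range in the sector `{|arg z| ≤ π / 4}`. -/
def RelSectorial (G : Submodule ℂ (H × H)) : Prop :=
  ∀ x y : H, (x, y) ∈ G → |(inner ℂ x y).im| ≤ (inner ℂ x y).re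

theorem RelSectorial.relAccretive {G : Submodule ℂ (H × H)} (hG : RelSectorial G) :
    RelAccretive G := fun x y h => (abs_nonneg _).trans (hG x y h)

theorem RelAccretive.topologicalClosure {G : Submodule ℂ (H × H)} (hG : RelAccretive G) :
    RelAccretive G.topologicalClosure := by
  intro x y h
  have hc : IsClosed {p : H × H | 0 ≤ (inner ℂ p.1 p.2).re} :=
    isClosed_le continuous_const (by fun_prop)
  exact closure_minimal (fun p hp => hG p.1 p.2 hp) hc h

theorem RelSectorial.topologicalClosure {G : Submodule ℂ (H × H)} (hG : RelSectorial G) :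
    RelSectorial G.topologicalClosure := by
  intro x y h
  have hc : IsClosed {p : H × H | |(inner ℂ p.1 p.2).im| ≤ (inner ℂ p.1 p.2).re} :=
    isClosed_le (by fun_prop) (by fun_prop)
  exact closure_minimal (fun p hp => hG p.1 p.2 hp) hc h

/-- The cross term of an accretive form at two vectors, one of which is isotropic, has vanishing
real part, and the same holds after multiplication of the other vector by `I`. -/
theorem RelAccretive.cross_eq_zero {G : Submodule ℂ (H × H)} (hG : RelAccretive G) {x y z w : H}
    (hy : (y, w) ∈ G) (h0 : (inner ℂ y w).re = 0) (hx : (x, z) ∈ G) :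
    inner ℂ x w = -(starRingEnd ℂ) (inner ℂ y z) := by
  have key : ∀ c : ℂ, ((starRingEnd ℂ) c * inner ℂ x w + c * inner ℂ y z).re = 0 := by
    intro c
    refine eq_zero_of_forall_quadratic (q := Complex.normSq c * (inner ℂ x z).re) fun t => ?_
    have h1 := hG _ _ (G.add_mem hy (G.smul_mem (t * c) hx))
    change 0 ≤ (inner ℂ (y + (t * c) • x) (w + (t * c) • z)).re at h1
    simp only [inner_add_left, inner_add_right, inner_smul_left, inner_smul_right, map_mul,
      Complex.conj_ofReal] at h1
    simp only [Complex.add_re, Complex.add_im, Complex.mul_re, Complex.mul_im, Complex.ofReal_re,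
      Complex.ofReal_im, Complex.conj_re, Complex.conj_im, h0, Complex.normSq_apply] at h1 ⊢
    nlinarith
  have h1 := key 1
  have h2 := key Complex.I
  simp at h1 h2
  apply Complex.ext
  · simp [-inner_conj_symm]; linarith
  · simp [-inner_conj_symm]; linarith

theorem RelAccretive.inner_eq_zero {G : Submodule ℂ (H × H)} (hG : RelAccretive G) {x y z : H}
    (hy : (y, 0) ∈ G) (hx : (x, z) ∈ G) : inner ℂ y z = 0 := by
  have := hG.cross_eq_zero hy (by simp) hx
  simpa [-inner_conj_symm] using this.symm

theorem eq_zero_of_dense_fst {G : Submodule ℂ (H × H)}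
    (hd : Dense (G.map (LinearMap.fst ℂ H H) : Set H)) {w : H}
    (h : ∀ x y, (x, y) ∈ G → inner ℂ x w = 0) : w = 0 := by
  refine hd.eq_zero_of_inner_right (𝕜 := ℂ) fun v hv => ?_
  obtain ⟨⟨x, y⟩, hxy, rfl⟩ := hv
  exact h x y hxy

/-- A densely defined accretive relation is single valued. -/
theorem RelAccretive.eq_zero_of_zero_mem {G : Submodule ℂ (H × H)} (hG : RelAccretive G)
    (hd : Dense (G.map (LinearMap.fst ℂ H H) : Set H)) {w : H} (hw : ((0 : H), w) ∈ G) :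
    w = 0 := by
  refine eq_zero_of_dense_fst hd fun x y hxy => ?_
  simpa using hG.cross_eq_zero hw (by simp) hxy

/-- The form of a sectorial operator is nondegenerate: if `Re ⟨Ty, y⟩ = 0` then `Ty = 0`. -/
theorem RelSectorial.eq_zero_of_re_inner {G : Submodule ℂ (H × H)} (hG : RelSectorial G)
    (hd : Dense (G.map (LinearMap.fst ℂ H H) : Set H)) {y w : H} (hy : (y, w) ∈ G)
    (h0 : (inner ℂ y w).re = 0) : w = 0 := by
  have him : (inner ℂ y w).im = 0 := by
    have := hG y w hy
    rw [h0] at this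
    exact abs_nonpos_iff.1 this
  refine eq_zero_of_dense_fst hd fun x z hx => ?_
  have h1 := hG.relAccretive.cross_eq_zero hy h0 hx
  -- the form rotated by `π / 4` is accretive as well, which gives a second linear relation between
  -- the two cross terms
  have key : ∀ c : ℂ,
      ((1 + Complex.I) * ((starRingEnd ℂ) c * inner ℂ x w + c * inner ℂ y z)).re = 0 := by
    intro c
    refine eq_zero_of_forall_quadratic
      (q := Complex.normSq c * ((inner ℂ x z).re - (inner ℂ x z).im)) fun t => ?_
    have h2 := (le_abs_self _).trans (hG _ _ (G.add_mem hy (G.smul_mem (t * c) hx)))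
    change (inner ℂ (y + (t * c) • x) (w + (t * c) • z)).im ≤
      (inner ℂ (y + (t * c) • x) (w + (t * c) • z)).re at h2
    simp only [inner_add_left, inner_add_right, inner_smul_left, inner_smul_right, map_mul,
      Complex.conj_ofReal] at h2
    simp only [Complex.add_re, Complex.add_im, Complex.mul_re, Complex.mul_im, Complex.ofReal_re,
      Complex.ofReal_im, Complex.conj_re, Complex.conj_im, h0, him, Complex.normSq_apply,
      Complex.one_re, Complex.one_im, Complex.I_re, Complex.I_im] at h2 ⊢
    nlinarith
  have h2 := key 1
  have h3 := key Complex.I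
  have h4 := congrArg Complex.re h1
  have h5 := congrArg Complex.im h1
  simp [-inner_conj_symm] at h2 h3 h4 h5
  apply Complex.ext
  · simp [-inner_conj_symm]; linarith
  · simp [-inner_conj_symm]; linarith

theorem dense_graph_fst {T : H →ₗ.[ℂ] H} (hT : Dense (T.domain : Set H)) :
    Dense (T.graph.map (LinearMap.fst ℂ H H) : Set H) := by
  rwa [T.graph_map_fst_eq_domain]

theorem Dense.map_fst_topologicalClosure {G : Submodule ℂ (H × H)}
    (hd : Dense (G.map (LinearMap.fst ℂ H H) : Set H)) :
    Dense (G.topologicalClosure.map (LinearMap.fst ℂ H H) : Set H) :=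
  hd.mono (Submodule.map_mono G.le_topologicalClosure)

/-! ### Perturbation of m-accretive operators -/

theorem mem_graph_add {T C : H →ₗ.[ℂ] H} {x w : H} :
    (x, w) ∈ (T + C).graph ↔ ∃ y z, (x, y) ∈ T.graph ∧ (x, z) ∈ C.graph ∧ y + z = w := by
  constructor
  · intro h
    obtain ⟨⟨u, hu⟩, rfl, rfl⟩ := (LinearPMap.mem_graph_iff _).1 h
    exact ⟨_, _, T.mem_graph ⟨u, hu.1⟩, C.mem_graph ⟨u, hu.2⟩, rfl⟩
  · rintro ⟨y, z, hy, hz, rfl⟩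
    obtain ⟨u, rfl, rfl⟩ := (LinearPMap.mem_graph_iff _).1 hy
    obtain ⟨v, hv, rfl⟩ := (LinearPMap.mem_graph_iff _).1 hz
    replace hv : (v : H) = u := hv
    have hu : (u : H) ∈ C.domain := by rw [← hv]; exact v.2
    obtain rfl : v = ⟨u, hu⟩ := Subtype.ext hv
    exact (LinearPMap.mem_graph_iff _).2 ⟨⟨u, u.2, hu⟩, rfl, rfl⟩

theorem mem_graph_sq {T : H →ₗ.[ℂ] H} {x z : H} :
    (x, z) ∈ (sq T).graph ↔ ∃ y, (x, y) ∈ T.graph ∧ (y, z) ∈ T.graph := by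
  constructor
  · intro h
    obtain ⟨⟨u, hu⟩, rfl, rfl⟩ := (LinearPMap.mem_graph_iff _).1 h
    obtain ⟨h1, h2⟩ := (mem_sq_domain T u).1 hu
    exact ⟨_, T.mem_graph ⟨u, h1⟩, T.mem_graph ⟨_, h2⟩⟩
  · rintro ⟨y, hy, hz⟩
    obtain ⟨u, rfl, rfl⟩ := (LinearPMap.mem_graph_iff _).1 hy
    obtain ⟨v, hv, rfl⟩ := (LinearPMap.mem_graph_iff _).1 hz
    have hv' : T u ∈ T.domain := by
      have := v.2
      rwa [hv] at this
    refine (LinearPMap.mem_graph_iff _).2 ⟨⟨u, (mem_sq_domain T u).2 ⟨u.2, hv'⟩⟩, rfl, ?_⟩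
    have h3 : v = ⟨T u, hv'⟩ := Subtype.ext hv
    rw [sq_apply T u u.2 hv', h3]

variable [CompleteSpace H]

/-- By the closed graph theorem, an accretive operator whose domain contains that of the
m-accretive operator `T` is `T`-bounded. -/
theorem IsMAccretive.exists_relative_bound {T C : H →ₗ.[ℂ] H} (hT : IsMAccretive T)
    (hC : IsAccretive C) (hd : T.domain ≤ C.domain) :
    ∃ K : ℝ, 0 ≤ K ∧ ∀ x y z, (x, y) ∈ T.graph → (x, z) ∈ C.graph → ‖z‖ ≤ K * (‖x‖ + ‖y‖) := by
  have h1 : (0 : ℝ) < (1 : ℂ).re := by simp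
  have hmem : ∀ f, res T 1 f ∈ C.domain := fun f =>
    hd (LinearPMap.mem_domain_of_mem_graph (hT.res_mem h1 f))
  let L : H →ₗ[ℂ] H := C.toFun.comp ((res T 1 : H →ₗ[ℂ] H).codRestrict C.domain hmem)
  have hL : ∀ f, (res T 1 f, L f) ∈ C.graph := fun f => C.mem_graph ⟨res T 1 f, hmem f⟩
  have hCd : Dense (C.graph.topologicalClosure.map (LinearMap.fst ℂ H H) : Set H) :=
    Dense.map_fst_topologicalClosure (dense_graph_fst (hT.2.1.mono hd))
  have hcont : Continuous L := by
    refine L.continuous_of_seq_closed_graph fun u x y hu hy => ?_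
    have h2 : (res T 1 x, y) ∈ C.graph.topologicalClosure := by
      refine C.graph.isClosed_topologicalClosure.mem_of_tendsto
        ((((res T 1).continuous.tendsto x).comp hu).prodMk_nhds hy)
        (Eventually.of_forall fun n => C.graph.le_topologicalClosure (hL (u n)))
    have h3 := C.graph.topologicalClosure.sub_mem h2 (C.graph.le_topologicalClosure (hL x))
    have h4 : ((0 : H), y - L x) ∈ C.graph.topologicalClosure := by simpa using h3
    exact sub_eq_zero.1
      ((isAccretive_iff_graph.1 hC).topologicalClosure.eq_zero_of_zero_mem hCd h4)
  let L' : H →L[ℂ] H := ⟨L, hcont⟩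
  refine ⟨‖L'‖, norm_nonneg _, fun x y z hy hz => ?_⟩
  have h5 := hL ((1 : ℂ) • x + y)
  rw [hT.res_apply h1 hy] at h5
  rw [C.mem_graph_snd_inj hz h5 rfl]
  refine (L'.le_opNorm _).trans ?_
  gcongr
  simpa using norm_add_le x y

/-- An accretive perturbation `C` of an m-accretive operator `T`, with
`Re ⟨Tx, Cx⟩` bounded below by `-β ‖Tx‖²`, `β < 1`, up to terms of lower order, leaves the sum
m-accretive. The lower bound controls `Tx` by `(s + T + t C) x` uniformly in `t ∈ [0, 1]`, and the
method of continuity applies. -/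
theorem IsMAccretive.add {T C : H →ₗ.[ℂ] H} (hT : IsMAccretive T) (hC : IsAccretive C)
    (hd : T.domain ≤ C.domain) {α β δ : ℝ} (hα : 0 ≤ α) (hβ : 0 ≤ β) (hβ1 : β < 1) (hδ : 0 ≤ δ)
    (h : ∀ x y z, (x, y) ∈ T.graph → (x, z) ∈ C.graph →
      -α * ‖x‖ ^ 2 - β * ‖y‖ ^ 2 - δ * ‖y‖ * ‖x‖ ≤ (inner ℂ z y).re) :
    IsMAccretive (T + C) := by
  obtain ⟨K, hK0, hK⟩ := hT.exists_relative_bound hC hd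
  have hacc : IsAccretive (T + C) := by
    rw [isAccretive_iff_graph]
    intro x w hw
    obtain ⟨y, z, hy, hz, rfl⟩ := mem_graph_add.1 hw
    rw [inner_add_right, Complex.add_re]
    exact add_nonneg (hT.relAccretive _ _ hy) (isAccretive_iff_graph.1 hC _ _ hz)
  have hdom : (T + C).domain = T.domain := inf_eq_left.2 hd
  refine isMAccretive_of_surjective hacc (by rw [hdom]; exact hT.2.1) (μ := 1) (by simp) ?_
  let P : T.domain →ₗ[ℂ] H := T.domain.subtype
  let D : T.domain →ₗ[ℂ] H := C.toFun.comp (Submodule.inclusion hd)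
  let M : ℝ := max 1 ((2 + α + δ) / (1 - β))
  have hs := surjective_add_of_bound (P + T.toFun) D (K := K * (1 + M)) (by
    intro t ht0 ht1 x
    have hxT : ((x : H), T x) ∈ T.graph := T.mem_graph x
    have hxC : ((x : H), D x) ∈ C.graph := C.mem_graph ⟨x, hd x.2⟩
    change ‖D x‖ ≤ K * (1 + M) * ‖((x : H) + T x) + (t : ℂ) • D x‖
    set f := ((x : H) + T x) + (t : ℂ) • D x with hf
    have hfx : T x + (t : ℂ) • D x = f - x := by rw [hf]; abel
    have hxf : ‖(x : H)‖ ≤ ‖f‖ := by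
      have : 1 * ‖(x : H)‖ ^ 2 ≤ (inner ℂ (x : H) f).re := by
        rw [hf, inner_add_right, inner_add_right, inner_smul_right, inner_self_eq_norm_sq_to_K]
        simp only [Complex.add_re, Complex.re_ofReal_mul, Complex.coe_algebraMap]
        rw [← Complex.ofReal_pow, Complex.ofReal_re]
        have h1 := hT.relAccretive _ _ hxT
        have h2 := mul_nonneg ht0 (isAccretive_iff_graph.1 hC _ _ hxC)
        linarith
      simpa using mul_norm_le_of_re_inner this
    have hTf : ‖T x‖ ≤ M * ‖f‖ := by
      rcases le_or_gt ‖T x‖ ‖f‖ with hle | hlt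
      · exact hle.trans (le_mul_of_one_le_left (norm_nonneg _) (le_max_left _ _))
      have h1 := h _ _ _ hxT hxC
      have h2 : (inner ℂ (f - x) (T x)).re = ‖T x‖ ^ 2 + t * (inner ℂ (D x) (T x)).re := by
        rw [← hfx, inner_add_left, inner_smul_left, inner_self_eq_norm_sq_to_K]
        simp only [Complex.add_re, Complex.re_ofReal_mul, Complex.coe_algebraMap,
          Complex.conj_ofReal]
        rw [← Complex.ofReal_pow, Complex.ofReal_re]
      have h3 : (inner ℂ (f - x) (T x)).re ≤ ‖f - x‖ * ‖T x‖ := re_inner_le_norm (𝕜 := ℂ) _ _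
      have h4 : ‖f - x‖ ≤ 2 * ‖f‖ := (norm_sub_le _ _).trans (by linarith)
      have h5 : -(α * ‖f‖ * ‖T x‖) - β * ‖T x‖ ^ 2 - δ * ‖T x‖ * ‖f‖
          ≤ t * (inner ℂ (D x) (T x)).re := by
        have e1 : α * ‖(x : H)‖ ^ 2 ≤ α * ‖f‖ * ‖T x‖ := by
          rw [mul_assoc, pow_two]
          gcongr
          exact hxf.trans hlt.le
        have e2 : δ * ‖T x‖ * ‖(x : H)‖ ≤ δ * ‖T x‖ * ‖f‖ := by gcongr
        have e3 : 0 ≤ α * ‖f‖ * ‖T x‖ + β * ‖T x‖ ^ 2 + δ * ‖T x‖ * ‖f‖ := by positivity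
        nlinarith
      have h6 : ‖f - x‖ * ‖T x‖ ≤ 2 * ‖f‖ * ‖T x‖ := by gcongr
      have h7 : (1 - β) * ‖T x‖ * ‖T x‖ ≤ (2 + α + δ) * ‖f‖ * ‖T x‖ := by nlinarith
      have h8 : 0 < ‖T x‖ := (norm_nonneg _).trans_lt hlt
      have h9 := le_of_mul_le_mul_right h7 h8
      have h10 : ‖T x‖ ≤ (2 + α + δ) / (1 - β) * ‖f‖ := by
        rw [div_mul_eq_mul_div, le_div_iff₀ (by linarith)]
        linarith
      exact h10.trans (by gcongr; exact le_max_right _ _)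
    refine (hK _ _ _ hxT hxC).trans ?_
    rw [mul_assoc]
    gcongr
    linarith)
    (by
      intro f
      obtain ⟨x, y, hxy, hf⟩ := hT.exists_mem_graph (μ := 1) (by simp) f
      obtain ⟨u, rfl, rfl⟩ := (LinearPMap.mem_graph_iff _).1 hxy
      exact ⟨u, by rw [← hf, one_smul]; rfl⟩)
  intro f
  obtain ⟨x, hx⟩ := hs f
  refine ⟨x, T x + D x, mem_graph_add.2 ⟨_, _, T.mem_graph x, C.mem_graph ⟨x, hd x.2⟩, rfl⟩, ?_⟩
  rw [← hx, one_smul, ← add_assoc]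
  rfl

/-- An accretive operator with m-accretive square is m-accretive: with `μ = 1 + 2i` one has
`B² + 3 - 4i = (B + μ) (B - μ)`, and the left hand side is onto. -/
theorem isMAccretive_of_sq {B : H →ₗ.[ℂ] H} (hB : IsAccretive B) (hB2 : IsMAccretive (sq B)) :
    IsMAccretive B := by
  have hdom : (sq B).domain ≤ B.domain := fun x hx => ((mem_sq_domain B x).1 hx).1
  refine isMAccretive_of_surjective hB (hB2.2.1.mono hdom) (μ := 1 + 2 * Complex.I) (by simp)
    fun f => ?_
  obtain ⟨x, z, hxz, hf⟩ := hB2.exists_mem_graph (μ := 3 - 4 * Complex.I) (by simp) f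
  obtain ⟨y, hxy, hyz⟩ := mem_graph_sq.1 hxz
  refine ⟨y - (1 + 2 * Complex.I) • x, z - (1 + 2 * Complex.I) • y,
    B.graph.sub_mem hyz (B.graph.smul_mem _ hxy), ?_⟩
  have : (3 - 4 * Complex.I : ℂ) = -((1 + 2 * Complex.I) * (1 + 2 * Complex.I)) := by
    linear_combination 4 * Complex.I_sq
  rw [← hf, this, neg_smul, mul_smul, smul_sub]
  abel

end

/-! ### The weight `s ^ (-1/2)` -/

section

theorem integrableOn_rpow_mul_inv_add_one :
    IntegrableOn (fun s : ℝ => s ^ (-(1 / 2 : ℝ)) * (s + 1)⁻¹) (Set.Ioi 0) := by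
  have h := (integrableOn_Ioi_comp_rpow_iff' (fun x : ℝ => (1 + x ^ 2)⁻¹)
    (p := 1 / 2) (by norm_num)).2 integrable_inv_one_add_sq.integrableOn
  refine h.congr_fun (fun s hs => ?_) measurableSet_Ioi
  have hs : 0 < s := hs
  have h1 : (s ^ (1 / 2 : ℝ)) ^ 2 = s := by
    rw [← Real.rpow_natCast, ← Real.rpow_mul hs.le]; norm_num
  simp only [smul_eq_mul]
  rw [h1, add_comm]
  norm_num

theorem integral_rpow_mul_inv_add_one :
    ∫ s in Set.Ioi (0 : ℝ), s ^ (-(1 / 2 : ℝ)) * (s + 1)⁻¹ = Real.pi := by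
  have h := integral_comp_rpow_Ioi_of_pos (g := fun x : ℝ => (1 + x ^ 2)⁻¹)
    (p := 1 / 2) (by norm_num)
  rw [integral_Ioi_inv_one_add_sq, Real.arctan_zero, sub_zero] at h
  have h2 : ∫ s in Set.Ioi (0 : ℝ), s ^ (-(1 / 2 : ℝ)) * (s + 1)⁻¹
      = 2 * ∫ x in Set.Ioi (0 : ℝ),
        (1 / 2 * x ^ ((1 / 2 : ℝ) - 1)) • (1 + (x ^ (1 / 2 : ℝ)) ^ 2)⁻¹ := by
    rw [← integral_const_mul]
    refine setIntegral_congr_fun measurableSet_Ioi fun s hs => ?_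
    have hs : 0 < s := hs
    have h1 : (s ^ (1 / 2 : ℝ)) ^ 2 = s := by
      rw [← Real.rpow_natCast, ← Real.rpow_mul hs.le]; norm_num
    simp only [smul_eq_mul]
    rw [h1, add_comm]
    norm_num
    ring
  rw [h2, h]
  ring

theorem integrableOn_rpow_mul_inv_add {ε : ℝ} (hε : 0 < ε) :
    IntegrableOn (fun s : ℝ => s ^ (-(1 / 2 : ℝ)) * (s + ε)⁻¹) (Set.Ioi 0) := by
  have hm : 0 < min 1 ε := lt_min one_pos hε
  refine (integrableOn_rpow_mul_inv_add_one.const_mul (min 1 ε)⁻¹).mono'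
    (by fun_prop) ?_
  refine (ae_restrict_mem measurableSet_Ioi).mono fun s hs => ?_
  have hs : 0 < s := hs
  rw [Real.norm_of_nonneg (by positivity), mul_left_comm, ← mul_inv]
  gcongr
  have h1 := min_le_left 1 ε
  have h2 := min_le_right 1 ε
  nlinarith

/-! ### The square root of a strictly accretive element of a Banach algebra -/

section Algebra

variable {𝔸 : Type*} [NormedRing 𝔸] [NormedAlgebra ℂ 𝔸] [CompleteSpace 𝔸]

/-- The resolvent `(s + a)⁻¹` in a Banach algebra. -/
def algRes (a : 𝔸) (s : ℝ) : 𝔸 := Ring.inverse ((s : ℂ) • 1 + a)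

/-- The Balakrishnan integral `(1/π) ∫₀^∞ s^{-1/2} a (s + a)⁻¹ ds`, with `a (s + a)⁻¹` in the form
`1 - s (s + a)⁻¹`. -/
def algSqrt (a : 𝔸) : 𝔸 :=
  ((1 / Real.pi : ℝ) : ℂ) •
    ∫ s in Set.Ioi (0 : ℝ), ((s ^ (-(1 / 2 : ℝ)) : ℝ) : ℂ) • (1 - (s : ℂ) • algRes a s)

/-- The resolvent bound of an element with numerical range to the right of `ε`. -/
def StrictRes (ε : ℝ) (a : 𝔸) : Prop :=
  ∀ s : ℝ, 0 ≤ s → IsUnit ((s : ℂ) • 1 + a) ∧ ‖algRes a s‖ ≤ (s + ε)⁻¹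

theorem Commute.ringInverse {a b : 𝔸} (h : Commute a b) : Commute a (Ring.inverse b) := by
  by_cases hb : IsUnit b
  · obtain ⟨u, rfl⟩ := hb
    rw [Ring.inverse_unit]
    exact h.units_inv_right
  · rw [Ring.inverse_non_unit _ hb]
    exact Commute.zero_right a

theorem hasDerivAt_ringInverse {f : ℝ → 𝔸} {f' : 𝔸} {t : ℝ} (hf : HasDerivAt f f' t)
    (hu : IsUnit (f t)) :
    HasDerivAt (fun t => Ring.inverse (f t))
      (-(Ring.inverse (f t) * f' * Ring.inverse (f t))) t := by
  obtain ⟨u, hu⟩ := hu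
  have h1 := hasFDerivAt_ringInverse (𝕜 := ℝ) u
  rw [hu] at h1
  have h2 := h1.comp_hasDerivAt t hf
  rw [← hu, Ring.inverse_unit]
  simpa using! h2

theorem commute_algRes {a b : 𝔸} (h : Commute b a) (s : ℝ) : Commute b (algRes a s) :=
  Commute.ringInverse (((Commute.one_right b).smul_right _).add_right h)

variable {ε : ℝ} {a : 𝔸}

theorem StrictRes.mul_algRes (h : StrictRes ε a) {s : ℝ} (hs : 0 ≤ s) :
    a * algRes a s = 1 - (s : ℂ) • algRes a s := by
  have h1 := Ring.mul_inverse_cancel _ (h s hs).1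
  rw [add_mul, smul_one_mul] at h1
  exact eq_sub_of_add_eq' h1

theorem hasDerivAt_smul_one (t : ℝ) : HasDerivAt (fun s : ℝ => (s : ℂ) • (1 : 𝔸)) 1 t := by
  simpa using (Complex.ofRealCLM.hasDerivAt (x := t)).smul_const (1 : 𝔸)

theorem StrictRes.hasDerivAt_algRes (h : StrictRes ε a) {s : ℝ} (hs : 0 ≤ s) :
    HasDerivAt (algRes a) (-(algRes a s * algRes a s)) s := by
  have := hasDerivAt_ringInverse ((hasDerivAt_smul_one (𝔸 := 𝔸) s).add_const a) (h s hs).1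
  rwa [mul_one] at this

theorem StrictRes.continuousOn_algRes (h : StrictRes ε a) :
    ContinuousOn (algRes a) (Set.Ioi 0) :=
  fun _ hs => (h.hasDerivAt_algRes (le_of_lt hs)).continuousAt.continuousWithinAt

theorem norm_rpow_smul {E : Type*} [NormedAddCommGroup E] [NormedSpace ℂ E] (s p : ℝ) (hs : 0 < s)
    (x : E) :
    ‖((s ^ p : ℝ) : ℂ) • x‖ = s ^ p * ‖x‖ := by
  rw [norm_smul, Complex.norm_real, Real.norm_of_nonneg (by positivity)]

theorem continuousOn_rpow_coe (p : ℝ) :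
    ContinuousOn (fun s : ℝ => ((s ^ p : ℝ) : ℂ)) (Set.Ioi 0) :=
  Complex.continuous_ofReal.comp_continuousOn
    (continuousOn_id.rpow_const fun _ hs => Or.inl (ne_of_gt hs))

theorem StrictRes.aestronglyMeasurable (h : StrictRes ε a) :
    AEStronglyMeasurable (fun s : ℝ => ((s ^ (-(1 / 2 : ℝ)) : ℝ) : ℂ) • (1 - (s : ℂ) • algRes a s))
      (volume.restrict (Set.Ioi 0)) := by
  refine ContinuousOn.aestronglyMeasurable ?_ measurableSet_Ioi
  exact (continuousOn_rpow_coe _).smul (continuousOn_const.sub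
    (Complex.continuous_ofReal.continuousOn.smul h.continuousOn_algRes))

theorem StrictRes.integrableOn (hε : 0 < ε) (h : StrictRes ε a) :
    IntegrableOn (fun s : ℝ => ((s ^ (-(1 / 2 : ℝ)) : ℝ) : ℂ) • (1 - (s : ℂ) • algRes a s))
      (Set.Ioi 0) := by
  refine ((integrableOn_rpow_mul_inv_add hε).const_mul ‖a‖).mono' h.aestronglyMeasurable ?_
  refine (ae_restrict_mem measurableSet_Ioi).mono fun s hs => ?_
  have hs : 0 < s := hs
  rw [norm_rpow_smul _ _ hs, ← h.mul_algRes hs.le, mul_left_comm]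
  gcongr
  exact (norm_mul_le _ _).trans (by gcongr; exact (h s hs.le).2)

theorem rpow_half_mul_inv_sq_le (hε : 0 < ε) {s : ℝ} (hs : 0 < s) :
    s ^ (1 / 2 : ℝ) * ((s + ε)⁻¹ * (s + ε)⁻¹) ≤ s ^ (-(1 / 2 : ℝ)) * (s + ε)⁻¹ := by
  have h1 : s ^ (1 / 2 : ℝ) = s ^ (-(1 / 2 : ℝ)) * s := by
    rw [← Real.rpow_add_one hs.ne']; norm_num
  rw [h1, mul_assoc, ← mul_assoc s]
  gcongr
  have : s * (s + ε)⁻¹ ≤ 1 := by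
    rw [← div_eq_mul_inv, div_le_one (by linarith)]; linarith
  nlinarith [inv_pos.2 (show 0 < s + ε by linarith)]

theorem StrictRes.norm_sq_le (hε : 0 < ε) (h : StrictRes ε a) {s : ℝ} (hs : 0 < s) (b c : 𝔸) :
    ‖((s ^ (1 / 2 : ℝ) : ℝ) : ℂ) • (c * algRes a s * b * algRes a s)‖ ≤
      (‖c‖ * ‖b‖) * (s ^ (-(1 / 2 : ℝ)) * (s + ε)⁻¹) := by
  rw [norm_rpow_smul _ _ hs]
  refine le_trans ?_ (mul_le_mul_of_nonneg_left (rpow_half_mul_inv_sq_le hε hs) (by positivity))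
  have h1 := (h s hs.le).2
  have h3 : 0 ≤ (s + ε)⁻¹ := (norm_nonneg _).trans h1
  calc s ^ (1 / 2 : ℝ) * ‖c * algRes a s * b * algRes a s‖
      ≤ s ^ (1 / 2 : ℝ) * (‖c‖ * (s + ε)⁻¹ * ‖b‖ * (s + ε)⁻¹) := by
        gcongr
        refine (norm_mul_le _ _).trans ?_
        gcongr
        refine (norm_mul_le _ _).trans ?_
        gcongr
        refine (norm_mul_le _ _).trans ?_
        gcongr
    _ = _ := by ring

theorem StrictRes.integrableOn_sq (hε : 0 < ε) (h : StrictRes ε a) (b c : 𝔸) :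
    IntegrableOn (fun s : ℝ => ((s ^ (1 / 2 : ℝ) : ℝ) : ℂ) • (c * algRes a s * b * algRes a s))
      (Set.Ioi 0) := by
  refine ((integrableOn_rpow_mul_inv_add hε).const_mul (‖c‖ * ‖b‖)).mono' ?_ ?_
  · refine ContinuousOn.aestronglyMeasurable ?_ measurableSet_Ioi
    exact (continuousOn_rpow_coe _).smul ((((continuousOn_const).mul h.continuousOn_algRes).mul
      continuousOn_const).mul h.continuousOn_algRes)
  · exact (ae_restrict_mem measurableSet_Ioi).mono fun s hs => h.norm_sq_le hε hs b c

/-- Integration by parts in the Balakrishnan integral: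
`∫ s^{-1/2} a (s + a)⁻¹ ds = 2 ∫ s^{1/2} a (s + a)⁻² ds`. -/
theorem StrictRes.integral_eq (hε : 0 < ε) (h : StrictRes ε a) :
    ∫ s in Set.Ioi (0 : ℝ), ((s ^ (-(1 / 2 : ℝ)) : ℝ) : ℂ) • (1 - (s : ℂ) • algRes a s) =
      (2 : ℂ) • ∫ s in Set.Ioi (0 : ℝ), ((s ^ (1 / 2 : ℝ) : ℝ) : ℂ) •
        (a * algRes a s * 1 * algRes a s) := by
  have hi1 := h.integrableOn hε
  have hi2 := h.integrableOn_sq hε 1 a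
  have hi3 : IntegrableOn (fun s : ℝ => ((1 / 2 : ℝ) : ℂ) • (((s ^ (-(1 / 2 : ℝ)) : ℝ) : ℂ) •
      (1 - (s : ℂ) • algRes a s))) (Set.Ioi 0) :=
    hi1.smul ((1 / 2 : ℝ) : ℂ)
  have hbound : ∀ s : ℝ, 0 ≤ s → ‖((s ^ (1 / 2 : ℝ) : ℝ) : ℂ) • (a * algRes a s)‖
      ≤ s ^ (1 / 2 : ℝ) * (‖a‖ * (s + ε)⁻¹) := by
    intro s hs
    rw [norm_smul, Complex.norm_real, Real.norm_of_nonneg (by positivity)]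
    gcongr
    exact (norm_mul_le _ _).trans (by gcongr; exact (h s hs).2)
  have key := integral_Ioi_of_hasDerivAt_of_tendsto (a := 0) (m := (0 : 𝔸))
    (f := fun s : ℝ => ((s ^ (1 / 2 : ℝ) : ℝ) : ℂ) • (a * algRes a s))
    (f' := fun s : ℝ => ((1 / 2 : ℝ) : ℂ) • (((s ^ (-(1 / 2 : ℝ)) : ℝ) : ℂ) •
        (1 - (s : ℂ) • algRes a s)) - ((s ^ (1 / 2 : ℝ) : ℝ) : ℂ) •
        (a * algRes a s * 1 * algRes a s)) ?_ ?_ (hi3.sub hi2) ?_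
  · rw [integral_sub hi3 hi2, integral_smul] at key
    simp only [one_div] at key ⊢
    rw [Real.zero_rpow (by norm_num), Complex.ofReal_zero, zero_smul, sub_zero,
      sub_eq_zero] at key
    rw [← key, smul_smul]
    norm_num
  · rw [ContinuousWithinAt, Real.zero_rpow (by norm_num), Complex.ofReal_zero, zero_smul]
    refine squeeze_zero_norm' (a := fun s : ℝ => s ^ (1 / 2 : ℝ) * (‖a‖ * (s + ε)⁻¹))
      (by filter_upwards [self_mem_nhdsWithin] with s hs using hbound s hs) ?_
    have : ContinuousAt (fun s : ℝ => s ^ (1 / 2 : ℝ) * (‖a‖ * (s + ε)⁻¹)) 0 := by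
      refine ContinuousAt.mul (Real.continuousAt_rpow_const _ _ (Or.inr (by norm_num))) ?_
      exact continuousAt_const.mul ((continuousAt_id.add continuousAt_const).inv₀
        (by simpa using hε.ne'))
    have h2 := this.tendsto
    rw [Real.zero_rpow (by norm_num), zero_mul] at h2
    exact h2.mono_left nhdsWithin_le_nhds
  · intro s hs
    have hs : 0 < s := hs
    have h1 : HasDerivAt (fun s : ℝ => ((s ^ (1 / 2 : ℝ) : ℝ) : ℂ))
        (((1 / 2 * s ^ ((1 / 2 : ℝ) - 1) : ℝ)) : ℂ) s :=
      (Real.hasDerivAt_rpow_const (Or.inl hs.ne')).ofReal_comp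
    have h2 := h1.smul ((h.hasDerivAt_algRes hs.le).const_mul a)
    rw [← h.mul_algRes hs.le]
    refine h2.congr_deriv ?_
    rw [show (1 / 2 : ℝ) - 1 = -(1 / 2) by norm_num, Complex.ofReal_mul, mul_smul, mul_one,
      mul_neg, smul_neg, mul_assoc]
    abel
  · refine squeeze_zero_norm' (a := fun s : ℝ => ‖a‖ * s ^ (-(1 / 2 : ℝ))) ?_ ?_
    · filter_upwards [eventually_gt_atTop 0] with s hs
      refine (hbound s hs.le).trans ?_
      rw [mul_left_comm]
      gcongr
      have h1 : s ^ (1 / 2 : ℝ) = s ^ (-(1 / 2 : ℝ)) * s := by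
        rw [← Real.rpow_add_one hs.ne']; norm_num
      rw [h1, mul_assoc]
      refine mul_le_of_le_one_right (by positivity) ?_
      rw [← div_eq_mul_inv, div_le_one (by linarith)]; linarith
    · simpa using (tendsto_rpow_neg_atTop (show (0 : ℝ) < 1 / 2 by norm_num)).const_mul ‖a‖

/-- The square root of an element that is joined to `1` by a segment of strictly accretive elements.
Along `N t = 1 + t (a - 1)` the Balakrishnan integral `G t` satisfies `2 N G' = N' G`, by
differentiation under the integral sign and integration by parts, so that `G² N⁻¹` is constant. -/
theorem algSqrt_mul_self {η : ℝ} (hε : 0 < ε) (hη : 0 < η)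
    (h : ∀ t ∈ Set.Ioo (-η) (1 + η), StrictRes ε (1 + (t : ℂ) • (a - 1))) :
    algSqrt a * algSqrt a = a := by
  set d := a - 1 with hd
  let N : ℝ → 𝔸 := fun t => 1 + (t : ℂ) • d
  let M : ℝ → 𝔸 := fun t => Ring.inverse (N t)
  let G : ℝ → 𝔸 := fun t => algSqrt (N t)
  let J : ℝ → 𝔸 := fun t => ((1 / Real.pi : ℝ) : ℂ) •
    ∫ s in Set.Ioi (0 : ℝ), ((s ^ (1 / 2 : ℝ) : ℝ) : ℂ) • (algRes (N t) s * algRes (N t) s)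
  have hdN : ∀ t, Commute d (N t) := fun t =>
    (Commute.one_right d).add_right ((Commute.refl d).smul_right _)
  have hunit : ∀ t ∈ Set.Ioo (-η) (1 + η), IsUnit (N t) := fun t ht => by
    have h1 := (h t ht 0 le_rfl).1
    rwa [Complex.ofReal_zero, zero_smul, zero_add] at h1
  have hMN : ∀ t ∈ Set.Ioo (-η) (1 + η), M t * N t = 1 := fun t ht =>
    Ring.inverse_mul_cancel _ (hunit t ht)
  have hNM : ∀ t ∈ Set.Ioo (-η) (1 + η), N t * M t = 1 := fun t ht =>
    Ring.mul_inverse_cancel _ (hunit t ht)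
  have hN' : ∀ t, HasDerivAt N d t := fun t => by
    have h1 : HasDerivAt (fun t : ℝ => (t : ℂ) • d) d t := by
      simpa using (Complex.ofRealCLM.hasDerivAt (x := t)).smul_const d
    exact h1.const_add 1
  have hM' : ∀ t ∈ Set.Ioo (-η) (1 + η), HasDerivAt M (-(M t * d * M t)) t := fun t ht =>
    hasDerivAt_ringInverse (hN' t) (hunit t ht)
  have hJint : ∀ t ∈ Set.Ioo (-η) (1 + η), IntegrableOn (fun s : ℝ => ((s ^ (1 / 2 : ℝ) : ℝ) : ℂ) •
      (algRes (N t) s * algRes (N t) s)) (Set.Ioi 0) := fun t ht => by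
    have h1 := (h t ht).integrableOn_sq hε 1 1
    simp only [one_mul, mul_one] at h1
    exact h1
  have hJcomm : ∀ t ∈ Set.Ioo (-η) (1 + η), ∀ b : 𝔸, Commute b (N t) → Commute b (J t) := by
    intro t ht b hb
    refine Commute.smul_right ?_ _
    rw [Commute, SemiconjBy, ← integral_const_mul_of_integrable (hJint t ht),
      ← integral_mul_const_of_integrable (hJint t ht)]
    congr 1
    ext s
    have h1 := commute_algRes hb s
    exact ((h1.mul_right h1).smul_right _).eq
  have hG : ∀ t ∈ Set.Ioo (-η) (1 + η), G t = (2 : ℂ) • (N t * J t) := by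
    intro t ht
    change ((1 / Real.pi : ℝ) : ℂ) • _ = (2 : ℂ) • (N t * (((1 / Real.pi : ℝ) : ℂ) • _))
    rw [(h t ht).integral_eq hε, mul_smul_comm, smul_comm,
      ← integral_const_mul_of_integrable (hJint t ht)]
    congr 3
    ext s
    rw [mul_one, mul_smul_comm, mul_assoc]
  have hG' : ∀ t ∈ Set.Ioo (-η) (1 + η), HasDerivAt G (d * J t) t := by
    intro t ht
    have h1 := hasDerivAt_integral_of_dominated_loc_of_deriv_le (μ := volume.restrict (Set.Ioi 0))
      (F := fun t s => ((s ^ (-(1 / 2 : ℝ)) : ℝ) : ℂ) • (1 - (s : ℂ) • algRes (N t) s))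
      (F' := fun t s => ((s ^ (1 / 2 : ℝ) : ℝ) : ℂ) • (1 * algRes (N t) s * d * algRes (N t) s))
      (bound := fun s => (‖(1 : 𝔸)‖ * ‖d‖) * (s ^ (-(1 / 2 : ℝ)) * (s + ε)⁻¹))
      (s := Set.Ioo (-η) (1 + η)) (x₀ := t) (isOpen_Ioo.mem_nhds ht)
      (by filter_upwards [isOpen_Ioo.mem_nhds ht] with u hu using (h u hu).aestronglyMeasurable)
      ((h t ht).integrableOn hε) ((h t ht).integrableOn_sq hε d 1).aestronglyMeasurable
      ((ae_restrict_mem measurableSet_Ioi).mono fun s hs u hu => (h u hu).norm_sq_le hε hs d 1)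
      ((integrableOn_rpow_mul_inv_add hε).const_mul _)
      ((ae_restrict_mem measurableSet_Ioi).mono fun s hs u hu => by
        have hs : 0 < s := hs
        have h2 := hasDerivAt_ringInverse ((hN' u).const_add ((s : ℂ) • 1)) (h u hu s hs.le).1
        have h3 := ((h2.const_smul (s : ℂ)).const_sub 1).const_smul ((s ^ (-(1 / 2 : ℝ)) : ℝ) : ℂ)
        refine h3.congr_deriv ?_
        have h4 : s ^ (1 / 2 : ℝ) = s ^ (-(1 / 2 : ℝ)) * s := by
          rw [← Real.rpow_add_one hs.ne']; norm_num
        rw [h4, Complex.ofReal_mul, mul_smul]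
        simp only [one_mul, smul_neg, neg_neg]
        rfl)
    refine (h1.2.const_smul ((1 / Real.pi : ℝ) : ℂ)).congr_deriv ?_
    change _ = d * (((1 / Real.pi : ℝ) : ℂ) • _)
    rw [mul_smul_comm, ← integral_const_mul_of_integrable (hJint t ht)]
    congr 2
    ext s
    have h2 := (commute_algRes (hdN t) s).eq
    rw [one_mul, ← h2, mul_smul_comm, mul_assoc]
  have hQ' : ∀ t ∈ Set.Ioo (-η) (1 + η), HasDerivAt (fun t => G t * G t * M t) 0 t := by
    intro t ht
    refine (((hG' t ht).mul (hG' t ht)).mul (hM' t ht)).congr_deriv ?_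
    have hdJ := (hJcomm t ht d (hdN t)).eq
    have hNJ := (hJcomm t ht (N t) (Commute.refl _)).eq
    have hdN := (hdN t).eq
    have e1 : d * J t * G t * M t = (2 : ℂ) • (d * J t * J t) := by
      rw [hG t ht, hNJ, mul_smul_comm, smul_mul_assoc]
      simp only [mul_assoc]
      rw [hNM t ht, mul_one]
    have e2 : G t * (d * J t) * M t = (2 : ℂ) • (d * J t * J t) := by
      rw [hG t ht, hNJ, smul_mul_assoc, smul_mul_assoc]
      congr 1
      calc J t * N t * (d * J t) * M t = J t * (N t * d) * J t * M t := by noncomm_ring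
        _ = (J t * d) * (N t * J t) * M t := by rw [← hdN]; noncomm_ring
        _ = d * J t * J t * (N t * M t) := by rw [← hdJ, hNJ]; noncomm_ring
        _ = _ := by rw [hNM t ht, mul_one]
    have e3 : G t * G t * (M t * d * M t) = (4 : ℂ) • (d * J t * J t) := by
      rw [hG t ht, smul_mul_smul_comm, smul_mul_assoc]
      congr 1
      · norm_num
      calc N t * J t * (N t * J t) * (M t * d * M t)
          = N t * J t * (J t * (N t * M t) * d * M t) := by rw [hNJ]; noncomm_ring
        _ = J t * N t * (J t * d * M t) := by rw [hNM t ht, mul_one, hNJ]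
        _ = J t * (N t * d) * J t * M t := by rw [← hdJ]; noncomm_ring
        _ = (J t * d) * (N t * J t) * M t := by rw [← hdN]; noncomm_ring
        _ = d * J t * J t * (N t * M t) := by rw [← hdJ, hNJ]; noncomm_ring
        _ = _ := by rw [hNM t ht, mul_one]
    change (d * J t * G t + G t * (d * J t)) * M t + G t * G t * -(M t * d * M t) = 0
    rw [add_mul, e1, e2, mul_neg, e3, ← add_smul]
    norm_num
  have hQ := constant_of_has_deriv_right_zero (f := fun t => G t * G t * M t) (a := 0) (b := 1)
    (fun t ht => (hQ' t ⟨by linarith [ht.1], by linarith [ht.2]⟩).continuousAt.continuousWithinAt)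
    (fun t ht => (hQ' t ⟨by linarith [ht.1], by linarith [ht.2]⟩).hasDerivWithinAt) 1 (by simp)
  have hN0 : N 0 = 1 := by simp [N]
  have hN1 : N 1 = a := by simp [N, hd]
  have hG0 : G 0 = 1 := by
    change algSqrt (N 0) = 1
    rw [hN0, algSqrt]
    have : ∀ s ∈ Set.Ioi (0 : ℝ), ((s ^ (-(1 / 2 : ℝ)) : ℝ) : ℂ) • (1 - (s : ℂ) • algRes (1 : 𝔸) s)
        = ((s ^ (-(1 / 2 : ℝ)) * (s + 1)⁻¹ : ℝ) : ℂ) • (1 : 𝔸) := by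
      intro s hs
      have hs : 0 < s := hs
      have hs1 : (s : ℂ) + 1 ≠ 0 := by
        exact_mod_cast (by positivity : (s + 1 : ℝ) ≠ 0)
      have h1 : algRes (1 : 𝔸) s = (((s : ℂ) + 1)⁻¹) • (1 : 𝔸) := by
        rw [algRes]
        have e : ((s : ℂ) • 1 + 1 : 𝔸) = ((s : ℂ) + 1) • 1 := by rw [add_smul, one_smul]
        have hu : ((s : ℂ) • 1 + 1 : 𝔸) * ((((s : ℂ) + 1)⁻¹) • (1 : 𝔸)) = 1 := by
          rw [e, mul_smul_comm, mul_one, smul_smul, inv_mul_cancel₀ hs1, one_smul]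
        have hu' : ((((s : ℂ) + 1)⁻¹) • (1 : 𝔸)) * ((s : ℂ) • 1 + 1 : 𝔸) = 1 := by
          rw [e, smul_mul_assoc, one_mul, smul_smul, inv_mul_cancel₀ hs1, one_smul]
        exact Ring.inverse_unit ⟨_, _, hu, hu'⟩
      have h2 : (1 : 𝔸) - (s : ℂ) • algRes (1 : 𝔸) s = (((s : ℂ) + 1)⁻¹) • (1 : 𝔸) := by
        nth_rewrite 1 [← one_smul ℂ (1 : 𝔸)]
        rw [h1, smul_smul, ← sub_smul]
        congr 1
        field_simp
        ring
      rw [h2, smul_smul]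
      congr 1
      push_cast
      rfl
    rw [setIntegral_congr_fun measurableSet_Ioi this, integral_smul_const, integral_complex_ofReal,
      integral_rpow_mul_inv_add_one, smul_smul]
    simp [Real.pi_ne_zero]
  have hM0 : M 0 = 1 := by simp [M, hN0]
  change G 1 * G 1 * M 1 = G 0 * G 0 * M 0 at hQ
  rw [hG0, hM0, one_mul, one_mul] at hQ
  have h1 : G 1 * G 1 = N 1 := by
    have h2 := hMN 1 ⟨by linarith, by linarith⟩
    calc G 1 * G 1 = G 1 * G 1 * (M 1 * N 1) := by rw [h2, mul_one]
      _ = G 1 * G 1 * M 1 * N 1 := by rw [mul_assoc (G 1 * G 1)]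
      _ = N 1 := by rw [hQ, one_mul]
  have h2 : G 1 = algSqrt a := by rw [← hN1]
  rw [← h2, h1, hN1]

theorem commute_algSqrt (hε : 0 < ε) (h : StrictRes ε a) {b : 𝔸} (hb : Commute b a) :
    Commute b (algSqrt a) := by
  refine Commute.smul_right ?_ _
  rw [Commute, SemiconjBy, ← integral_const_mul_of_integrable (h.integrableOn hε),
    ← integral_mul_const_of_integrable (h.integrableOn hε)]
  congr 1
  ext s
  exact (((Commute.one_right b).sub_right ((commute_algRes hb s).smul_right _)).smul_right _).eq

end Algebra

end

/-! ### Bounded accretive operators and their square roots -/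

section

variable {H : Type*} [NormedAddCommGroup H] [InnerProductSpace ℂ H] [CompleteSpace H]

/-- `Re ⟨Tx, x⟩ ≥ ε ‖x‖²` for a bounded operator `T`. -/
def Coercive (ε : ℝ) (T : H →L[ℂ] H) : Prop := ∀ x, ε * ‖x‖ ^ 2 ≤ (inner ℂ x (T x)).re

theorem Coercive.mul_norm_le {ε : ℝ} {T : H →L[ℂ] H} (hT : Coercive ε T) (x : H) :
    ε * ‖x‖ ≤ ‖T x‖ := mul_norm_le_of_re_inner (hT x)

theorem Coercive.smul_one_add {ε : ℝ} {T : H →L[ℂ] H} (hT : Coercive ε T) (s : ℝ) :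
    Coercive (s + ε) ((s : ℂ) • 1 + T) := by
  intro x
  have h := re_inner_smul_add_self (s : ℂ) x (T x)
  change _ ≤ (inner ℂ x ((s : ℂ) • x + T x)).re
  rw [h, Complex.ofReal_re]
  linarith [hT x]

theorem Coercive.isUnit {ε : ℝ} (hε : 0 < ε) {T : H →L[ℂ] H} (hT : Coercive ε T) : IsUnit T := by
  rw [ContinuousLinearMap.isUnit_iff_bijective]
  constructor
  · refine (injective_iff_map_eq_zero T).2 fun x hx => ?_
    have := hT.mul_norm_le x
    rw [hx, norm_zero] at this
    have h2 : ‖x‖ ≤ 0 := by nlinarith [norm_nonneg x]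
    exact norm_le_zero_iff.1 h2
  · have h := surjective_add_of_bound ((ε : ℂ) • (LinearMap.id : H →ₗ[ℂ] H))
      ((T : H →ₗ[ℂ] H) - (ε : ℂ) • LinearMap.id) (K := ‖T - (ε : ℂ) • 1‖ / ε) (by
        intro t ht0 ht1 x
        change ‖(T - (ε : ℂ) • 1) x‖ ≤ _ * ‖(ε : ℂ) • x + (t : ℂ) • (T x - (ε : ℂ) • x)‖
        have h1 : ε * ‖x‖ ≤ ‖(ε : ℂ) • x + (t : ℂ) • (T x - (ε : ℂ) • x)‖ := by
          apply mul_norm_le_of_re_inner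
          rw [inner_add_right, inner_smul_right, inner_smul_right, inner_sub_right,
            inner_smul_right, inner_self_eq_norm_sq_to_K]
          simp only [Complex.add_re, Complex.re_ofReal_mul, Complex.sub_re, Complex.coe_algebraMap]
          rw [← Complex.ofReal_pow, Complex.ofReal_re]
          nlinarith [hT x]
        refine ((T - (ε : ℂ) • 1).le_opNorm x).trans ?_
        rw [div_mul_eq_mul_div, mul_div_assoc]
        gcongr
        rw [le_div_iff₀ hε, mul_comm]
        exact h1)
      (fun y => ⟨(ε : ℂ)⁻¹ • y, by
        change (ε : ℂ) • (ε : ℂ)⁻¹ • y = y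
        rw [smul_inv_smul₀ (by exact_mod_cast hε.ne')]⟩)
    rw [add_sub_cancel] at h
    exact h

theorem Coercive.apply_inverse {ε : ℝ} (hε : 0 < ε) {T : H →L[ℂ] H} (hT : Coercive ε T) (x : H) :
    T (Ring.inverse T x) = x :=
  congrArg (fun A : H →L[ℂ] H => A x) (Ring.mul_inverse_cancel _ (hT.isUnit hε))

theorem Coercive.norm_inverse_le {ε : ℝ} (hε : 0 < ε) {T : H →L[ℂ] H} (hT : Coercive ε T) :
    ‖Ring.inverse T‖ ≤ ε⁻¹ := by
  refine ContinuousLinearMap.opNorm_le_bound _ (by positivity) fun x => ?_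
  have := hT.mul_norm_le (Ring.inverse T x)
  rw [hT.apply_inverse hε] at this
  rwa [inv_mul_eq_div, le_div_iff₀ hε, mul_comm]

theorem Coercive.strictRes {ε : ℝ} (hε : 0 < ε) {T : H →L[ℂ] H} (hT : Coercive ε T) :
    StrictRes ε T := by
  intro s hs
  have h := hT.smul_one_add s
  have h0 : 0 < s + ε := by linarith
  exact ⟨h.isUnit h0, h.norm_inverse_le h0⟩

/-- The segment from `1` to a coercive operator consists of coercive operators, and so does a
neighbourhood of it on the line that it spans. -/
theorem Coercive.algSqrt_mul_self {ε : ℝ} (hε : 0 < ε) {T : H →L[ℂ] H} (hT : Coercive ε T) :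
    algSqrt T * algSqrt T = T := by
  set ε' := min ε 1 with hε'
  have h0 : 0 < ε' := lt_min hε one_pos
  have h1 : ε' ≤ 1 := min_le_right _ _
  have hT' : ∀ x, ε' * ‖x‖ ^ 2 ≤ (inner ℂ x (T x)).re := fun x =>
    (by gcongr; exact min_le_left _ _ : ε' * ‖x‖ ^ 2 ≤ ε * ‖x‖ ^ 2).trans (hT x)
  have hη : 0 < min (ε' / 2) (1 / (2 * (‖T‖ + 1))) := by positivity
  refine PencilFactor.algSqrt_mul_self (ε := ε' / 2) (half_pos h0) hη fun t ht => ?_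
  refine Coercive.strictRes (half_pos h0) fun x => ?_
  have e : (inner ℂ x ((1 + (t : ℂ) • (T - 1)) x)).re
      = (1 - t) * ‖x‖ ^ 2 + t * (inner ℂ x (T x)).re := by
    change (inner ℂ x (x + (t : ℂ) • (T x - x))).re = _
    rw [inner_add_right, inner_smul_right, inner_sub_right, inner_self_eq_norm_sq_to_K]
    simp only [Complex.add_re, Complex.re_ofReal_mul, Complex.sub_re, Complex.coe_algebraMap]
    rw [← Complex.ofReal_pow, Complex.ofReal_re]
    ring
  rw [e]
  have hx := sq_nonneg ‖x‖
  rcases le_or_gt 0 t with h2 | h2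
  · have h3 : t < 1 + ε' / 2 := ht.2.trans_le (by gcongr; exact min_le_left _ _)
    have h4 := mul_le_mul_of_nonneg_left (hT' x) h2
    have h5 : ε' / 2 ≤ 1 - t + t * ε' := by nlinarith
    nlinarith
  · have h3 : -(1 / (2 * (‖T‖ + 1))) < t :=
      lt_of_le_of_lt (neg_le_neg (min_le_right _ _)) ht.1
    have h4 : (inner ℂ x (T x)).re ≤ ‖T‖ * ‖x‖ ^ 2 := by
      have h5 : (inner ℂ x (T x)).re ≤ ‖x‖ * ‖T x‖ := re_inner_le_norm (𝕜 := ℂ) _ _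
      nlinarith [T.le_opNorm x, norm_nonneg x]
    have h5 : -t * (‖T‖ + 1) ≤ 1 / 2 := by
      have h6 : -t < 1 / (2 * (‖T‖ + 1)) := by linarith
      rw [lt_div_iff₀ (by positivity)] at h6
      linarith
    have h6 : -t * (inner ℂ x (T x)).re ≤ -t * (‖T‖ * ‖x‖ ^ 2) := by gcongr; linarith
    have h7 : ε' / 2 ≤ 1 - t + t * ‖T‖ := by nlinarith
    nlinarith

/-- The half-plane condition for `(1 - ik) W` improves to a strict one when `k < 1` and `W²` is
accretive: a vector on which the form of `(1 - ik) W` almost vanishes would make the form of `W²`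
close to `-‖Wx‖²`, up to a factor in the open right half plane. -/
theorem strict_of_sq_accretive {W : H →L[ℂ] H} {η k : ℝ} (hη : 0 < η) (hk0 : 0 ≤ k) (hk1 : k < 1)
    (hW : Coercive η W) (hW2 : ∀ x, 0 ≤ (inner ℂ x (W (W x))).re)
    (h : ∀ x, 0 ≤ (inner ℂ x (W x)).re + k * (inner ℂ x (W x)).im) :
    ∃ c : ℝ, 0 < c ∧ ∀ x, c * ‖x‖ ^ 2 ≤ (inner ℂ x (W x)).re + k * (inner ℂ x (W x)).im := by
  set u : ℂ := 1 - Complex.I * k with hu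
  have hure : u.re = 1 := by simp [hu]
  have huim : u.im = -k := by simp [hu]
  set Q : H →L[ℂ] H := u • W with hQ
  set X : H →L[ℂ] H := Q + ContinuousLinearMap.adjoint Q with hX
  have hQre : ∀ x, (inner ℂ x (Q x)).re = (inner ℂ x (W x)).re + k * (inner ℂ x (W x)).im := by
    intro x
    change (inner ℂ x (u • W x)).re = _
    rw [inner_smul_right, Complex.mul_re, hure, huim]
    ring
  have hXre : ∀ x, (inner ℂ x (X x)).re = 2 * (inner ℂ x (Q x)).re := by
    intro x
    rw [hX, add_apply, inner_add_right, ContinuousLinearMap.adjoint_inner_right,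
      Complex.add_re, ← inner_conj_symm (Q x) x, Complex.conj_re]
    ring
  have hXsymm : ∀ x y, inner ℂ (X x) y = inner ℂ x (X y) := by
    intro x y
    rw [hX, add_apply, add_apply, inner_add_left,
      inner_add_right, ContinuousLinearMap.adjoint_inner_right,
      ContinuousLinearMap.adjoint_inner_left, add_comm]
  set m : ℝ := ‖X‖ + 1 with hm
  have hm0 : 0 < m := by positivity
  have hXbound : ∀ x, ‖X x‖ ^ 2 ≤ m * (inner ℂ x (X x)).re := by
    intro x
    set v := X x with hv
    have h1 : 0 ≤ (inner ℂ (x - ((m⁻¹ : ℝ) : ℂ) • v) (X (x - ((m⁻¹ : ℝ) : ℂ) • v))).re := by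
      rw [hXre, hQre]; linarith [h (x - ((m⁻¹ : ℝ) : ℂ) • v)]
    rw [map_sub, map_smul, ← hv, inner_sub_left, inner_sub_right, inner_sub_right,
      inner_smul_left, inner_smul_left, inner_smul_right, inner_smul_right, Complex.conj_ofReal,
      ← hXsymm x v, ← hv, inner_self_eq_norm_sq_to_K] at h1
    simp only [Complex.sub_re, Complex.re_ofReal_mul, Complex.coe_algebraMap] at h1
    rw [← Complex.ofReal_pow, Complex.ofReal_re] at h1
    have h2 : (inner ℂ v (X v)).re ≤ m * ‖v‖ ^ 2 := by
      have h3 : (inner ℂ v (X v)).re ≤ ‖v‖ * ‖X v‖ := re_inner_le_norm (𝕜 := ℂ) _ _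
      nlinarith [X.le_opNorm v, norm_nonneg v]
    have h3 : m⁻¹ * (m⁻¹ * (inner ℂ v (X v)).re) ≤ m⁻¹ * ‖v‖ ^ 2 := by
      gcongr
      rw [inv_mul_le_iff₀ hm0]
      exact h2
    have h4 : m⁻¹ * ‖v‖ ^ 2 ≤ (inner ℂ x v).re := by linarith
    rwa [inv_mul_le_iff₀ hm0] at h4
  have hlow : ∀ x, (1 - k ^ 2) * η * ‖x‖ ≤ 2 * ‖X x‖ := by
    intro x
    have h1 : inner ℂ (X x) (Q x) = (‖Q x‖ : ℂ) ^ 2 + u ^ 2 * inner ℂ x (W (W x)) := by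
      rw [hX, add_apply, inner_add_left, inner_self_eq_norm_sq_to_K,
        ContinuousLinearMap.adjoint_inner_left]
      have : Q (Q x) = u ^ 2 • W (W x) := by
        rw [hQ, smul_apply, smul_apply, map_smul, smul_smul,
          pow_two]
      rw [this, inner_smul_right]
      rfl
    have h2 : ((starRingEnd ℂ) u ^ 2 * inner ℂ (X x) (Q x)).re
        = (1 - k ^ 2) * ‖Q x‖ ^ 2 + (1 + k ^ 2) ^ 2 * (inner ℂ x (W (W x))).re := by
      have e1 : (starRingEnd ℂ) u ^ 2 * u ^ 2 = (((1 + k ^ 2) ^ 2 : ℝ) : ℂ) := by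
        rw [← mul_pow, ← Complex.normSq_eq_conj_mul_self, Complex.normSq_apply, hure, huim]
        push_cast
        ring
      rw [h1, mul_add, ← mul_assoc, e1, Complex.add_re, Complex.re_ofReal_mul, ← Complex.ofReal_pow,
        Complex.re_mul_ofReal]
      congr 2
      rw [pow_two, Complex.mul_re, Complex.conj_re, Complex.conj_im, hure, huim]
      ring
    have h3 : ((starRingEnd ℂ) u ^ 2 * inner ℂ (X x) (Q x)).re ≤ 2 * (‖X x‖ * ‖Q x‖) := by
      refine (Complex.re_le_norm _).trans ?_
      rw [norm_mul, norm_pow, RCLike.norm_conj, ← Complex.normSq_eq_norm_sq, Complex.normSq_apply,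
        hure, huim]
      gcongr
      · nlinarith
      · exact norm_inner_le_norm _ _
    have h4 : η * ‖x‖ ≤ ‖Q x‖ := by
      refine (hW.mul_norm_le x).trans ?_
      rw [hQ, smul_apply, norm_smul]
      refine le_mul_of_one_le_left (norm_nonneg _) ?_
      have := Complex.re_le_norm u
      rwa [hure] at this
    have h5 : 0 ≤ (1 + k ^ 2) ^ 2 * (inner ℂ x (W (W x))).re := by have := hW2 x; positivity
    have h6 : (1 - k ^ 2) * ‖Q x‖ * ‖Q x‖ ≤ 2 * ‖X x‖ * ‖Q x‖ := by nlinarith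
    have hk2 : 0 ≤ 1 - k ^ 2 := by nlinarith
    rcases (norm_nonneg (Q x)).eq_or_lt with h7 | h7
    · rw [← h7] at h4
      have h8 : ‖x‖ = 0 := le_antisymm (by nlinarith [norm_nonneg x]) (norm_nonneg x)
      rw [h8, mul_zero]
      positivity
    · have h8 := le_of_mul_le_mul_right h6 h7
      nlinarith
  refine ⟨((1 - k ^ 2) * η) ^ 2 / (8 * m), ?_, fun x => ?_⟩
  · have : 0 < 1 - k ^ 2 := by nlinarith
    positivity
  · have h1 := hXbound x
    rw [hXre, hQre] at h1
    have h2 : ((1 - k ^ 2) * η * ‖x‖) ^ 2 ≤ (2 * ‖X x‖) ^ 2 := by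
      have : 0 ≤ 1 - k ^ 2 := by nlinarith
      exact pow_le_pow_left₀ (by positivity) (hlow x) 2
    rw [div_mul_eq_mul_div, div_le_iff₀ (by positivity)]
    nlinarith

/-- The set of `k ∈ [0, 1]` for which `(1 - ik) W` is accretive is closed, contains `0`, and by
`strict_of_sq_accretive` is open to the right in `[0, 1)`; hence it contains `1`. -/
theorem im_le_re_of_coercive {W : H →L[ℂ] H} {η : ℝ} (hη : 0 < η)
    (hW : Coercive η W) (hW2 : ∀ x, 0 ≤ (inner ℂ x (W (W x))).re) (x : H) :
    0 ≤ (inner ℂ x (W x)).re + (inner ℂ x (W x)).im := by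
  let S : Set ℝ := {k | ∀ x, 0 ≤ (inner ℂ x (W x)).re + k * (inner ℂ x (W x)).im}
  have hS : IsClosed S := by
    simp only [S, Set.ofPred_forall]
    exact isClosed_iInter fun x => isClosed_le continuous_const (by fun_prop)
  have h0 : (0 : ℝ) ∈ S := fun x => by
    have := hW x
    have h2 : 0 ≤ η * ‖x‖ ^ 2 := by positivity
    simp only [zero_mul, add_zero]
    linarith
  have hsub : Set.Icc (0 : ℝ) 1 ⊆ S := by
    refine (hS.inter isClosed_Icc).Icc_subset_of_forall_exists_gt h0 fun k hk y hy => ?_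
    obtain ⟨hkS, hk0, hk1⟩ := hk
    obtain ⟨c, hc, hc'⟩ := strict_of_sq_accretive hη hk0 hk1 hW hW2 hkS
    have hm : 0 < ‖W‖ + 1 := by positivity
    refine ⟨min y (k + c / (‖W‖ + 1)), fun x => ?_, lt_min hy (by linarith [div_pos hc hm]),
      min_le_left _ _⟩
    set δ := min y (k + c / (‖W‖ + 1)) - k with hδ
    have hδ0 : 0 ≤ δ := sub_nonneg.2 (le_min (le_of_lt hy) (by linarith [div_pos hc hm]))
    have hδ1 : δ ≤ c / (‖W‖ + 1) := by
      have := min_le_right y (k + c / (‖W‖ + 1))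
      linarith
    rw [le_div_iff₀ hm] at hδ1
    have h1 : |(inner ℂ x (W x)).im| ≤ ‖W‖ * ‖x‖ ^ 2 := by
      refine (Complex.abs_im_le_norm _).trans ((norm_inner_le_norm _ _).trans ?_)
      nlinarith [W.le_opNorm x, norm_nonneg x]
    have h2 := (abs_le.1 h1).1
    have h3 := hc' x
    have e : min y (k + c / (‖W‖ + 1)) = k + δ := by rw [hδ]; ring
    rw [e]
    have h4 : δ * (-(‖W‖ * ‖x‖ ^ 2)) ≤ δ * (inner ℂ x (W x)).im := by gcongr
    nlinarith [sq_nonneg ‖x‖]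
  simpa using hsub (Set.right_mem_Icc.2 zero_le_one) x

/-- A bounded accretive operator with accretive square has its numerical range in the sector
`{|arg z| ≤ π / 4}`. -/
theorem abs_im_le_re_of_sq_accretive {P : H →L[ℂ] H} (hP : ∀ x, 0 ≤ (inner ℂ x (P x)).re)
    (hP2 : ∀ x, 0 ≤ (inner ℂ x (P (P x))).re) (x : H) :
    |(inner ℂ x (P x)).im| ≤ (inner ℂ x (P x)).re := by
  -- one of the two half-plane conditions, by approximation of `P` by the coercive `η + P`; the
  -- other one is the same condition for the adjoint
  have key : ∀ P : H →L[ℂ] H, (∀ x, 0 ≤ (inner ℂ x (P x)).re) →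
      (∀ x, 0 ≤ (inner ℂ x (P (P x))).re) → ∀ x,
      0 ≤ (inner ℂ x (P x)).re + (inner ℂ x (P x)).im := by
    intro P hP hP2 x
    have h1 : ∀ η : ℝ, 0 < η → 0 ≤ (inner ℂ x (P x)).re + (inner ℂ x (P x)).im
        + η * ‖x‖ ^ 2 := by
      intro η hη
      have hc : Coercive (η + 0) ((η : ℂ) • 1 + P) :=
        Coercive.smul_one_add (fun x => by simpa using hP x) η
      rw [add_zero] at hc
      have h2 := im_le_re_of_coercive hη hc (fun y => by
        change 0 ≤ (inner ℂ y ((η : ℂ) • ((η : ℂ) • y + P y) + P ((η : ℂ) • y + P y))).re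
        rw [map_add, map_smul]
        simp only [inner_add_right, inner_smul_right, inner_self_eq_norm_sq_to_K, Complex.add_re,
          Complex.re_ofReal_mul, Complex.coe_algebraMap]
        rw [← Complex.ofReal_pow, Complex.ofReal_re]
        have := hP y
        have := hP2 y
        positivity) x
      change 0 ≤ (inner ℂ x ((η : ℂ) • x + P x)).re + (inner ℂ x ((η : ℂ) • x + P x)).im at h2
      simp only [inner_add_right, inner_smul_right, inner_self_eq_norm_sq_to_K, Complex.add_re,
          Complex.re_ofReal_mul, Complex.coe_algebraMap, Complex.add_im,
          Complex.im_ofReal_mul] at h2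
      rw [← Complex.ofReal_pow, Complex.ofReal_re, Complex.ofReal_im] at h2
      linarith
    refine ge_of_tendsto' (x := atTop) (f := fun n : ℕ => (inner ℂ x (P x)).re
      + (inner ℂ x (P x)).im + (1 / ((n : ℝ) + 1)) * ‖x‖ ^ 2) ?_
      fun n => h1 _ (by positivity)
    simpa using ((tendsto_one_div_add_atTop_nhds_zero_nat (𝕜 := ℝ)).mul_const
      (‖x‖ ^ 2)).const_add ((inner ℂ x (P x)).re + (inner ℂ x (P x)).im)
  have h1 := key P hP hP2 x
  have hadj : ∀ y z : H, inner ℂ y (ContinuousLinearMap.adjoint P z)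
      = (starRingEnd ℂ) (inner ℂ z (P y)) := fun y z => by
    rw [ContinuousLinearMap.adjoint_inner_right, inner_conj_symm]
  have h2 := key (ContinuousLinearMap.adjoint P)
    (fun y => by rw [hadj, Complex.conj_re]; exact hP y)
    (fun y => by
      rw [ContinuousLinearMap.adjoint_inner_right, hadj, Complex.conj_re]; exact hP2 y) x
  rw [hadj, Complex.conj_re, Complex.conj_im] at h2
  rw [abs_le]
  constructor <;> linarith

end

/-! ### The Balakrishnan integral of an m-accretive operator -/

section

variable {H : Type*} [NormedAddCommGroup H] [InnerProductSpace ℂ H]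

theorem integral_le_re_inner_integral [CompleteSpace H] {μ : Measure ℝ} {f : ℝ → H} {g : ℝ → ℝ}
    (hf : Integrable f μ) (hg : Integrable g μ) (x : H) (h : ∀ᵐ s ∂μ, g s ≤ (inner ℂ x (f s)).re) :
    ∫ s, g s ∂μ ≤ (inner ℂ x (∫ s, f s ∂μ)).re := by
  rw [← integral_inner hf]
  have h1 : Integrable (fun s => inner ℂ x (f s)) μ := hf.const_inner x
  have h2 : (∫ s, inner ℂ x (f s) ∂μ).re = ∫ s, (inner ℂ x (f s)).re ∂μ :=
    (integral_re h1).symm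
  rw [h2]
  exact integral_mono_ae hg h1.re h

variable [CompleteSpace H] {T : H →ₗ.[ℂ] H}

theorem IsMAccretive.balakrishnan_eq (hT : IsMAccretive T) (x : H) :
    balakrishnan T x = ((1 / Real.pi : ℝ) : ℂ) •
      ∫ s in Set.Ioi (0 : ℝ), ((s ^ (-(1 / 2 : ℝ)) : ℝ) : ℂ) • yos T s x := by
  rw [balakrishnan]
  congr 1
  refine setIntegral_congr_fun measurableSet_Ioi fun s hs => ?_
  simp only [hT.mulResolvent_eq hs]

theorem IsMAccretive.norm_yos_le_inv (hT : IsMAccretive T) {s : ℝ} (hs : 0 < s) {x y : H}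
    (h : (x, y) ∈ T.graph) : ‖yos T s x‖ ≤ (‖x‖ + ‖y‖) * (s + 1)⁻¹ := by
  have h1 := hT.norm_yos_le hs x
  have h2 := hT.norm_yos_le_div hs h
  rw [le_div_iff₀ hs] at h2
  rw [← div_eq_mul_inv, le_div_iff₀ (by linarith)]
  linarith

theorem IsMAccretive.aestronglyMeasurable (hT : IsMAccretive T) (x : H) :
    AEStronglyMeasurable (fun s : ℝ => ((s ^ (-(1 / 2 : ℝ)) : ℝ) : ℂ) • yos T s x)
      (volume.restrict (Set.Ioi 0)) :=
  ((continuousOn_rpow_coe _).smul (hT.continuousOn_yos x)).aestronglyMeasurable measurableSet_Ioi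

theorem IsMAccretive.norm_integrand_le (hT : IsMAccretive T) {s : ℝ} (hs : 0 < s) {x y : H}
    (h : (x, y) ∈ T.graph) : ‖((s ^ (-(1 / 2 : ℝ)) : ℝ) : ℂ) • yos T s x‖ ≤
      (‖x‖ + ‖y‖) * (s ^ (-(1 / 2 : ℝ)) * (s + 1)⁻¹) := by
  rw [norm_rpow_smul _ _ hs, mul_left_comm]
  gcongr
  exact hT.norm_yos_le_inv hs h

theorem IsMAccretive.integrableOn (hT : IsMAccretive T) {x y : H} (h : (x, y) ∈ T.graph) :
    IntegrableOn (fun s : ℝ => ((s ^ (-(1 / 2 : ℝ)) : ℝ) : ℂ) • yos T s x) (Set.Ioi 0) :=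
  (integrableOn_rpow_mul_inv_add_one.const_mul (‖x‖ + ‖y‖)).mono' (hT.aestronglyMeasurable x)
    ((ae_restrict_mem measurableSet_Ioi).mono fun _ hs => hT.norm_integrand_le hs h)

theorem IsMAccretive.norm_balakrishnan_le (hT : IsMAccretive T) {x y : H}
    (h : (x, y) ∈ T.graph) : ‖balakrishnan T x‖ ≤ ‖x‖ + ‖y‖ := by
  rw [hT.balakrishnan_eq, norm_smul, Complex.norm_real, Real.norm_of_nonneg (by positivity)]
  have h1 := norm_integral_le_of_norm_le (μ := volume.restrict (Set.Ioi (0 : ℝ)))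
    (integrableOn_rpow_mul_inv_add_one.const_mul (‖x‖ + ‖y‖))
    ((ae_restrict_mem measurableSet_Ioi).mono fun _ hs => hT.norm_integrand_le hs h)
  rw [integral_const_mul, integral_rpow_mul_inv_add_one] at h1
  rw [one_div, inv_mul_le_iff₀ Real.pi_pos, mul_comm]
  exact h1

theorem IsMAccretive.balakrishnan_add (hT : IsMAccretive T) {x y x' y' : H}
    (h : (x, y) ∈ T.graph) (h' : (x', y') ∈ T.graph) :
    balakrishnan T (x + x') = balakrishnan T x + balakrishnan T x' := by
  rw [hT.balakrishnan_eq, hT.balakrishnan_eq, hT.balakrishnan_eq, ← smul_add,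
    ← integral_add (hT.integrableOn h) (hT.integrableOn h')]
  simp only [map_add, smul_add]

/-- A bounded operator that leaves the graph invariant commutes with the Balakrishnan integral. -/
theorem IsMAccretive.balakrishnan_map (hT : IsMAccretive T) {M : H →L[ℂ] H}
    (hM : ∀ x y, (x, y) ∈ T.graph → (M x, M y) ∈ T.graph) {x y : H} (h : (x, y) ∈ T.graph) :
    balakrishnan T (M x) = M (balakrishnan T x) := by
  rw [hT.balakrishnan_eq, hT.balakrishnan_eq, map_smul, ← M.integral_comp_comm (hT.integrableOn h)]
  congr 1
  refine setIntegral_congr_fun measurableSet_Ioi fun s hs => ?_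
  simp only [yos_apply, map_smul, map_sub]
  rw [hT.commute_res hM (by simpa using hs)]

theorem IsMAccretive.balakrishnan_smul (hT : IsMAccretive T) (c : ℂ) {x y : H}
    (h : (x, y) ∈ T.graph) : balakrishnan T (c • x) = c • balakrishnan T x :=
  hT.balakrishnan_map (M := c • 1) (fun _ _ h => T.graph.smul_mem c h) h

theorem IsMAccretive.balakrishnan_sub (hT : IsMAccretive T) {x y x' y' : H}
    (h : (x, y) ∈ T.graph) (h' : (x', y') ∈ T.graph) :
    balakrishnan T (x - x') = balakrishnan T x - balakrishnan T x' := by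
  have h1 := hT.balakrishnan_add h (T.graph.smul_mem (-1) h')
  rw [hT.balakrishnan_smul _ h', neg_one_smul, neg_one_smul] at h1
  rw [sub_eq_add_neg, h1, sub_eq_add_neg]

theorem IsMAccretive.re_inner_balakrishnan (hT : IsMAccretive T) {x y : H}
    (h : (x, y) ∈ T.graph) : 0 ≤ (inner ℂ x (balakrishnan T x)).re := by
  rw [hT.balakrishnan_eq, inner_smul_right, Complex.re_ofReal_mul]
  refine mul_nonneg (by positivity) ?_
  refine le_of_eq_of_le ?_ (integral_le_re_inner_integral (hT.integrableOn h) (g := fun _ => 0)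
    (integrable_zero _ _ _) x ((ae_restrict_mem measurableSet_Ioi).mono fun s hs => ?_))
  · simp
  · have hs : 0 < s := hs
    rw [inner_smul_right, Complex.re_ofReal_mul]
    exact mul_nonneg (by positivity) ((sq_nonneg _).trans (hT.norm_sq_yos_le hs x))

/-! ### Approximation by bounded operators -/

/-- A bounded operator, as an everywhere defined partial linear map. -/
def ofCLM (A : H →L[ℂ] H) : H →ₗ.[ℂ] H := (A : H →ₗ[ℂ] H).toPMap ⊤

theorem mem_graph_ofCLM {A : H →L[ℂ] H} {x y : H} : (x, y) ∈ (ofCLM A).graph ↔ A x = y := by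
  rw [LinearPMap.mem_graph_iff]
  constructor
  · rintro ⟨z, rfl, rfl⟩
    rfl
  · rintro rfl
    exact ⟨⟨x, Submodule.mem_top⟩, rfl, rfl⟩

theorem Coercive.isMAccretive {ε : ℝ} (hε : 0 < ε) {A : H →L[ℂ] H} (hA : Coercive ε A) :
    IsMAccretive (ofCLM A) := by
  refine ⟨?_, ?_, 1, one_pos, fun y => ?_⟩
  · rw [isAccretive_iff_graph]
    intro x y hxy
    rw [← mem_graph_ofCLM.1 hxy]
    exact (by positivity : 0 ≤ ε * ‖x‖ ^ 2).trans (hA x)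
  · change Dense ((⊤ : Submodule ℂ H) : Set H)
    simp
  · have h1 := (hA.smul_one_add 1).apply_inverse (by positivity) y
    exact ⟨⟨_, Submodule.mem_top⟩, h1⟩

theorem Coercive.yos_ofCLM {ε : ℝ} (hε : 0 < ε) {A : H →L[ℂ] H} (hA : Coercive ε A) {s : ℝ}
    (hs : 0 < s) (x : H) : yos (ofCLM A) s x = (1 - (s : ℂ) • algRes A s) x := by
  have h1 := (hA.isMAccretive hε).res_real_apply hs (mem_graph_ofCLM.2 (rfl : A (algRes A s x) = _))
  have h2 := (hA.smul_one_add s).apply_inverse (by positivity) x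
  change (s : ℂ) • (algRes A s x) + A (algRes A s x) = x at h2
  rw [h2] at h1
  rw [yos_apply, h1]
  rfl

theorem Coercive.algSqrt_apply {ε : ℝ} (hε : 0 < ε) {A : H →L[ℂ] H} (hA : Coercive ε A) (x : H) :
    algSqrt A x = balakrishnan (ofCLM A) x := by
  rw [(hA.isMAccretive hε).balakrishnan_eq]
  rw [algSqrt, smul_apply, ContinuousLinearMap.integral_apply ((hA.strictRes hε).integrableOn hε)]
  congr 1
  refine setIntegral_congr_fun measurableSet_Ioi fun s hs => ?_
  simp only [hA.yos_ofCLM hε hs]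
  rfl

/-- The bounded approximation `k T (k + T)⁻¹ + 1/k`, `k = n + 1`, of an m-accretive operator.
The summand `1/k` makes it coercive, hence invertible. -/
def approx (T : H →ₗ.[ℂ] H) (n : ℕ) : H →L[ℂ] H :=
  (((n : ℝ) + 1 : ℝ) : ℂ) • yos T ((n : ℝ) + 1) + ((1 / ((n : ℝ) + 1) : ℝ) : ℂ) • 1

theorem approx_apply (T : H →ₗ.[ℂ] H) (n : ℕ) (x : H) :
    approx T n x = (((n : ℝ) + 1 : ℝ) : ℂ) • yos T ((n : ℝ) + 1) x
      + ((1 / ((n : ℝ) + 1) : ℝ) : ℂ) • x := rfl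

theorem IsMAccretive.coercive_approx (hT : IsMAccretive T) (n : ℕ) :
    Coercive (1 / ((n : ℝ) + 1)) (approx T n) := by
  intro x
  have h : 0 < (n : ℝ) + 1 := by positivity
  have h1 := (sq_nonneg _).trans (hT.norm_sq_yos_le h x)
  rw [approx_apply, inner_add_right, inner_smul_right, inner_smul_right,
    inner_self_eq_norm_sq_to_K, Complex.add_re, Complex.re_ofReal_mul, Complex.re_ofReal_mul]
  simp only [Complex.coe_algebraMap]
  rw [← Complex.ofReal_pow, Complex.ofReal_re]
  have := mul_nonneg h.le h1
  linarith

theorem IsMAccretive.approx_eq (hT : IsMAccretive T) (n : ℕ) {x y : H} (h : (x, y) ∈ T.graph) :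
    approx T n x = (((n : ℝ) + 1 : ℝ) : ℂ) • res T (((n : ℝ) + 1 : ℝ) : ℂ) y
      + ((1 / ((n : ℝ) + 1) : ℝ) : ℂ) • x := by
  rw [approx_apply, hT.yos_eq_res (by positivity) h]

theorem IsMAccretive.tendsto_approx (hT : IsMAccretive T) {x y : H} (h : (x, y) ∈ T.graph) :
    Tendsto (fun n => approx T n x) atTop (𝓝 y) := by
  simp only [hT.approx_eq _ h]
  have h1 : Tendsto (fun n : ℕ => (n : ℝ) + 1) atTop atTop :=
    tendsto_atTop_add_const_right _ _ tendsto_natCast_atTop_atTop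
  have h2 := (hT.tendsto_smul_res y).comp h1
  have h3 : Tendsto (fun n : ℕ => ((1 / ((n : ℝ) + 1) : ℝ) : ℂ) • x) atTop (𝓝 0) := by
    have := ((Complex.continuous_ofReal.tendsto 0).comp
      (tendsto_one_div_add_atTop_nhds_zero_nat (𝕜 := ℝ))).smul_const x
    rw [Complex.ofReal_zero, zero_smul] at this
    exact this
  have h4 := h2.add h3
  rw [add_zero] at h4
  exact h4

theorem IsMAccretive.norm_approx_le (hT : IsMAccretive T) (n : ℕ) {x y : H}
    (h : (x, y) ∈ T.graph) : ‖approx T n x‖ ≤ ‖x‖ + ‖y‖ := by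
  have hn : 0 < (n : ℝ) + 1 := by positivity
  rw [hT.approx_eq _ h, add_comm ‖x‖]
  refine (norm_add_le _ _).trans (add_le_add ?_ ?_)
  · rw [norm_smul, Complex.norm_real, Real.norm_of_nonneg hn.le]
    have := hT.norm_res_real_le hn y
    rwa [le_div_iff₀ hn, mul_comm] at this
  · rw [norm_smul, Complex.norm_real, Real.norm_of_nonneg (by positivity)]
    refine mul_le_of_le_one_left (norm_nonneg _) ?_
    rw [div_le_one hn]
    linarith [(Nat.cast_nonneg n : (0 : ℝ) ≤ n)]

theorem IsMAccretive.isMAccretive_approx (hT : IsMAccretive T) (n : ℕ) :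
    IsMAccretive (ofCLM (approx T n)) := (hT.coercive_approx n).isMAccretive (by positivity)

theorem IsMAccretive.tendsto_yos_approx (hT : IsMAccretive T) {s : ℝ} (hs : 0 < s) (x : H) :
    Tendsto (fun n => yos (ofCLM (approx T n)) s x) atTop (𝓝 (yos T s x)) := by
  simp only [yos_apply]
  refine tendsto_const_nhds.sub (Tendsto.const_smul ?_ _)
  rw [tendsto_iff_norm_sub_tendsto_zero]
  have h1 := (hT.tendsto_approx (hT.res_yos_mem hs x)).const_sub (yos T s x)
  rw [sub_self] at h1
  have h2 := h1.norm.div_const s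
  rw [norm_zero, zero_div] at h2
  refine squeeze_zero (fun _ => norm_nonneg _) (fun n => ?_) h2
  have h3 := (hT.isMAccretive_approx n).res_real_apply hs
    (mem_graph_ofCLM.2 (rfl : approx T n (res T s x) = _))
  have h4 : res (ofCLM (approx T n)) s x - res T s x
      = res (ofCLM (approx T n)) s (yos T s x - approx T n (res T s x)) := by
    have h5 : yos T s x - approx T n (res T s x)
        = x - ((s : ℂ) • res T s x + approx T n (res T s x)) := by rw [yos_apply]; abel
    rw [h5, map_sub, h3]
  rw [h4]
  exact (hT.isMAccretive_approx n).norm_res_real_le hs _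

/-- The square roots of the bounded approximations converge to the Balakrishnan integral on the
domain. -/
theorem IsMAccretive.tendsto_algSqrt_approx (hT : IsMAccretive T) {x y : H}
    (h : (x, y) ∈ T.graph) :
    Tendsto (fun n => algSqrt (approx T n) x) atTop (𝓝 (balakrishnan T x)) := by
  have h1 : ∀ n, algSqrt (approx T n) x = _ := fun n =>
    ((hT.coercive_approx n).algSqrt_apply (by positivity) x).trans
      ((hT.isMAccretive_approx n).balakrishnan_eq x)
  simp only [h1]
  rw [hT.balakrishnan_eq]
  refine Tendsto.const_smul ?_ _
  refine tendsto_integral_of_dominated_convergence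
    (fun s => (‖x‖ + (‖x‖ + ‖y‖)) * (s ^ (-(1 / 2 : ℝ)) * (s + 1)⁻¹))
    (fun n => (hT.isMAccretive_approx n).aestronglyMeasurable x)
    (integrableOn_rpow_mul_inv_add_one.const_mul _) (fun n => ?_) ?_
  · refine (ae_restrict_mem measurableSet_Ioi).mono fun s hs => ?_
    have hs : 0 < s := hs
    refine ((hT.isMAccretive_approx n).norm_integrand_le hs (mem_graph_ofCLM.2 rfl)).trans ?_
    gcongr
    exact hT.norm_approx_le n h
  · refine (ae_restrict_mem measurableSet_Ioi).mono fun s hs => ?_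
    exact (hT.tendsto_yos_approx hs x).const_smul _

theorem IsMAccretive.algSqrt_approx_sq (hT : IsMAccretive T) (n : ℕ) (x : H) :
    algSqrt (approx T n) (algSqrt (approx T n) x) = approx T n x :=
  congrArg (fun A : H →L[ℂ] H => A x) ((hT.coercive_approx n).algSqrt_mul_self (by positivity))

theorem IsMAccretive.abs_im_le_re_balakrishnan (hT : IsMAccretive T) {x y : H}
    (h : (x, y) ∈ T.graph) :
    |(inner ℂ x (balakrishnan T x)).im| ≤ (inner ℂ x (balakrishnan T x)).re := by
  have h1 := (tendsto_const_nhds (x := x)).inner (𝕜 := ℂ) (hT.tendsto_algSqrt_approx h)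
  refine le_of_tendsto_of_tendsto'
    ((continuous_abs.comp Complex.continuous_im).tendsto _ |>.comp h1)
    ((Complex.continuous_re.tendsto _).comp h1) fun n => ?_
  have hc := hT.coercive_approx n
  have hn : (0 : ℝ) < 1 / ((n : ℝ) + 1) := by positivity
  refine abs_im_le_re_of_sq_accretive (fun z => ?_) (fun z => ?_) x
  · rw [hc.algSqrt_apply hn]
    exact (hT.isMAccretive_approx n).re_inner_balakrishnan (mem_graph_ofCLM.2 rfl)
  · rw [hT.algSqrt_approx_sq]
    exact (by positivity : (0 : ℝ) ≤ 1 / ((n : ℝ) + 1) * ‖z‖ ^ 2).trans (hc z)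

/-! ### The square root -/

/-- If the resolvent of `T'` leaves the graph of `T` invariant, then the Balakrishnan integral of
`T` leaves the graph of `T'` invariant, as far as it is defined. -/
theorem IsMAccretive.balakrishnan_mem_graph (hT : IsMAccretive T) {T' : H →ₗ.[ℂ] H}
    (hT' : IsMAccretive T')
    (hM : ∀ x y, (x, y) ∈ T.graph → (res T' 1 x, res T' 1 y) ∈ T.graph) {x y a b : H}
    (h : (x, y) ∈ T'.graph) (hx : (x, a) ∈ T.graph) (hy : (y, b) ∈ T.graph) :
    (balakrishnan T x, balakrishnan T y) ∈ T'.graph := by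
  have h1 := hT'.res_apply (μ := 1) (by simp) h
  rw [one_smul] at h1
  have h2 := hT.balakrishnan_map hM (T.graph.add_mem hx hy)
  rw [h1, hT.balakrishnan_add hx hy] at h2
  have h3 := hT'.res_mem (μ := 1) (by simp) (balakrishnan T x + balakrishnan T y)
  rw [← h2, one_smul, add_sub_cancel_left] at h3
  exact h3

theorem IsMAccretive.algSqrt_approx_mem_graph (hT : IsMAccretive T) (n : ℕ) {x y : H}
    (h : (x, y) ∈ T.graph) :
    (algSqrt (approx T n) x, algSqrt (approx T n) y) ∈ T.graph := by
  have h0 : (0 : ℝ) < (1 : ℂ).re := by simp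
  have hcomm : Commute (res T 1) (algSqrt (approx T n)) := by
    refine commute_algSqrt (ε := 1 / ((n : ℝ) + 1)) (by positivity)
      ((hT.coercive_approx n).strictRes (by positivity)) ?_
    refine ContinuousLinearMap.ext fun z => ?_
    change res T 1 (approx T n z) = approx T n (res T 1 z)
    rw [approx_apply, approx_apply, yos_apply, yos_apply]
    simp only [map_add, map_smul, map_sub]
    rw [hT.commute_res (fun _ _ h => hT.res_mem_graph h0 h) (by rw [Complex.ofReal_re]; positivity)]
  have h1 := hT.res_apply h0 h
  have h2 : res T 1 (algSqrt (approx T n) ((1 : ℂ) • x + y))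
      = algSqrt (approx T n) (res T 1 ((1 : ℂ) • x + y)) :=
    congrArg (fun A : H →L[ℂ] H => A _) hcomm.eq
  have h3 := hT.res_mem h0 (algSqrt (approx T n) ((1 : ℂ) • x + y))
  rw [h2, h1, map_add, one_smul, one_smul, add_sub_cancel_left] at h3
  exact h3

/-- The Balakrishnan integral squares to `T` on the domain of `T²`. -/
theorem IsMAccretive.balakrishnan_balakrishnan (hT : IsMAccretive T) {x y z : H}
    (hx : (x, y) ∈ T.graph) (hy : (y, z) ∈ T.graph) :
    balakrishnan T (balakrishnan T x) = y := by
  have h0 : (0 : ℝ) < (1 : ℂ).re := by simp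
  have hb : (balakrishnan T x, balakrishnan T y) ∈ T.graph :=
    hT.balakrishnan_mem_graph hT (fun _ _ h => hT.res_mem_graph h0 h) hx hx hy
  let P := fun n => algSqrt (approx T n)
  have h1 : Tendsto (fun n => P n (P n x)) atTop (𝓝 y) := by
    simp only [P, hT.algSqrt_approx_sq]
    exact hT.tendsto_approx hx
  have h2 : Tendsto (fun n => P n (P n x - balakrishnan T x)) atTop (𝓝 0) := by
    have e1 := (hT.tendsto_algSqrt_approx hx).sub_const (balakrishnan T x)
    have e2 := (hT.tendsto_algSqrt_approx hy).sub_const (balakrishnan T y)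
    rw [sub_self] at e1 e2
    have e3 := (e1.norm.add e1.norm).add e2.norm
    simp only [norm_zero, add_zero] at e3
    refine squeeze_zero_norm (fun n => ?_) e3
    have e4 := T.graph.sub_mem (hT.algSqrt_approx_mem_graph n hx) hb
    have e5 := hT.norm_approx_le n e4
    have e6 := (hT.isMAccretive_approx n).norm_balakrishnan_le
      (mem_graph_ofCLM.2 (rfl : approx T n (P n x - balakrishnan T x) = _))
    rw [← (hT.coercive_approx n).algSqrt_apply (by positivity)] at e6
    refine e6.trans ?_
    rw [add_assoc]
    gcongr
  have h3 := (hT.tendsto_algSqrt_approx hb).add h2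
  have h4 : ∀ n, P n (balakrishnan T x) + P n (P n x - balakrishnan T x) = P n (P n x) := by
    intro n
    rw [map_sub]; abel
  rw [add_zero] at h3
  exact tendsto_nhds_unique (h3.congr h4) h1

/-- The graph of the Balakrishnan integral over the domain of `T`. -/
def balGraph (T : H →ₗ.[ℂ] H) (hT : IsMAccretive T) : Submodule ℂ (H × H) where
  carrier := {p : H × H | p.1 ∈ T.domain ∧ p.2 = balakrishnan T p.1}
  add_mem' := by
    rintro ⟨x, y⟩ ⟨x', y'⟩ ⟨hx, hy⟩ ⟨hx', hy'⟩
    obtain rfl : y = balakrishnan T x := hy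
    obtain rfl : y' = balakrishnan T x' := hy'
    obtain ⟨z, hz⟩ := LinearPMap.mem_domain_iff.1 hx
    obtain ⟨z', hz'⟩ := LinearPMap.mem_domain_iff.1 hx'
    exact ⟨T.domain.add_mem hx hx', (hT.balakrishnan_add hz hz').symm⟩
  zero_mem' := ⟨T.domain.zero_mem, by
    simpa using (hT.balakrishnan_smul 0 T.graph.zero_mem).symm⟩
  smul_mem' := by
    rintro c ⟨x, y⟩ ⟨hx, hy⟩
    obtain rfl : y = balakrishnan T x := hy
    obtain ⟨z, hz⟩ := LinearPMap.mem_domain_iff.1 hx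
    exact ⟨T.domain.smul_mem c hx, (hT.balakrishnan_smul c hz).symm⟩

theorem IsMAccretive.mem_balGraph (hT : IsMAccretive T) {x y : H} (h : (x, y) ∈ T.graph) :
    (x, balakrishnan T x) ∈ balGraph T hT := ⟨LinearPMap.mem_domain_of_mem_graph h, rfl⟩

theorem IsMAccretive.relSectorial_balGraph (hT : IsMAccretive T) :
    RelSectorial (balGraph T hT) := by
  rintro x y ⟨hx, hy⟩
  obtain rfl : y = balakrishnan T x := hy
  obtain ⟨z, hz⟩ := LinearPMap.mem_domain_iff.1 hx
  exact hT.abs_im_le_re_balakrishnan hz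

theorem IsMAccretive.dense_balGraph (hT : IsMAccretive T) :
    Dense ((balGraph T hT).map (LinearMap.fst ℂ H H) : Set H) :=
  hT.2.1.mono fun x hx => ⟨(x, balakrishnan T x), ⟨hx, rfl⟩, rfl⟩

theorem IsMAccretive.graph_sqrtOp (hT : IsMAccretive T) :
    (sqrtOp T).graph = (balGraph T hT).topologicalClosure := by
  have h1 : Submodule.span ℂ {p : H × H | p.1 ∈ T.domain ∧ p.2 = balakrishnan T p.1}
      = balGraph T hT := Submodule.span_eq (balGraph T hT)
  rw [sqrtOp, h1]
  refine Submodule.toLinearPMap_graph_eq _ ?_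
  rintro ⟨x, y⟩ hxy (rfl : x = 0)
  exact hT.relSectorial_balGraph.relAccretive.topologicalClosure.eq_zero_of_zero_mem
    (Dense.map_fst_topologicalClosure hT.dense_balGraph) hxy

theorem IsMAccretive.mem_graph_sqrtOp (hT : IsMAccretive T) {x y : H} (h : (x, y) ∈ T.graph) :
    (x, balakrishnan T x) ∈ (sqrtOp T).graph := by
  rw [hT.graph_sqrtOp]
  exact (balGraph T hT).le_topologicalClosure (hT.mem_balGraph h)

theorem IsMAccretive.relSectorial_sqrtOp (hT : IsMAccretive T) :
    RelSectorial (sqrtOp T).graph := by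
  rw [hT.graph_sqrtOp]
  exact hT.relSectorial_balGraph.topologicalClosure

/-- If `G` is closed and accretive then the range of `μ + G` is closed, so it suffices that it is
dense. -/
theorem RelAccretive.surjective_of_dense {G : Submodule ℂ (H × H)} (hG : RelAccretive G)
    (hc : IsClosed (G : Set (H × H))) {μ : ℂ} (hμ : 0 < μ.re)
    (hd : Dense {f : H | ∃ x y, (x, y) ∈ G ∧ μ • x + y = f}) (f : H) :
    ∃ x y, (x, y) ∈ G ∧ μ • x + y = f := by
  have : CompleteSpace G := hc.completeSpace_coe
  let L : G →L[ℂ] H := (μ • ContinuousLinearMap.fst ℂ H H + ContinuousLinearMap.snd ℂ H H).comp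
    G.subtypeL
  have hL : AntilipschitzWith (Real.toNNReal (1 / μ.re + (‖μ‖ / μ.re + 1))) L := by
    refine AddMonoidHomClass.antilipschitz_of_bound L ?_
    rintro ⟨⟨x, y⟩, hxy⟩
    have h1 := hG.mul_norm_le μ hxy
    change ‖(x, y)‖ ≤ _ * ‖μ • x + y‖
    have h2 : ‖x‖ ≤ 1 / μ.re * ‖μ • x + y‖ := by
      rw [one_div, inv_mul_eq_div, le_div_iff₀ hμ, mul_comm]
      exact h1
    have h3 : ‖y‖ ≤ (‖μ‖ / μ.re + 1) * ‖μ • x + y‖ := by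
      have h4 : y = (μ • x + y) - μ • x := by abel
      calc ‖y‖ = ‖(μ • x + y) - μ • x‖ := by rw [← h4]
        _ ≤ ‖μ • x + y‖ + ‖μ‖ * ‖x‖ := (norm_sub_le _ _).trans (by rw [norm_smul])
        _ ≤ ‖μ • x + y‖ + ‖μ‖ * (1 / μ.re * ‖μ • x + y‖) := by gcongr
        _ = _ := by ring
    have h5 : 0 ≤ 1 / μ.re * ‖μ • x + y‖ := by positivity
    have h6 : 0 ≤ (‖μ‖ / μ.re + 1) * ‖μ • x + y‖ := by positivity
    rw [Real.coe_toNNReal _ (by positivity), add_mul, Prod.norm_mk]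
    exact max_le (by linarith) (by linarith)
  have hcl := hL.isClosed_range L.uniformContinuous
  have hrange : Set.range L = Set.univ := by
    rw [← hcl.closure_eq, ← dense_iff_closure_eq]
    refine hd.mono ?_
    rintro _ ⟨x, y, hxy, rfl⟩
    exact ⟨⟨(x, y), hxy⟩, rfl⟩
  obtain ⟨⟨⟨x, y⟩, hxy⟩, hf⟩ := hrange.symm ▸ Set.mem_univ f
  exact ⟨x, y, hxy, hf⟩

/-- The square root of an m-accretive operator is m-accretive. With `P` the Balakrishnan integral
and `μ = 1 + 2i`, the identity `(μ + P) (P - μ) = T + 3 - 4i` on the domain of `T²` shows that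
`μ + P` has dense range. -/
theorem IsMAccretive.isMAccretive_sqrtOp (hT : IsMAccretive T) : IsMAccretive (sqrtOp T) := by
  have h0 : (0 : ℝ) < (1 : ℂ).re := by simp
  have hμ : (0 : ℝ) < (1 + 2 * Complex.I : ℂ).re := by simp
  have hd : Dense ((sqrtOp T).domain : Set H) := hT.2.1.mono fun x hx => by
    obtain ⟨z, hz⟩ := LinearPMap.mem_domain_iff.1 hx
    exact LinearPMap.mem_domain_of_mem_graph (hT.mem_graph_sqrtOp hz)
  refine isMAccretive_of_surjective
    (isAccretive_iff_graph.2 hT.relSectorial_sqrtOp.relAccretive) hd hμ ?_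
  refine hT.relSectorial_sqrtOp.relAccretive.surjective_of_dense
    (by rw [hT.graph_sqrtOp]; exact Submodule.isClosed_topologicalClosure _) hμ ?_
  refine hT.2.1.mono fun f hf => ?_
  obtain ⟨x, z, hxz, rfl⟩ := hT.exists_mem_graph (μ := 3 - 4 * Complex.I) (by simp) f
  have hz : z ∈ T.domain := by
    have := T.domain.sub_mem hf
      (T.domain.smul_mem (3 - 4 * Complex.I) (LinearPMap.mem_domain_of_mem_graph hxz))
    simpa using this
  obtain ⟨w, hzw⟩ := LinearPMap.mem_domain_iff.1 hz
  have hb : (balakrishnan T x, balakrishnan T z) ∈ T.graph :=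
    hT.balakrishnan_mem_graph hT (fun _ _ h => hT.res_mem_graph h0 h) hxz hxz hzw
  have hu := T.graph.sub_mem hb (T.graph.smul_mem (1 + 2 * Complex.I) hxz)
  refine ⟨_, _, hT.mem_graph_sqrtOp hu, ?_⟩
  change (1 + 2 * Complex.I) • (balakrishnan T x - (1 + 2 * Complex.I) • x) +
    balakrishnan T (balakrishnan T x - (1 + 2 * Complex.I) • x) = _
  rw [hT.balakrishnan_sub hb (T.graph.smul_mem _ hxz), hT.balakrishnan_balakrishnan hxz hzw,
    hT.balakrishnan_smul _ hxz]
  have : (3 - 4 * Complex.I : ℂ) = -((1 + 2 * Complex.I) * (1 + 2 * Complex.I)) := by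
    linear_combination 4 * Complex.I_sq
  rw [this, neg_smul, mul_smul, smul_sub]
  abel

/-- An m-accretive operator `B` whose square is m-accretive is the square root of its square. For
`x` in the domain of `B⁴`, the difference `v = Bx - (B²)^{1/2} x` satisfies
`Bv + (B²)^{1/2} v = 0`; accretivity puts `v` in both null spaces, which are orthogonal to the
ranges. -/
theorem IsMAccretive.balakrishnan_sq_mem_graph {B : H →ₗ.[ℂ] H} (hB : IsMAccretive B)
    (hA : IsMAccretive (sq B)) {x z : H} (hx : (x, z) ∈ (sq B).graph) :
    (x, balakrishnan (sq B) x) ∈ B.graph := by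
  have h0 : (0 : ℝ) < (1 : ℂ).re := by simp
  have hM : ∀ x y, (x, y) ∈ (sq B).graph → (res B 1 x, res B 1 y) ∈ (sq B).graph := by
    intro x y h
    obtain ⟨w, h1, h2⟩ := mem_graph_sq.1 h
    exact mem_graph_sq.2 ⟨_, hB.res_mem_graph h0 h1, hB.res_mem_graph h0 h2⟩
  have key : ∀ x z w, (x, z) ∈ (sq B).graph → (z, w) ∈ (sq B).graph →
      (x, balakrishnan (sq B) x) ∈ B.graph := by
    intro x z w hx hz
    obtain ⟨y, hxy, hyz⟩ := mem_graph_sq.1 hx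
    obtain ⟨z', hzz', hz'w⟩ := mem_graph_sq.1 hz
    have hyA : (y, z') ∈ (sq B).graph := mem_graph_sq.2 ⟨z, hyz, hzz'⟩
    have hbA := hA.balakrishnan_mem_graph hA (fun _ _ h => hA.res_mem_graph h0 h) hx hx hz
    have hbB := hA.balakrishnan_mem_graph hB hM hxy hx hyA
    have hvB : (y - balakrishnan (sq B) x, z - balakrishnan (sq B) y) ∈ B.graph :=
      B.graph.sub_mem hyz hbB
    have hvA := (sq B).graph.sub_mem hyA hbA
    have hv := hA.balakrishnan_sub hyA hbA
    rw [hA.balakrishnan_balakrishnan hx hz] at hv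
    set v := y - balakrishnan (sq B) x with hvdef
    have hvG := hA.mem_balGraph hvA
    have h1 := hB.relAccretive _ _ hvB
    have h2 := hA.relSectorial_balGraph.relAccretive _ _ hvG
    have h3 : (inner ℂ v (balakrishnan (sq B) v)).re = 0 := by
      refine le_antisymm ?_ h2
      have e : balakrishnan (sq B) v = -(z - balakrishnan (sq B) y) := by
        rw [neg_sub]; exact hv
      rw [e, inner_neg_right, Complex.neg_re]
      linarith
    have h4 := hA.relSectorial_balGraph.eq_zero_of_re_inner hA.dense_balGraph hvG h3
    have h5 : z - balakrishnan (sq B) y = 0 := by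
      rw [← neg_eq_zero, neg_sub]
      exact hv.symm.trans h4
    have hvG' := hvG
    rw [h4] at hvG'
    rw [h5] at hvB
    have h6 := hB.relAccretive.inner_eq_zero hvB hxy
    have h7 := hA.relSectorial_balGraph.relAccretive.inner_eq_zero hvG' (hA.mem_balGraph hx)
    have h8 : inner ℂ v v = 0 := by
      nth_rewrite 2 [hvdef]
      rw [inner_sub_right, h6, h7, sub_zero]
    have h9 : y = balakrishnan (sq B) x := sub_eq_zero.1 (inner_self_eq_zero.1 h8)
    rwa [← h9]
  -- the regularizations `n (n + B²)⁻¹ x` lie in the domain of `B⁴` and converge in graph norm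
  let R : ℕ → H →L[ℂ] H := fun n => ((n : ℝ) : ℂ) • res (sq B) ((n : ℝ) : ℂ)
  have hR : ∀ u, Tendsto (fun n => R n u) atTop (𝓝 u) := fun u =>
    (hA.tendsto_smul_res u).comp tendsto_natCast_atTop_atTop
  have hmem : ∀ n : ℕ, 0 < n → ∀ u v, (u, v) ∈ (sq B).graph → (R n u, R n v) ∈ (sq B).graph :=
    fun n hn u v h => (sq B).graph.smul_mem _ (hA.res_mem_graph (by simpa using hn) h)
  have h1 : Tendsto (fun n => balakrishnan (sq B) (R n x)) atTop (𝓝 (balakrishnan (sq B) x)) := by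
    rw [tendsto_iff_norm_sub_tendsto_zero]
    have e1 := (hR x).sub_const x
    have e2 := (hR z).sub_const z
    rw [sub_self] at e1 e2
    have e3 := e1.norm.add e2.norm
    rw [norm_zero, add_zero] at e3
    refine squeeze_zero' (Eventually.of_forall fun _ => norm_nonneg _) ?_ e3
    filter_upwards [eventually_gt_atTop 0] with n hn
    have e4 := hmem n hn _ _ hx
    rw [← hA.balakrishnan_sub e4 hx]
    exact hA.norm_balakrishnan_le ((sq B).graph.sub_mem e4 hx)
  refine hB.isClosed_graph.mem_of_tendsto ((hR x).prodMk_nhds h1) ?_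
  filter_upwards [eventually_gt_atTop 0] with n hn
  exact key _ _ _ (hmem n hn _ _ hx)
    ((sq B).graph.smul_mem _ (hA.res_mem (by simpa using hn) z))

end

/-! ### The angle between the square roots of two operators -/

section

variable {H : Type*} [NormedAddCommGroup H] [InnerProductSpace ℂ H] [CompleteSpace H]

section Angle

variable {A L : H →ₗ.[ℂ] H} {κ : ℝ}

theorem re_inner_comm (x y : H) : (inner ℂ x y).re = (inner ℂ y x).re := inner_re_symm (𝕜 := ℂ) x y

/-- The lower bound for `Re ⟨Ax, Lx⟩` passes to the bounded operator `L (t + L)⁻¹`. -/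
theorem re_inner_yos_right (hA : IsMAccretive A) (hL : IsMAccretive L) (hd : A.domain = L.domain)
    (hκ : 0 ≤ κ) (h : ∀ x y z, (x, y) ∈ A.graph → (x, z) ∈ L.graph →
      -κ * ‖x‖ ^ 2 ≤ (inner ℂ y z).re) {t : ℝ} (ht : 0 < t) {x y : H} (hx : (x, y) ∈ A.graph) :
    -κ * t⁻¹ * ‖x‖ ^ 2 ≤ (inner ℂ y (yos L t x)).re := by
  have h1 := hL.res_yos_mem ht x
  obtain ⟨a, ha⟩ := LinearPMap.mem_domain_iff.1
    (hd ▸ LinearPMap.mem_domain_of_mem_graph h1 : res L t x ∈ A.domain)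
  have h2 := h _ _ _ ha h1
  have h3 := hA.relAccretive _ _ (A.graph.sub_mem hx (A.graph.smul_mem (t : ℂ) ha))
  change 0 ≤ (inner ℂ (yos L t x) (y - (t : ℂ) • a)).re at h3
  rw [re_inner_comm, inner_sub_left, inner_smul_left, Complex.conj_ofReal, Complex.sub_re,
    Complex.re_ofReal_mul] at h3
  have h4 : t * (-κ * ‖res L t x‖ ^ 2) ≤ t * (inner ℂ a (yos L t x)).re := by gcongr
  have h5 : t * (κ * ‖res L t x‖ ^ 2) ≤ κ * t⁻¹ * ‖x‖ ^ 2 := by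
    calc t * (κ * ‖res L t x‖ ^ 2) ≤ t * (κ * (‖x‖ / t) ^ 2) := by
          gcongr
          exact hL.norm_res_real_le ht x
      _ = _ := by field_simp
  linarith

/-- The lower bound for `Re ⟨Ax, Lx⟩` passes to the bounded operators `A (s + A)⁻¹` and
`L (t + L)⁻¹`. -/
theorem re_inner_yos_yos (hA : IsMAccretive A) (hL : IsMAccretive L) (hd : A.domain = L.domain)
    (hκ : 0 ≤ κ) (h : ∀ x y z, (x, y) ∈ A.graph → (x, z) ∈ L.graph →
      -κ * ‖x‖ ^ 2 ≤ (inner ℂ y z).re) {s t : ℝ} (hs : 0 < s) (ht : 0 < t) (x : H) :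
    -κ * t⁻¹ * s⁻¹ * ‖x‖ ^ 2 ≤ (inner ℂ (yos A s x) (yos L t x)).re := by
  have h1 := hA.res_yos_mem hs x
  have h2 := re_inner_yos_right hA hL hd hκ h ht h1
  have h3 := (sq_nonneg _).trans (hL.norm_sq_yos_le ht (yos A s x))
  have h4 : yos L t x = (s : ℂ) • yos L t (res A s x) + yos L t (yos A s x) := by
    rw [← map_smul, ← map_add, smul_res_add_yos]
  rw [h4, inner_add_right, inner_smul_right, Complex.add_re, Complex.re_ofReal_mul]
  have h5 : s * (-κ * t⁻¹ * ‖res A s x‖ ^ 2) ≤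
      s * (inner ℂ (yos A s x) (yos L t (res A s x))).re := by gcongr
  have h6 : s * (κ * t⁻¹ * ‖res A s x‖ ^ 2) ≤ κ * t⁻¹ * s⁻¹ * ‖x‖ ^ 2 := by
    calc s * (κ * t⁻¹ * ‖res A s x‖ ^ 2) ≤ s * (κ * t⁻¹ * (‖x‖ / s) ^ 2) := by
          gcongr
          exact hA.norm_res_real_le hs x
      _ = _ := by field_simp
  linarith

theorem integrableOn_rpow_mul_inv :
    IntegrableOn (fun s : ℝ => s ^ (-(1 / 2 : ℝ)) * s⁻¹) (Set.Ioi 1) := by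
  refine (integrableOn_Ioi_rpow_of_lt (a := -(3 / 2 : ℝ)) (by norm_num) one_pos).congr_fun
    (fun s hs => ?_) measurableSet_Ioi
  have hs : 0 < s := one_pos.trans hs
  simp only
  rw [← Real.rpow_neg_one s, ← Real.rpow_add hs]
  norm_num

theorem integral_rpow_mul_inv :
    ∫ s in Set.Ioi (1 : ℝ), s ^ (-(1 / 2 : ℝ)) * s⁻¹ = 2 := by
  have h := integral_Ioi_rpow_of_lt (a := -(3 / 2 : ℝ)) (by norm_num) one_pos
  rw [setIntegral_congr_fun (g := fun s : ℝ => s ^ (-(3 / 2 : ℝ))) measurableSet_Ioi, h]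
  · norm_num
  · intro s hs
    have hs : 0 < s := one_pos.trans hs
    simp only
    rw [← Real.rpow_neg_one s, ← Real.rpow_add hs]
    norm_num

/-- The part of the Balakrishnan integral over `(1, ∞)`. There the lower bound of
`re_inner_yos_yos` is integrable against the weights, and the part over `(0, 1)` is a bounded
operator. -/
def tail (T : H →ₗ.[ℂ] H) (x : H) : H :=
  ((1 / Real.pi : ℝ) : ℂ) •
    ∫ s in Set.Ioi (1 : ℝ), ((s ^ (-(1 / 2 : ℝ)) : ℝ) : ℂ) • yos T s x

theorem IsMAccretive.integrableOn_tail {T : H →ₗ.[ℂ] H} (hT : IsMAccretive T) {x y : H}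
    (h : (x, y) ∈ T.graph) :
    IntegrableOn (fun s : ℝ => ((s ^ (-(1 / 2 : ℝ)) : ℝ) : ℂ) • yos T s x) (Set.Ioi 1) :=
  (hT.integrableOn h).mono_set (Set.Ioi_subset_Ioi zero_le_one)

theorem IsMAccretive.norm_balakrishnan_sub_tail {T : H →ₗ.[ℂ] H} (hT : IsMAccretive T) {x y : H}
    (h : (x, y) ∈ T.graph) : ‖balakrishnan T x - tail T x‖ ≤ ‖x‖ := by
  have h1 := hT.integrableOn h
  have hu : Set.Ioi (0 : ℝ) = Set.Ioc 0 1 ∪ Set.Ioi 1 :=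
    (Set.Ioc_union_Ioi_eq_Ioi zero_le_one).symm
  have h2 : balakrishnan T x - tail T x = ((1 / Real.pi : ℝ) : ℂ) •
      ∫ s in Set.Ioc (0 : ℝ) 1, ((s ^ (-(1 / 2 : ℝ)) : ℝ) : ℂ) • yos T s x := by
    rw [hT.balakrishnan_eq, tail, ← smul_sub, hu, setIntegral_union
      (Set.Ioc_disjoint_Ioi le_rfl) measurableSet_Ioi
      (h1.mono_set Set.Ioc_subset_Ioi_self) (hT.integrableOn_tail h), add_sub_cancel_right]
  have hint : IntervalIntegrable (fun s : ℝ => s ^ (-(1 / 2 : ℝ))) volume 0 1 :=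
    intervalIntegral.intervalIntegrable_rpow' (by norm_num)
  have h3 : ∫ s in Set.Ioc (0 : ℝ) 1, s ^ (-(1 / 2 : ℝ)) = 2 := by
    rw [← intervalIntegral.integral_of_le zero_le_one, integral_rpow (Or.inl (by norm_num))]
    norm_num
  have h4 := norm_integral_le_of_norm_le (μ := volume.restrict (Set.Ioc (0 : ℝ) 1))
    (f := fun s : ℝ => ((s ^ (-(1 / 2 : ℝ)) : ℝ) : ℂ) • yos T s x)
    (g := fun s : ℝ => s ^ (-(1 / 2 : ℝ)) * ‖x‖)
    (((intervalIntegrable_iff_integrableOn_Ioc_of_le zero_le_one).1 hint).mul_const ‖x‖)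
    ((ae_restrict_mem measurableSet_Ioc).mono fun s hs => by
      rw [norm_rpow_smul _ _ hs.1]
      have := hs.1
      gcongr
      exact hT.norm_yos_le hs.1 x)
  rw [integral_mul_const, h3] at h4
  rw [h2, norm_smul, Complex.norm_real, Real.norm_of_nonneg (by positivity), one_div,
    inv_mul_le_iff₀ Real.pi_pos]
  refine h4.trans ?_
  gcongr
  exact Real.two_le_pi

/-- Integration of `re_inner_yos_yos` over `s, t > 1` gives the constant `(2 / π)² κ ≤ κ`. -/
theorem re_inner_tail_tail (hA : IsMAccretive A) (hL : IsMAccretive L) (hd : A.domain = L.domain)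
    (hκ : 0 ≤ κ) (h : ∀ x y z, (x, y) ∈ A.graph → (x, z) ∈ L.graph →
      -κ * ‖x‖ ^ 2 ≤ (inner ℂ y z).re) {x y z : H} (hx : (x, y) ∈ A.graph) (hz : (x, z) ∈ L.graph) :
    -κ * ‖x‖ ^ 2 ≤ (inner ℂ (tail A x) (tail L x)).re := by
  set a := ∫ s in Set.Ioi (1 : ℝ), ((s ^ (-(1 / 2 : ℝ)) : ℝ) : ℂ) • yos A s x with ha
  set l := ∫ s in Set.Ioi (1 : ℝ), ((s ^ (-(1 / 2 : ℝ)) : ℝ) : ℂ) • yos L s x with hl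
  have h1 : ∀ s : ℝ, 1 < s → -(2 * κ * ‖x‖ ^ 2) * s⁻¹ ≤ (inner ℂ (yos A s x) l).re := by
    intro s hs
    have hs0 : 0 < s := one_pos.trans hs
    have h2 := integral_le_re_inner_integral (hL.integrableOn_tail hz)
      (integrableOn_rpow_mul_inv.const_mul (-(κ * ‖x‖ ^ 2 * s⁻¹))) (yos A s x)
      ((ae_restrict_mem measurableSet_Ioi).mono fun t ht => by
        have ht0 : 0 < t := one_pos.trans ht
        rw [inner_smul_right, Complex.re_ofReal_mul]
        have h3 := mul_le_mul_of_nonneg_left (re_inner_yos_yos hA hL hd hκ h hs0 ht0 x)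
          (by positivity : 0 ≤ t ^ (-(1 / 2 : ℝ)))
        refine le_of_eq_of_le ?_ h3
        ring)
    rw [integral_const_mul, integral_rpow_mul_inv] at h2
    refine le_of_eq_of_le ?_ h2
    ring
  have h2 := integral_le_re_inner_integral (hA.integrableOn_tail hx)
    (integrableOn_rpow_mul_inv.const_mul (-(2 * κ * ‖x‖ ^ 2))) l
    ((ae_restrict_mem measurableSet_Ioi).mono fun s hs => by
      have hs0 : 0 < s := one_pos.trans hs
      rw [inner_smul_right, Complex.re_ofReal_mul, re_inner_comm]
      have h3 := mul_le_mul_of_nonneg_left (h1 s hs) (by positivity : 0 ≤ s ^ (-(1 / 2 : ℝ)))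
      refine le_of_eq_of_le ?_ h3
      ring)
  rw [integral_const_mul, integral_rpow_mul_inv] at h2
  rw [tail, tail, ← ha, ← hl, inner_smul_left, inner_smul_right, Complex.conj_ofReal,
    Complex.re_ofReal_mul, Complex.re_ofReal_mul, re_inner_comm]
  have hp := Real.two_le_pi
  have h3 : (1 / Real.pi) * ((1 / Real.pi) * (-(2 * κ * ‖x‖ ^ 2) * 2)) ≤
      (1 / Real.pi) * ((1 / Real.pi) * (inner ℂ l a).re) := by gcongr
  have h4 : (1 / Real.pi) * ((1 / Real.pi) * 4) ≤ 1 := by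
    rw [one_div, inv_mul_le_iff₀ Real.pi_pos, inv_mul_le_iff₀ Real.pi_pos]
    nlinarith
  have h5 : 0 ≤ κ * ‖x‖ ^ 2 := by positivity
  nlinarith

/-- If `Re ⟨Ax, Lx⟩ ≥ -κ ‖x‖²` then the square roots satisfy
`Re ⟨A^{1/2} x, L^{1/2} x⟩ ≥ 0` up to terms of lower order. -/
theorem re_inner_balakrishnan_balakrishnan (hA : IsMAccretive A) (hL : IsMAccretive L)
    (hd : A.domain = L.domain) (hκ : 0 ≤ κ)
    (h : ∀ x y z, (x, y) ∈ A.graph → (x, z) ∈ L.graph → -κ * ‖x‖ ^ 2 ≤ (inner ℂ y z).re)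
    {x y z : H} (hx : (x, y) ∈ A.graph) (hz : (x, z) ∈ L.graph) :
    -(κ + 1) * ‖x‖ ^ 2 - ‖x‖ * ‖balakrishnan L x‖ - ‖x‖ * ‖balakrishnan A x‖ ≤
      (inner ℂ (balakrishnan A x) (balakrishnan L x)).re := by
  have h1 := re_inner_tail_tail hA hL hd hκ h hx hz
  set a := balakrishnan A x
  set l := balakrishnan L x
  have ha : ‖a - tail A x‖ ≤ ‖x‖ := hA.norm_balakrishnan_sub_tail hx
  have hl : ‖l - tail L x‖ ≤ ‖x‖ := hL.norm_balakrishnan_sub_tail hz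
  have e : inner ℂ (tail A x) (tail L x) = inner ℂ a l - inner ℂ (a - tail A x) l
      - inner ℂ a (l - tail L x) + inner ℂ (a - tail A x) (l - tail L x) := by
    simp only [inner_sub_left, inner_sub_right]
    ring
  rw [e, Complex.add_re, Complex.sub_re, Complex.sub_re] at h1
  have b1 := neg_le_of_abs_le ((Complex.abs_re_le_norm _).trans
    (norm_inner_le_norm (𝕜 := ℂ) (a - tail A x) l))
  have b2 := neg_le_of_abs_le ((Complex.abs_re_le_norm _).trans
    (norm_inner_le_norm (𝕜 := ℂ) a (l - tail L x)))
  have b3 := (Complex.re_le_norm _).trans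
    (norm_inner_le_norm (𝕜 := ℂ) (a - tail A x) (l - tail L x))
  have c1 : ‖a - tail A x‖ * ‖l‖ ≤ ‖x‖ * ‖l‖ := by gcongr
  have c2 : ‖a‖ * ‖l - tail L x‖ ≤ ‖a‖ * ‖x‖ := by gcongr
  have c3 : ‖a - tail A x‖ * ‖l - tail L x‖ ≤ ‖x‖ * ‖x‖ := by gcongr
  nlinarith

end Angle

/-! ### The sector of angle `π / 4` -/

theorem sin_abs_arg (z : ℂ) : ‖z‖ * Real.sin |z.arg| = |z.im| := by
  rw [← Real.abs_sin_eq_sin_abs_of_abs_le_pi (Complex.abs_arg_le_pi z), ← abs_norm z, ← abs_mul,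
    Complex.norm_mul_sin_arg]

theorem cos_abs_arg (z : ℂ) : ‖z‖ * Real.cos |z.arg| = z.re := by
  rw [Real.cos_abs, Complex.norm_mul_cos_arg]

theorem abs_arg_le_pi_div_four {z : ℂ} (h : |z.im| ≤ z.re) : |z.arg| ≤ Real.pi / 4 := by
  rcases eq_or_ne z 0 with rfl | hz
  · simp only [Complex.arg_zero, abs_zero]
    positivity
  have hp := Real.pi_pos
  have h0 : 0 < ‖z‖ := norm_pos_iff.2 hz
  have h2 : |z.arg| ≤ Real.pi / 2 := Complex.abs_arg_le_pi_div_two_iff.2 ((abs_nonneg _).trans h)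
  rw [← sin_abs_arg, ← cos_abs_arg] at h
  have h3 := le_of_mul_le_mul_left h h0
  by_contra! hc
  have h4 := Real.sin_lt_sin_of_lt_of_le_pi_div_two (by linarith) h2 hc
  have h5 := Real.cos_lt_cos_of_nonneg_of_le_pi_div_two (by linarith) h2 hc
  rw [Real.sin_pi_div_four] at h4
  rw [Real.cos_pi_div_four] at h5
  linarith

theorem openSector_pi_div_four : openSector (Real.pi / 4) = {z : ℂ | |z.im| < z.re} := by
  have hp := Real.pi_pos
  ext z
  constructor
  · rintro ⟨hz, h⟩
    have h0 : 0 < ‖z‖ := norm_pos_iff.2 hz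
    have h4 := Real.sin_lt_sin_of_lt_of_le_pi_div_two (by linarith [abs_nonneg z.arg])
      (by linarith) h
    have h5 := Real.cos_lt_cos_of_nonneg_of_le_pi_div_two (abs_nonneg _) (by linarith) h
    rw [Real.sin_pi_div_four] at h4
    rw [Real.cos_pi_div_four] at h5
    change |z.im| < z.re
    rw [← sin_abs_arg, ← cos_abs_arg]
    exact mul_lt_mul_of_pos_left (h4.trans h5) h0
  · intro (h : |z.im| < z.re)
    have hz : z ≠ 0 := by
      rintro rfl
      simp at h
    have h0 : 0 < ‖z‖ := norm_pos_iff.2 hz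
    refine ⟨hz, lt_of_le_of_ne (abs_arg_le_pi_div_four h.le) fun hc => ?_⟩
    rw [← sin_abs_arg, ← cos_abs_arg, hc, Real.sin_pi_div_four, Real.cos_pi_div_four] at h
    exact lt_irrefl _ h

theorem RelSectorial.isSectorial {T : H →ₗ.[ℂ] H} (hT : RelSectorial T.graph) :
    IsSectorial (Real.pi / 4) T := by
  rintro z ⟨x, -, rfl⟩
  exact abs_arg_le_pi_div_four (hT _ _ (T.mem_graph x))

/-! ### The linear factor -/

section Factor

variable {B C : H →ₗ.[ℂ] H}

theorem isMAccretive_lam (hB2 : IsMAccretive (sq B)) (hC : IsAccretive C)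
    (hBC : LowerBoundCondition B C) : IsMAccretive (lam B C) := by
  obtain ⟨hd, α, β, δ, hα, hβ, hβ1, hδ, h⟩ := hBC
  refine hB2.add hC hd hα hβ hβ1 hδ fun x y z hy hz => ?_
  obtain ⟨u, rfl, rfl⟩ := (LinearPMap.mem_graph_iff _).1 hy
  obtain ⟨v, hv, rfl⟩ := (LinearPMap.mem_graph_iff _).1 hz
  obtain rfl : v = ⟨u, hd u.2⟩ := Subtype.ext hv
  exact h u u.2 (hd u.2)

/-- Completion of the square turns the compatibility condition into
`Re ⟨B²x, Λx⟩ ≥ -κ ‖x‖²`. -/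
theorem exists_lower_bound (hBC : LowerBoundCondition B C) :
    ∃ κ : ℝ, 0 ≤ κ ∧ ∀ x y z, (x, y) ∈ (sq B).graph → (x, z) ∈ (lam B C).graph →
      -κ * ‖x‖ ^ 2 ≤ (inner ℂ y z).re := by
  obtain ⟨hd, α, β, δ, hα, hβ, hβ1, hδ, h⟩ := hBC
  have hb : 0 < 1 - β := by linarith
  refine ⟨α + δ ^ 2 / (4 * (1 - β)), by positivity, fun x y w hy hw => ?_⟩
  obtain ⟨y', z, hy', hz, rfl⟩ := mem_graph_add.1 hw
  obtain rfl : y = y' := (sq B).mem_graph_snd_inj hy hy' rfl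
  obtain ⟨u, rfl, rfl⟩ := (LinearPMap.mem_graph_iff _).1 hy
  obtain ⟨v, hv, rfl⟩ := (LinearPMap.mem_graph_iff _).1 hz
  obtain rfl : v = ⟨u, hd u.2⟩ := Subtype.ext hv
  have h1 := h u u.2 (hd u.2)
  rw [inner_add_right, inner_self_eq_norm_sq_to_K, Complex.add_re, re_inner_comm (sq B u)]
  simp only [Complex.coe_algebraMap]
  rw [← Complex.ofReal_pow, Complex.ofReal_re]
  have h2 : 0 ≤ (1 - β) * (‖sq B u‖ - δ / (2 * (1 - β)) * ‖(u : H)‖) ^ 2 := by positivity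
  have h3 : (1 - β) * (‖sq B u‖ - δ / (2 * (1 - β)) * ‖(u : H)‖) ^ 2
      = (1 - β) * ‖sq B u‖ ^ 2 - δ * ‖sq B u‖ * ‖(u : H)‖
        + δ ^ 2 / (4 * (1 - β)) * ‖(u : H)‖ ^ 2 := by
    field_simp
    ring
  change -α * ‖(u : H)‖ ^ 2 - β * ‖sq B u‖ ^ 2 - δ * ‖sq B u‖ * ‖(u : H)‖ ≤ _ at h1
  linarith

/-- On the domain of `Λ^{1/2}` the operator `B` is sectorial, and `Re ⟨Bx, Λ^{1/2} x⟩` is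
nonnegative up to terms of lower order. Both hold on the core `D(Λ) = D(B²)` and pass to the limit,
because `B` is bounded relative to `Λ^{1/2}`. -/
theorem exists_bounds_on_sqrtOp (hB2 : IsMAccretive (sq B)) (hC : IsAccretive C)
    (hBC : LowerBoundCondition B C) (hdom : (sqrtOp (lam B C)).domain ≤ B.domain)
    (hB : IsAccretive B) :
    ∃ c : ℝ, 0 ≤ c ∧ ∀ x y z, (x, y) ∈ (sqrtOp (lam B C)).graph → (x, z) ∈ B.graph →
      |(inner ℂ x z).im| ≤ (inner ℂ x z).re ∧
      -c * ‖x‖ ^ 2 - 0 * ‖y‖ ^ 2 - c * ‖y‖ * ‖x‖ ≤ (inner ℂ z y).re := by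
  have hL := isMAccretive_lam hB2 hC hBC
  have hBm := isMAccretive_of_sq hB hB2
  have hS := hL.isMAccretive_sqrtOp
  obtain ⟨K, hK0, hK⟩ := hS.exists_relative_bound hB hdom
  obtain ⟨κ, hκ, hlow⟩ := exists_lower_bound hBC
  have hd : (sq B).domain = (lam B C).domain := (inf_eq_left.2 hBC.1).symm
  refine ⟨κ + 1 + K, by positivity, fun x y z hy hz => ?_⟩
  have hy' := hy
  rw [hL.graph_sqrtOp] at hy'
  obtain ⟨p, hp, hlim⟩ := mem_closure_iff_seq_limit.1 hy'
  have hpS : ∀ n, p n ∈ (sqrtOp (lam B C)).graph := fun n => by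
    rw [hL.graph_sqrtOp]
    exact (balGraph _ hL).le_topologicalClosure (hp n)
  have hpA : ∀ n, ∃ a, ((p n).1, a) ∈ (sq B).graph := fun n =>
    LinearPMap.mem_domain_iff.1 (hd ▸ (hp n).1)
  choose a ha using hpA
  let b : ℕ → H := fun n => balakrishnan (sq B) (p n).1
  have hb : ∀ n, ((p n).1, b n) ∈ B.graph := fun n => hBm.balakrishnan_sq_mem_graph hB2 (ha n)
  have h1 := (continuous_fst.tendsto _).comp hlim
  have h2 := (continuous_snd.tendsto _).comp hlim
  have h3 : Tendsto b atTop (𝓝 z) := by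
    rw [tendsto_iff_norm_sub_tendsto_zero]
    have e1 := (h1.sub_const x).norm
    have e2 := (h2.sub_const y).norm
    have e3 := (e1.add e2).const_mul K
    simp only [sub_self, norm_zero, add_zero, mul_zero] at e3
    exact squeeze_zero (fun _ => norm_nonneg _) (fun n =>
      hK _ _ _ ((sqrtOp (lam B C)).graph.sub_mem (hpS n) hy) (B.graph.sub_mem (hb n) hz)) e3
  have hclosed : IsClosed {q : H × H × H | |(inner ℂ q.1 q.2.2).im| ≤ (inner ℂ q.1 q.2.2).re ∧
      -(κ + 1 + K) * ‖q.1‖ ^ 2 - 0 * ‖q.2.1‖ ^ 2 - (κ + 1 + K) * ‖q.2.1‖ * ‖q.1‖ ≤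
        (inner ℂ q.2.2 q.2.1).re} := by
    rw [Set.ofPred_and]
    exact (isClosed_le (by fun_prop) (by fun_prop)).inter (isClosed_le (by fun_prop) (by fun_prop))
  refine hclosed.mem_of_tendsto (h1.prodMk_nhds (h2.prodMk_nhds h3)) (Eventually.of_forall
    fun n => ⟨hB2.abs_im_le_re_balakrishnan (ha n), ?_⟩)
  obtain ⟨w, hw⟩ := LinearPMap.mem_domain_iff.1 (hp n).1
  have e : (p n).2 = balakrishnan (lam B C) (p n).1 := (hp n).2
  have h4 := re_inner_balakrishnan_balakrishnan hB2 hL hd hκ hlow (ha n) hw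
  have h5 := hK _ _ _ (hpS n) (hb n)
  rw [← e] at h4
  refine le_trans ?_ h4
  have h6 : ‖(p n).1‖ * ‖b n‖ ≤ ‖(p n).1‖ * (K * (‖(p n).1‖ + ‖(p n).2‖)) := by gcongr
  have h7 : 0 ≤ κ * ‖(p n).2‖ * ‖(p n).1‖ := by positivity
  change -(κ + 1 + K) * ‖(p n).1‖ ^ 2 - 0 * ‖(p n).2‖ ^ 2 - (κ + 1 + K) * ‖(p n).2‖ * ‖(p n).1‖ ≤
    -(κ + 1) * ‖(p n).1‖ ^ 2 - ‖(p n).1‖ * ‖(p n).2‖ - ‖(p n).1‖ * ‖b n‖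
  nlinarith

/-- `B` is an accretive perturbation of `Λ^{1/2}`, with `β = 0` in the lower bound. -/
theorem isMAccretive_factorOne (hB2 : IsMAccretive (sq B)) (hC : IsAccretive C)
    (hBC : LowerBoundCondition B C) (hdom : (sqrtOp (lam B C)).domain ≤ B.domain)
    (hB : IsAccretive B) : IsMAccretive (factorOne B C) := by
  obtain ⟨c, hc, h⟩ := exists_bounds_on_sqrtOp hB2 hC hBC hdom hB
  rw [factorOne, add_comm]
  exact (isMAccretive_lam hB2 hC hBC).isMAccretive_sqrtOp.add hB hdom hc le_rfl one_pos hc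
    fun x y z hy hz => (h x y z hy hz).2

theorem relSectorial_factorOne (hB2 : IsMAccretive (sq B)) (hC : IsAccretive C)
    (hBC : LowerBoundCondition B C) (hdom : (sqrtOp (lam B C)).domain ≤ B.domain)
    (hB : IsAccretive B) : RelSectorial (factorOne B C).graph := by
  obtain ⟨c, hc, h⟩ := exists_bounds_on_sqrtOp hB2 hC hBC hdom hB
  intro x w hw
  obtain ⟨z, y, hz, hy, rfl⟩ := mem_graph_add.1 hw
  have h1 := (h x y z hy hz).1
  have h2 := (isMAccretive_lam hB2 hC hBC).relSectorial_sqrtOp x y hy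
  rw [inner_add_right, Complex.add_im, Complex.add_re]
  exact (abs_add_le _ _).trans (add_le_add h1 h2)

theorem mem_nullSpace {T : H →ₗ.[ℂ] H} {x : H} : x ∈ nullSpace T ↔ (x, (0 : H)) ∈ T.graph := by
  rw [LinearPMap.mem_graph_iff]
  constructor
  · rintro ⟨hx, h⟩
    exact ⟨⟨x, hx⟩, rfl, h⟩
  · rintro ⟨⟨y, hy⟩, rfl, h⟩
    exact ⟨hy, h⟩

/-- If `Bx + Λ^{1/2} x = 0` then both forms have zero real part at `x`, and the sectoriality of
`Λ^{1/2}` gives `Λ^{1/2} x = 0`, hence also `Bx = 0`. -/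
theorem nullSpace_factorOne (hB2 : IsMAccretive (sq B)) (hC : IsAccretive C)
    (hBC : LowerBoundCondition B C) (hB : IsAccretive B) :
    nullSpace (factorOne B C) = nullSpace B ∩ nullSpace (sqrtOp (lam B C)) := by
  have hL := isMAccretive_lam hB2 hC hBC
  ext x
  rw [Set.mem_inter_iff, mem_nullSpace, mem_nullSpace, mem_nullSpace, factorOne, mem_graph_add]
  constructor
  · rintro ⟨z, y, hz, hy, h⟩
    have h1 := isAccretive_iff_graph.1 hB x z hz
    have h2 := hL.relSectorial_sqrtOp.relAccretive x y hy
    have h3 : (inner ℂ x z).re + (inner ℂ x y).re = 0 := by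
      rw [← Complex.add_re, ← inner_add_right, h, inner_zero_right, Complex.zero_re]
    obtain rfl := hL.relSectorial_sqrtOp.eq_zero_of_re_inner
      (dense_graph_fst hL.isMAccretive_sqrtOp.2.1) hy (by linarith)
    rw [add_zero] at h
    exact ⟨h ▸ hz, hy⟩
  · rintro ⟨hz, hy⟩
    exact ⟨0, 0, hz, hy, add_zero 0⟩

end Factor

end

/-! ### Exponentials of bounded accretive operators -/

section

variable {H : Type*} [NormedAddCommGroup H] [InnerProductSpace ℂ H] [CompleteSpace H]

section Exponential

variable {A A' : H →L[ℂ] H}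

theorem hasDerivAt_exp_smul_apply (A : H →L[ℂ] H) (x : H) (t : ℝ) :
    HasDerivAt (fun t : ℝ => NormedSpace.exp (t • A) x) (NormedSpace.exp (t • A) (A x)) t :=
  (((ContinuousLinearMap.apply ℂ H x).restrictScalars ℝ).hasFDerivAt).comp_hasDerivAt t
    (hasDerivAt_exp_smul_const A t)

/-- The exponential of minus a bounded accretive operator is a contraction. -/
theorem norm_exp_neg_apply_le (hA : ∀ x, 0 ≤ (inner ℂ x (A x)).re) (x : H) :
    ‖NormedSpace.exp (-A) x‖ ≤ ‖x‖ := by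
  let f : ℝ → H := fun t => NormedSpace.exp (t • -A) x
  have hf : ∀ t, HasDerivAt f (-A (f t)) t := fun t =>
    (((ContinuousLinearMap.apply ℂ H x).restrictScalars ℝ).hasFDerivAt).comp_hasDerivAt t
      (hasDerivAt_exp_smul_const' (-A) t)
  have hg : ∀ t, HasDerivAt (fun t => (inner ℂ (f t) (f t)).re)
      (inner ℂ (f t) (-A (f t)) + inner ℂ (-A (f t)) (f t)).re t := fun t =>
    Complex.reCLM.hasFDerivAt.comp_hasDerivAt t ((hf t).inner ℂ (hf t))
  have hanti : Antitone fun t => (inner ℂ (f t) (f t)).re := by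
    refine antitone_of_deriv_nonpos (fun t => (hg t).differentiableAt) fun t => ?_
    rw [(hg t).deriv, Complex.add_re, re_inner_comm (-A (f t)), inner_neg_right, Complex.neg_re]
    linarith [hA (f t)]
  have h1 := hanti zero_le_one
  have h0 : f 0 = x := by simp [f]
  have h2 : f 1 = NormedSpace.exp (-A) x := by simp [f]
  simp only [h0, h2, inner_self_eq_norm_sq_to_K, Complex.coe_algebraMap, ← Complex.ofReal_pow,
    Complex.ofReal_re] at h1
  exact le_of_sq_le_sq h1 (norm_nonneg _)

/-- The path `t ↦ e^{-((1 - t) A' + t A)} x` has speed at most `‖A x - A' x‖`. -/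
theorem norm_exp_neg_sub_exp_neg_apply_le (hA : ∀ x, 0 ≤ (inner ℂ x (A x)).re)
    (hA' : ∀ x, 0 ≤ (inner ℂ x (A' x)).re) (h : Commute A A') (x : H) :
    ‖NormedSpace.exp (-A) x - NormedSpace.exp (-A') x‖ ≤ ‖A x - A' x‖ := by
  let : NormedAlgebra ℚ (H →L[ℂ] H) := NormedAlgebra.restrictScalars ℚ ℂ _
  let f : ℝ → H := fun t => NormedSpace.exp (-A') (NormedSpace.exp (t • (A' - A)) x)
  have hf : ∀ t, HasDerivAt f (NormedSpace.exp (-A') (NormedSpace.exp (t • (A' - A)) ((A' - A) x)))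
      t := fun t =>
    (((NormedSpace.exp (-A')).restrictScalars ℝ).hasFDerivAt).comp_hasDerivAt t
      (hasDerivAt_exp_smul_apply (A' - A) x t)
  have hexp : ∀ (t : ℝ) (v : H), NormedSpace.exp (-A') (NormedSpace.exp (t • (A' - A)) v) =
      NormedSpace.exp (-((1 - t) • A' + t • A)) v := by
    intro t v
    have hc : Commute (-A') (t • (A' - A)) :=
      ((((Commute.refl A').sub_right h.symm)).smul_right t).neg_left
    have e : -((1 - t) • A' + t • A) = -A' + t • (A' - A) := by
      rw [sub_smul, one_smul, smul_sub]; abel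
    rw [e, NormedSpace.exp_add_of_commute hc]
    rfl
  have h1 := norm_image_sub_le_of_norm_deriv_le_segment_01' (f := f) (C := ‖A x - A' x‖)
    (fun t _ => (hf t).hasDerivWithinAt) (fun t ht => by
      rw [hexp, norm_sub_rev]
      refine norm_exp_neg_apply_le (fun v => ?_) _
      have e : ((1 - t) • A' + t • A) v = ((1 - t : ℝ) : ℂ) • A' v + (t : ℂ) • A v := rfl
      rw [e, inner_add_right, inner_smul_right, inner_smul_right, Complex.add_re,
        Complex.re_ofReal_mul, Complex.re_ofReal_mul]
      exact add_nonneg (mul_nonneg (by linarith [ht.2]) (hA' v)) (mul_nonneg ht.1 (hA v)))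
  have h2 : f 1 = NormedSpace.exp (-A) x := by simp [f, hexp]
  have h3 : f 0 = NormedSpace.exp (-A') x := by simp [f, hexp]
  rwa [h2, h3] at h1

theorem norm_exp_neg_apply_sub_le (hA : ∀ x, 0 ≤ (inner ℂ x (A x)).re) (x : H) :
    ‖NormedSpace.exp (-A) x - x‖ ≤ ‖A x‖ := by
  simpa using norm_exp_neg_sub_exp_neg_apply_le (A' := 0) hA (by simp) (Commute.zero_right A) x

/-- A first order expansion of the exponential. The vector `v` stands for a smoother
approximation of `A x`; it permits passage to limits in which `A (A x)` is not controlled. -/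
theorem norm_exp_neg_apply_sub_add_le (hA : ∀ x, 0 ≤ (inner ℂ x (A x)).re) (x v : H) :
    ‖NormedSpace.exp (-A) x - x + A x‖ ≤ 2 * ‖A x - v‖ + ‖A v‖ := by
  let f : ℝ → H := fun t => NormedSpace.exp (t • -A) x + t • A x
  have hf : ∀ t, HasDerivAt f (NormedSpace.exp (t • -A) ((-A) x) + (1 : ℝ) • A x) t := fun t =>
    (hasDerivAt_exp_smul_apply (-A) x t).add ((hasDerivAt_id t).smul_const (A x))
  have h1 := norm_image_sub_le_of_norm_deriv_le_segment_01' (f := f)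
    (C := 2 * ‖A x - v‖ + ‖A v‖) (fun t _ => (hf t).hasDerivWithinAt) (fun t ht => by
      have hAt : ∀ u, 0 ≤ (inner ℂ u ((t • A) u)).re := fun u => by
        change 0 ≤ (inner ℂ u ((t : ℂ) • A u)).re
        rw [inner_smul_right, Complex.re_ofReal_mul]
        exact mul_nonneg ht.1 (hA u)
      have b1 := norm_exp_neg_apply_le hAt (A x - v)
      have b2 := norm_exp_neg_apply_sub_le hAt v
      have b3 : ‖(t • A) v‖ ≤ ‖A v‖ := by
        change ‖t • A v‖ ≤ _
        rw [norm_smul, Real.norm_of_nonneg ht.1]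
        exact mul_le_of_le_one_left (norm_nonneg _) ht.2.le
      have e : NormedSpace.exp (t • -A) ((-A) x) + (1 : ℝ) • A x = (A x - v)
          - NormedSpace.exp (-(t • A)) (A x - v) - (NormedSpace.exp (-(t • A)) v - v) := by
        rw [smul_neg, neg_apply, map_neg, map_sub, one_smul]
        abel
      rw [e]
      refine (norm_sub_le _ _).trans ((add_le_add_left (norm_sub_le _ _) _).trans ?_)
      linarith)
  have h2 : f 1 - f 0 = NormedSpace.exp (-A) x - x + A x := by
    simp only [f, one_smul, zero_smul, NormedSpace.exp_zero, one_apply_eq_self]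
    abel
  rwa [h2] at h1

end Exponential

/-! ### Holomorphic families of bounded operators -/

/-- A locally bounded family of bounded operators that is strongly holomorphic is holomorphic for
the operator norm. -/
theorem differentiableAt_of_forall_apply {F : ℂ → H →L[ℂ] H} {w : ℂ} {ρ c : ℝ} (hρ : 0 < ρ)
    (hc : 0 < c) (hb : ∀ z ∈ Metric.ball w ρ, ∀ x, ‖F z x‖ ≤ c * ‖x‖)
    (hd : ∀ x, DifferentiableOn ℂ (fun z => F z x) (Metric.ball w ρ)) : DifferentiableAt ℂ F w := by
  have hw : Metric.ball w ρ ∈ 𝓝 w := Metric.ball_mem_nhds w hρ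
  let f : H → ℂ → H := fun x z => F z x
  have hda : ∀ x, DifferentiableAt ℂ (f x) w := fun x => (hd x).differentiableAt hw
  -- two applications of the Schwarz lemma bound the difference quotient and its increments
  have h1 : ∀ x, ∀ z ∈ Metric.ball w ρ, ‖dslope (f x) w z‖ ≤ 2 * c / ρ * ‖x‖ := by
    intro x z hz
    have h2 := Complex.norm_dslope_le_div_of_mapsTo_ball (R₂ := 2 * c * ‖x‖) (hd x)
      (fun u hu => by
        rw [Metric.mem_closedBall, dist_eq_norm]
        refine (norm_sub_le _ _).trans ?_
        have := hb u hu x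
        have := hb w (Metric.mem_ball_self hρ) x
        linarith) hz
    refine h2.trans_eq ?_
    field_simp
  have h2 : ∀ x, ∀ z ∈ Metric.ball w ρ,
      ‖dslope (f x) w z - deriv (f x) w‖ ≤ 4 * c / ρ ^ 2 * ‖x‖ * ‖z - w‖ := by
    intro x z hz
    have h3 := Complex.dist_le_div_mul_dist_of_mapsTo_ball (R₂ := 4 * c / ρ * ‖x‖)
      (((Complex.differentiableOn_dslope hw).2 (hd x))) (fun u hu => by
        rw [Metric.mem_closedBall, dist_eq_norm]
        refine (norm_sub_le _ _).trans ?_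
        have := h1 x u hu
        have := h1 x w (Metric.mem_ball_self hρ)
        have e : 4 * c / ρ * ‖x‖ = 2 * c / ρ * ‖x‖ + 2 * c / ρ * ‖x‖ := by ring
        change ‖dslope (f x) w u‖ + ‖dslope (f x) w w‖ ≤ _
        linarith) hz
    rw [dist_eq_norm, dist_eq_norm] at h3
    change ‖dslope (f x) w z - dslope (f x) w w‖ ≤ _ at h3
    rw [dslope_same] at h3
    refine h3.trans_eq ?_
    field_simp
  let D : H →L[ℂ] H := LinearMap.mkContinuous
    { toFun := fun x => deriv (f x) w
      map_add' := fun x y => by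
        rw [← deriv_add (hda x) (hda y)]
        congr 1
        ext z
        simp [f]
      map_smul' := fun a x => by
        rw [RingHom.id_apply, ← deriv_const_smul a (hda x)]
        congr 1
        ext z
        simp [f] } (2 * c / ρ) (fun x => by
      have := h1 x w (Metric.mem_ball_self hρ)
      rwa [dslope_same] at this)
  refine HasDerivAt.differentiableAt (f' := D) ?_
  rw [hasDerivAt_iff_isLittleO]
  refine Asymptotics.IsBigO.trans_isLittleO (g := fun z => ‖z - w‖ ^ 2) ?_ ?_
  · refine Asymptotics.IsBigO.of_bound (4 * c / ρ ^ 2) ?_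
    filter_upwards [hw] with z hz
    refine ContinuousLinearMap.opNorm_le_bound _ (by positivity) fun x => ?_
    have e : (F z - F w - (z - w) • D) x = (z - w) • (dslope (f x) w z - deriv (f x) w) := by
      rw [smul_sub, sub_smul_dslope]
      rfl
    rw [e, norm_smul, norm_pow, norm_norm]
    have := mul_le_mul_of_nonneg_left (h2 x z hz) (norm_nonneg (z - w))
    refine this.trans_eq ?_
    ring
  · rw [Asymptotics.isLittleO_iff]
    intro ε hε
    filter_upwards [Metric.ball_mem_nhds w hε] with z hz
    rw [norm_pow, norm_norm, pow_two]
    gcongr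
    rw [← dist_eq_norm]
    exact (Metric.mem_ball.1 hz).le

end

/-! ### The semigroup generated by minus a sectorial m-accretive operator -/

section

variable {H : Type*} [NormedAddCommGroup H] [InnerProductSpace ℂ H] [CompleteSpace H]
  {T : H →ₗ.[ℂ] H}

theorem re_mul_nonneg_of_abs_im_le {z w : ℂ} (hz : |z.im| ≤ z.re) (hw : |w.im| ≤ w.re) :
    0 ≤ (z * w).re := by
  rw [Complex.mul_re, sub_nonneg]
  refine (le_abs_self _).trans ?_
  rw [abs_mul]
  exact mul_le_mul hz hw (abs_nonneg _) ((abs_nonneg _).trans hz)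

/-- With `u = (k + T)⁻¹ x` and `v = T u` one has `⟨v, x⟩ = k ⟨Tu, u⟩ + ‖v‖²`. -/
theorem RelSectorial.abs_im_inner_approx_le (hs : RelSectorial T.graph) (hT : IsMAccretive T)
    (n : ℕ) (x : H) : |(inner ℂ x (approx T n x)).im| ≤ (inner ℂ x (approx T n x)).re := by
  have hk : 0 < (n : ℝ) + 1 := by positivity
  set k : ℝ := (n : ℝ) + 1
  have h1 := hs _ _ (hT.res_yos_mem hk x)
  set u := res T k x
  set v := yos T k x
  have e : inner ℂ x v = (k : ℂ) * inner ℂ u v + ((‖v‖ ^ 2 : ℝ) : ℂ) := by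
    nth_rewrite 1 [← smul_res_add_yos T k x]
    rw [inner_add_left, inner_smul_left, Complex.conj_ofReal, inner_self_eq_norm_sq_to_K]
    simp [u, v]
  have e2 : inner ℂ x (approx T n x) =
      (k : ℂ) * inner ℂ x v + ((1 / k * ‖x‖ ^ 2 : ℝ) : ℂ) := by
    rw [approx_apply, inner_add_right, inner_smul_right, inner_smul_right,
      inner_self_eq_norm_sq_to_K]
    simp [v, k]
  rw [e2, e]
  simp only [Complex.add_im, Complex.im_ofReal_mul, Complex.ofReal_im, add_zero, Complex.add_re,
    Complex.re_ofReal_mul, Complex.ofReal_re, abs_mul, abs_of_pos hk]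
  have h2 : k * (k * |(inner ℂ u v).im|) ≤ k * (k * (inner ℂ u v).re) := by gcongr
  have h3 : 0 ≤ k * ‖v‖ ^ 2 := by positivity
  have h4 : 0 ≤ 1 / k * ‖x‖ ^ 2 := by positivity
  linarith

theorem RelSectorial.re_inner_smul_approx (hs : RelSectorial T.graph) (hT : IsMAccretive T)
    (n : ℕ) {z : ℂ} (hz : |z.im| ≤ z.re) (x : H) : 0 ≤ (inner ℂ x ((z • approx T n) x)).re := by
  rw [smul_apply, inner_smul_right]
  exact re_mul_nonneg_of_abs_im_le hz (hs.abs_im_inner_approx_le hT n x)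

theorem IsMAccretive.commute_approx (hT : IsMAccretive T) {M : H →L[ℂ] H}
    (hM : ∀ x y, (x, y) ∈ T.graph → (M x, M y) ∈ T.graph) (n : ℕ) : Commute M (approx T n) := by
  ext x
  change M (approx T n x) = approx T n (M x)
  have hk : 0 < (n : ℝ) + 1 := by positivity
  simp only [approx_apply, yos_apply, map_add, map_smul, map_sub]
  rw [hT.commute_res hM (by simpa using hk)]

theorem IsMAccretive.approx_mem_graph (hT : IsMAccretive T) (n : ℕ) {x y : H}
    (h : (x, y) ∈ T.graph) : (approx T n x, approx T n y) ∈ T.graph := by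
  have hk : 0 < (n : ℝ) + 1 := by positivity
  have h1 := hT.res_mem_graph (μ := ((n : ℝ) + 1 : ℝ)) (by simpa using hk) h
  have h2 := T.graph.smul_mem (((n : ℝ) + 1 : ℝ) : ℂ)
    (T.graph.sub_mem h (T.graph.smul_mem (((n : ℝ) + 1 : ℝ) : ℂ) h1))
  exact T.graph.add_mem h2 (T.graph.smul_mem ((1 / ((n : ℝ) + 1) : ℝ) : ℂ) h)

theorem IsMAccretive.commute_approx_approx (hT : IsMAccretive T) (m n : ℕ) :
    Commute (approx T m) (approx T n) :=
  hT.commute_approx (fun _ _ h => hT.approx_mem_graph m h) n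

/-- The exponential `e^{-z A}`, where `A` is the `n`-th bounded approximation of `T`. -/
def expApprox (T : H →ₗ.[ℂ] H) (n : ℕ) (z : ℂ) : H →L[ℂ] H :=
  NormedSpace.exp (-(z • approx T n))

open scoped Classical in
/-- The semigroup `e^{-z T}` as the strong limit of the exponentials of the bounded
approximations; zero if there is no limit. -/
def semigroup (T : H →ₗ.[ℂ] H) (z : ℂ) : H →L[ℂ] H :=
  if h : ∃ S : H →L[ℂ] H, ∀ x, Tendsto (fun n => expApprox T n z x) atTop (𝓝 (S x)) then h.choose
  else 0

section Sectorial

variable {z w : ℂ}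

theorem RelSectorial.norm_expApprox_le (hs : RelSectorial T.graph) (hT : IsMAccretive T) (n : ℕ)
    (hz : |z.im| ≤ z.re) (x : H) : ‖expApprox T n z x‖ ≤ ‖x‖ :=
  norm_exp_neg_apply_le (hs.re_inner_smul_approx hT n hz) x

theorem RelSectorial.norm_expApprox_sub_le (hs : RelSectorial T.graph) (hT : IsMAccretive T)
    (m n : ℕ) (hz : |z.im| ≤ z.re) (x : H) :
    ‖expApprox T m z x - expApprox T n z x‖ ≤ ‖z‖ * ‖approx T m x - approx T n x‖ := by
  refine (norm_exp_neg_sub_exp_neg_apply_le (hs.re_inner_smul_approx hT m hz)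
    (hs.re_inner_smul_approx hT n hz)
    (((hT.commute_approx_approx m n).smul_left z).smul_right z) x).trans_eq ?_
  rw [smul_apply, smul_apply, ← smul_sub, norm_smul]

theorem RelSectorial.cauchySeq_expApprox (hs : RelSectorial T.graph) (hT : IsMAccretive T)
    (hz : |z.im| ≤ z.re) (x : H) : CauchySeq fun n => expApprox T n z x := by
  rw [Metric.cauchySeq_iff']
  intro ε hε
  obtain ⟨u, hu, hxu⟩ := hT.2.1.exists_dist_lt x (show 0 < ε / 4 by positivity)
  obtain ⟨y, hy⟩ := LinearPMap.mem_domain_iff.1 hu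
  have hc := (hT.tendsto_approx hy).cauchySeq
  rw [Metric.cauchySeq_iff'] at hc
  obtain ⟨N, hN⟩ := hc (ε / (2 * (‖z‖ + 1))) (by positivity)
  refine ⟨N, fun n hn => ?_⟩
  have h1 := hN n hn
  rw [dist_eq_norm, lt_div_iff₀ (by positivity)] at h1
  rw [dist_eq_norm] at hxu ⊢
  have e : expApprox T n z x - expApprox T N z x = expApprox T n z (x - u)
      - expApprox T N z (x - u) + (expApprox T n z u - expApprox T N z u) := by
    simp only [map_sub]; abel
  have h2 := hs.norm_expApprox_le hT n hz (x - u)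
  have h3 := hs.norm_expApprox_le hT N hz (x - u)
  have h4 := hs.norm_expApprox_sub_le hT n N hz u
  rw [e]
  refine (norm_add_le _ _).trans_lt ?_
  have h5 := norm_sub_le (expApprox T n z (x - u)) (expApprox T N z (x - u))
  have h6 := norm_nonneg (approx T n u - approx T N u)
  linarith

theorem RelSectorial.tendsto_expApprox (hs : RelSectorial T.graph) (hT : IsMAccretive T)
    (hz : |z.im| ≤ z.re) (x : H) :
    Tendsto (fun n => expApprox T n z x) atTop (𝓝 (semigroup T z x)) := by
  have h : ∃ S : H →L[ℂ] H, ∀ x, Tendsto (fun n => expApprox T n z x) atTop (𝓝 (S x)) := by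
    choose f hf using fun x => cauchySeq_tendsto_of_complete (hs.cauchySeq_expApprox hT hz x)
    exact ⟨continuousLinearMapOfTendsto (fun n => expApprox T n z) (tendsto_pi_nhds.2 hf), hf⟩
  rw [semigroup, dif_pos h]
  exact h.choose_spec x

theorem RelSectorial.norm_semigroup_le (hs : RelSectorial T.graph) (hT : IsMAccretive T)
    (hz : |z.im| ≤ z.re) (x : H) : ‖semigroup T z x‖ ≤ ‖x‖ :=
  le_of_tendsto (hs.tendsto_expApprox hT hz x).norm
    (Eventually.of_forall fun n => hs.norm_expApprox_le hT n hz x)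

theorem RelSectorial.semigroup_zero (hs : RelSectorial T.graph) (hT : IsMAccretive T) :
    semigroup T 0 = ContinuousLinearMap.id ℂ H := by
  ext x
  refine tendsto_nhds_unique (hs.tendsto_expApprox hT (by simp) x) ?_
  simp [expApprox]

theorem RelSectorial.semigroup_add (hs : RelSectorial T.graph) (hT : IsMAccretive T)
    (hz : |z.im| ≤ z.re) (hw : |w.im| ≤ w.re) :
    semigroup T (z + w) = (semigroup T z).comp (semigroup T w) := by
  let : NormedAlgebra ℚ (H →L[ℂ] H) := NormedAlgebra.restrictScalars ℚ ℂ _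
  ext x
  have hzw : |(z + w).im| ≤ (z + w).re := (abs_add_le _ _).trans (add_le_add hz hw)
  refine tendsto_nhds_unique (hs.tendsto_expApprox hT hzw x) ?_
  have e : ∀ n, expApprox T n (z + w) x = expApprox T n z (expApprox T n w x) := by
    intro n
    have hc : Commute (-(z • approx T n)) (-(w • approx T n)) :=
      (((Commute.refl (approx T n)).smul_left z).smul_right w).neg_left.neg_right
    rw [expApprox, add_smul, neg_add, NormedSpace.exp_add_of_commute hc]
    rfl
  simp only [e]
  have h1 := hs.tendsto_expApprox hT hz (semigroup T w x)
  have h2 := tendsto_iff_norm_sub_tendsto_zero.1 (hs.tendsto_expApprox hT hw x)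
  have h3 : Tendsto (fun n => expApprox T n z (expApprox T n w x - semigroup T w x)) atTop (𝓝 0) :=
    squeeze_zero_norm (fun n => hs.norm_expApprox_le hT n hz _) h2
  have h4 := h3.add h1
  simp only [map_sub, sub_add_cancel, zero_add] at h4
  exact h4

theorem RelSectorial.norm_semigroup_sub_expApprox_le (hs : RelSectorial T.graph)
    (hT : IsMAccretive T) (hz : |z.im| ≤ z.re) (n : ℕ) {x y : H} (h : (x, y) ∈ T.graph) :
    ‖semigroup T z x - expApprox T n z x‖ ≤ ‖z‖ * ‖y - approx T n x‖ :=
  le_of_tendsto_of_tendsto' ((hs.tendsto_expApprox hT hz x).sub_const _).norm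
    (((hT.tendsto_approx h).sub_const _).norm.const_mul _)
    fun m => hs.norm_expApprox_sub_le hT m n hz x

theorem RelSectorial.norm_semigroup_sub_le (hs : RelSectorial T.graph) (hT : IsMAccretive T)
    (hz : |z.im| ≤ z.re) {x y : H} (h : (x, y) ∈ T.graph) :
    ‖semigroup T z x - x‖ ≤ ‖z‖ * ‖y‖ :=
  le_of_tendsto_of_tendsto' ((hs.tendsto_expApprox hT hz x).sub_const _).norm
    ((hT.tendsto_approx h).norm.const_mul _) fun n => by
      refine (norm_exp_neg_apply_sub_le (hs.re_inner_smul_approx hT n hz) x).trans_eq ?_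
      rw [smul_apply, norm_smul]

/-- A first order expansion of the semigroup at `0`, for `x` in the domain and an approximation
`v` of `T x` in the domain. -/
theorem RelSectorial.norm_semigroup_sub_add_le (hs : RelSectorial T.graph) (hT : IsMAccretive T)
    {t : ℝ} (ht : 0 < t) {x y v w : H} (h : (x, y) ∈ T.graph) (hv : (v, w) ∈ T.graph) :
    ‖((t⁻¹ : ℝ) : ℂ) • (semigroup T t x - x) + y‖ ≤ 2 * ‖y - v‖ + t * ‖w‖ := by
  have htz : |(t : ℂ).im| ≤ (t : ℂ).re := by simpa using ht.le
  refine le_of_tendsto_of_tendsto' ((((hs.tendsto_expApprox hT htz x).sub_const x).const_smul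
    ((t⁻¹ : ℝ) : ℂ)).add (hT.tendsto_approx h)).norm
    ((((hT.tendsto_approx h).sub_const v).norm.const_mul 2).add
      ((hT.tendsto_approx hv).norm.const_mul t)) fun n => ?_
  have h1 := norm_exp_neg_apply_sub_add_le (hs.re_inner_smul_approx hT n htz) x ((t : ℂ) • v)
  have htc : (t : ℂ) ≠ 0 := by exact_mod_cast ht.ne'
  have e1 : NormedSpace.exp (-((t : ℂ) • approx T n)) x - x
      + ((t : ℂ) • approx T n) x
      = (t : ℂ) • (((t⁻¹ : ℝ) : ℂ) • (expApprox T n t x - x) + approx T n x) := by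
    rw [smul_add, Complex.ofReal_inv, smul_inv_smul₀ htc]
    rfl
  rw [e1, map_smul, smul_apply, smul_apply, ← smul_sub] at h1
  simp only [norm_smul, Complex.norm_real, Real.norm_of_nonneg ht.le] at h1
  refine le_of_mul_le_mul_left (h1.trans_eq ?_) ht
  ring

theorem RelSectorial.differentiableOn_semigroup_apply (hs : RelSectorial T.graph)
    (hT : IsMAccretive T) {w : ℂ} {ρ : ℝ} (hρ : ∀ z ∈ Metric.ball w ρ, |z.im| ≤ z.re) (x : H) :
    DifferentiableOn ℂ (fun z => semigroup T z x) (Metric.ball w ρ) := by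
  have key : ∀ x ∈ T.domain, DifferentiableOn ℂ (fun z => semigroup T z x) (Metric.ball w ρ) := by
    intro x hx
    obtain ⟨y, hy⟩ := LinearPMap.mem_domain_iff.1 hx
    refine TendstoLocallyUniformlyOn.differentiableOn (F := fun n z => expApprox T n z x)
      (φ := atTop) (TendstoUniformlyOn.tendstoLocallyUniformlyOn ?_)
      (Eventually.of_forall fun n => ?_) Metric.isOpen_ball
    · rw [Metric.tendstoUniformlyOn_iff]
      intro ε hε
      have hK : 0 < ‖w‖ + |ρ| + 1 := by positivity
      filter_upwards [Metric.tendsto_nhds.1 (hT.tendsto_approx hy) (ε / (‖w‖ + |ρ| + 1))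
        (by positivity)] with n hn z hz
      rw [dist_comm, dist_eq_norm, lt_div_iff₀ hK] at hn
      rw [dist_eq_norm]
      refine (hs.norm_semigroup_sub_expApprox_le hT (hρ z hz) n hy).trans_lt (lt_of_le_of_lt ?_ hn)
      rw [mul_comm]
      gcongr
      have h1 : ‖z - w‖ < ρ := by rwa [← dist_eq_norm]
      have h2 := norm_add_le w (z - w)
      rw [add_sub_cancel] at h2
      linarith [le_abs_self ρ]
    · have e : (fun z => expApprox T n z x)
          = fun z : ℂ => NormedSpace.exp (z • -approx T n) x := by
        simp only [expApprox, smul_neg]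
      intro z _
      rw [e]
      exact ((ContinuousLinearMap.apply ℂ H x).hasFDerivAt.comp_hasDerivAt z
        (hasDerivAt_exp_smul_const _ z)).differentiableAt.differentiableWithinAt
  obtain ⟨u, hu, hux⟩ := mem_closure_iff_seq_limit.1 (hT.2.1 x)
  refine TendstoLocallyUniformlyOn.differentiableOn (F := fun n z => semigroup T z (u n))
    (φ := atTop) (TendstoUniformlyOn.tendstoLocallyUniformlyOn ?_)
    (Eventually.of_forall fun n => key _ (hu n)) Metric.isOpen_ball
  rw [Metric.tendstoUniformlyOn_iff]
  intro ε hε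
  filter_upwards [Metric.tendsto_nhds.1 hux ε hε] with n hn z hz
  rw [dist_eq_norm, ← map_sub]
  rw [dist_comm, dist_eq_norm] at hn
  exact (hs.norm_semigroup_le hT (hρ z hz) _).trans_lt hn

theorem RelSectorial.differentiableOn_semigroup (hs : RelSectorial T.graph) (hT : IsMAccretive T) :
    DifferentiableOn ℂ (semigroup T) {z | |z.im| < z.re} := by
  have ho : IsOpen {z : ℂ | |z.im| < z.re} := isOpen_lt (by fun_prop) (by fun_prop)
  intro w hw
  obtain ⟨ρ, hρ, h⟩ := Metric.isOpen_iff.1 ho w hw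
  have h' : ∀ z ∈ Metric.ball w ρ, |z.im| ≤ z.re := fun z hz => (h hz).le
  exact (differentiableAt_of_forall_apply hρ one_pos
    (fun z hz x => by simpa using hs.norm_semigroup_le hT (h' z hz) x)
    (fun x => hs.differentiableOn_semigroup_apply hT h' x)).differentiableWithinAt

theorem RelSectorial.tendsto_semigroup (hs : RelSectorial T.graph) (hT : IsMAccretive T) (x : H) :
    Tendsto (fun z => semigroup T z x) (𝓝[{z | |z.im| < z.re}] 0) (𝓝 x) := by
  refine tendsto_of_dense (A₀ := ContinuousLinearMap.id ℂ H) (c := 1) ?_ hT.2.1 (fun x hx => ?_) x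
  · filter_upwards [self_mem_nhdsWithin] with z hz x
    simpa using hs.norm_semigroup_le hT (le_of_lt hz) x
  · obtain ⟨y, hy⟩ := LinearPMap.mem_domain_iff.1 hx
    rw [tendsto_iff_norm_sub_tendsto_zero]
    refine squeeze_zero' (g := fun z => ‖z‖ * ‖y‖) (Eventually.of_forall fun _ => norm_nonneg _) ?_
      ?_
    · filter_upwards [self_mem_nhdsWithin] with z hz
      exact hs.norm_semigroup_sub_le hT (le_of_lt hz) hy
    · have h : Continuous fun z : ℂ => ‖z‖ * ‖y‖ := by fun_prop
      have := h.tendsto 0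
      simp only [norm_zero, zero_mul] at this
      exact this.mono_left nhdsWithin_le_nhds

/-- The generator of the semigroup extends `-T`. -/
theorem RelSectorial.tendsto_difference_quotient (hs : RelSectorial T.graph) (hT : IsMAccretive T)
    {x y : H} (h : (x, y) ∈ T.graph) :
    Tendsto (fun t : ℝ => ((t⁻¹ : ℝ) : ℂ) • (semigroup T (t : ℂ) x - x)) (𝓝[>] (0 : ℝ))
      (𝓝 (-y)) := by
  rw [Metric.tendsto_nhds]
  intro ε hε
  obtain ⟨v, hv, hyv⟩ := hT.2.1.exists_dist_lt y (show 0 < ε / 4 by positivity)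
  obtain ⟨w, hw⟩ := LinearPMap.mem_domain_iff.1 hv
  have hδ : 0 < ε / (2 * (‖w‖ + 1)) := by positivity
  filter_upwards [Ioo_mem_nhdsGT hδ] with t ht
  have h1 := hs.norm_semigroup_sub_add_le hT ht.1 h hw
  rw [dist_eq_norm, sub_neg_eq_add]
  rw [dist_eq_norm] at hyv
  have h2 := (lt_div_iff₀ (by positivity)).1 ht.2
  have h3 := ht.1
  nlinarith [norm_nonneg w]

/-- The generator of a contraction semigroup is dissipative, so it cannot properly extend the
operator `-T`, for which `1 + T` is onto. -/
theorem RelSectorial.mem_graph_of_tendsto (hs : RelSectorial T.graph) (hT : IsMAccretive T)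
    {x y : H} (h : Tendsto (fun t : ℝ => ((t⁻¹ : ℝ) : ℂ) • (semigroup T (t : ℂ) x - x))
      (𝓝[>] (0 : ℝ)) (𝓝 y)) : (x, -y) ∈ T.graph := by
  obtain ⟨u, v, huv, hf⟩ := hT.exists_mem_graph (μ := 1) (by simp) (x - y)
  rw [one_smul] at hf
  have h1 := h.sub (hs.tendsto_difference_quotient hT huv)
  have e : y - -v = x - u := by
    rw [sub_neg_eq_add, eq_sub_iff_add_eq, ← eq_sub_iff_add_eq.1 hf]; abel
  have h2 : Tendsto (fun t : ℝ => (inner ℂ (x - u)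
      (((t⁻¹ : ℝ) : ℂ) • (semigroup T (t : ℂ) (x - u) - (x - u)))).re) (𝓝[>] (0 : ℝ))
      (𝓝 (inner ℂ (x - u) (x - u)).re) := by
    refine (Complex.continuous_re.tendsto _).comp (Tendsto.inner tendsto_const_nhds ?_)
    rw [e] at h1
    refine h1.congr fun t => ?_
    rw [← smul_sub, map_sub]
    congr 1
    abel
  have h3 : (inner ℂ (x - u) (x - u)).re ≤ 0 := by
    refine le_of_tendsto h2 ?_
    filter_upwards [self_mem_nhdsWithin] with t ht
    have ht : 0 < t := ht
    rw [inner_smul_right, Complex.re_ofReal_mul, inner_sub_right, Complex.sub_re]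
    have h4 := hs.norm_semigroup_le hT (z := t) (by simpa using ht.le) (x - u)
    have h5 : (inner ℂ (x - u) (semigroup T t (x - u))).re ≤ ‖x - u‖ * ‖semigroup T t (x - u)‖ :=
      re_inner_le_norm (𝕜 := ℂ) _ _
    have h6 : (inner ℂ (x - u) (x - u)).re = ‖x - u‖ * ‖x - u‖ :=
      inner_self_eq_norm_mul_norm (𝕜 := ℂ) _
    rw [h6]
    refine mul_nonpos_of_nonneg_of_nonpos (by positivity) ?_
    nlinarith [norm_nonneg (x - u)]
  have h7 : (inner ℂ (x - u) (x - u)).re = ‖x - u‖ * ‖x - u‖ :=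
      inner_self_eq_norm_mul_norm (𝕜 := ℂ) _
  have h8 : ‖x - u‖ = 0 := by nlinarith [norm_nonneg (x - u)]
  obtain rfl : x = u := sub_eq_zero.1 (norm_eq_zero.1 h8)
  have h9 : v = -y := by
    rw [sub_eq_add_neg] at hf
    exact add_left_cancel hf
  exact h9 ▸ huv

/-- A sectorial m-accretive operator of angle `π / 4` generates a holomorphic semigroup of
angle `π / 4`. -/
theorem generatesHolomorphicSemigroup (hT : IsMAccretive T) (hs : RelSectorial T.graph) :
    GeneratesHolomorphicSemigroup (Real.pi / 4) (-T) := by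
  refine ⟨semigroup T, ⟨hs.semigroup_zero hT, ?_, ?_, ?_⟩, fun x y => ?_⟩
  · rw [openSector_pi_div_four]
    exact fun z hz w hw => hs.semigroup_add hT (le_of_lt hz) (le_of_lt hw)
  · rw [openSector_pi_div_four]
    exact hs.differentiableOn_semigroup hT
  · rw [openSector_pi_div_four]
    exact hs.tendsto_semigroup hT
  · constructor
    · rintro ⟨hx, rfl⟩
      exact hs.tendsto_difference_quotient hT (T.mem_graph ⟨x, hx⟩)
    · intro h
      obtain ⟨u, rfl, hu⟩ := (LinearPMap.mem_graph_iff _).1 (hs.mem_graph_of_tendsto hT h)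
      exact ⟨u.2, neg_eq_iff_eq_neg.2 hu⟩

end Sectorial

end

end PencilFactor

end

theorem proposition3p6 {H : Type*} [NormedAddCommGroup H] [InnerProductSpace ℂ H] [CompleteSpace H]
    (B C : H →ₗ.[ℂ] H)
    (hB2 : PencilFactor.IsMAccretive (PencilFactor.sq B))
    (hC : PencilFactor.IsAccretive C)
    (hBC : PencilFactor.LowerBoundCondition B C)
    (hdom : (PencilFactor.sqrtOp (PencilFactor.lam B C)).domain ≤ B.domain)
    (hB : PencilFactor.IsAccretive B) :
    PencilFactor.IsMSectorial (Real.pi / 4) (PencilFactor.factorOne B C) ∧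
    PencilFactor.GeneratesHolomorphicSemigroup (Real.pi / 4) (-PencilFactor.factorOne B C) ∧
    ∀ θ : ℝ, 0 ≤ θ → θ < Real.pi / 2 → PencilFactor.IsSectorial θ B →
      PencilFactor.nullSpace (PencilFactor.factorOne B C) =
        PencilFactor.nullSpace B ∩
          PencilFactor.nullSpace (PencilFactor.sqrtOp (PencilFactor.lam B C)) := by
  have hs := PencilFactor.relSectorial_factorOne hB2 hC hBC hdom hB
  have hm := PencilFactor.isMAccretive_factorOne hB2 hC hBC hdom hB
  exact ⟨⟨hs.isSectorial, hm⟩, PencilFactor.generatesHolomorphicSemigroup hm hs,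
    fun _ _ _ _ => PencilFactor.nullSpace_factorOne hB2 hC hBC hB⟩
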